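/- Conventions. Let $\Omega$ be a (Hausdorff) smooth manifold of dimension $n$, with complexified tangent bundle $\mathbb{C}T\Omega$. Functions, maps and vector fields are called Lipschitz if they are locally Lipschitz in local coordinates; "almost every" refers to the Lebesgue measure class of the charts. The bracket of Lipschitz vector fields is defined almost everywhere and is locally bounded. A Lipschitz subbundle $\mathcal{S}\subset\mathbb{C}T\Omega$ is a family of complex subspaces $\mathcal{S}_p\subset\mathbb{C}T_p\Omega$ that has, near each point, a frame of Lipschitz complex vector fields; $\overline{\mathcal{S}}_p=\{u-iv: u+iv\in\mathcal{S}_p,\ u,v\in T_p\Omega\}$. We call $\mathcal{S}$ involutive if for all Lipschitz sections $X,Y$ of $\mathcal{S}$ $$[X,Y]\in\mathcal{S}\quad\text{and}\quad [X,\overline{Y}]\in\mathcal{S}+\overline{\mathcal{S}}\qquad\text{almost everywhere.}\tag{6.1}$$ Put $\mathcal{V}_p=\mathcal{S}_p\cap T_p\Omega$ and $\mathcal{E}_p=\{w+\overline{w}: w\in\mathcal{S}_p\}\subset T_p\Omega$. A Lipschitz Levi-flat CR structure on a manifold is an involutive Lipschitz subbundle $\mathcal{S}$ of its complexified tangent bundle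 with $\mathcal{S}\cap\overline{\mathcal{S}}=0$. Hypothesis V. Each $p\in\Omega$ has a neighborhood on which there is a Lipschitz frame field $\{X_1,\dots,X_k\}$ for $\mathcal{E}$ such that $\{X_1,\dots,X_\ell\}$ is a frame field for $\mathcal{V}$ and $[X_i,X_j]=0$ almost everywhere for $1\le i,j\le k$. Proposition 6.1. Assume that $\mathcal{S}$ and $\mathcal{S}+\overline{\mathcal{S}}$ are Lipschitz subbundles of $\mathbb{C}T\Omega$, that $\mathcal{S}$ satisfies the involutivity condition (6.1), and that Hypothesis V holds. Let $p\in\Omega$ and $\ell=\dim\mathcal{V}_p$. Then there are an open neighborhood $U_1$ of $p$, an open set $\widetilde{U}_0\subset\mathbb{R}^{n-\ell}$ carrying a Lipschitz Levi-flat CR structure $\widetilde{\mathcal{S}}_0\subset\mathbb{C}T\widetilde{U}_0$, and a Lipschitz fibration $\pi$ of $U_1$ onto $\widetilde{U}_0$ (a surjective Lipschitz map that over a neighborhood of each point of $\widetilde{U}_0$ is bi-Lipschitz equivalent to a product projection with fiber an open subset of $\mathbb{R}^\ell$), such that $$\mathcal{S}\big|_{U_1}=(D\pi)^{-1}\,\widetilde{\mathcal{S}}_0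 .\tag{6.20}$$ Here (6.20) means that for every $x\in U_1$, $\mathcal{S}_x$ is the set of all $u+iv$ with $u,v\in T_x\Omega$ such that the directional derivatives $\partial_u\pi(x)$ and $\partial_v\pi(x)$ exist and $\partial_u\pi(x)+i\,\partial_v\pi(x)\in\widetilde{\mathcal{S}}_{0,\pi(x)}$. In particular, at each point $x$ where $\pi$ is differentiable (hence at almost every $x\in U_1$), $\mathcal{S}_x$ is the preimage of $\widetilde{\mathcal{S}}_{0,\pi(x)}$ under the complex linear map $D\pi(x)$. -/

import Mathlib

open Set Topology MeasureTheory
open scoped Manifold ContDiff TensorProduct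

namespace ComplexFrobenius

/-! ### Linear algebra in the complexification `ℂ ⊗[ℝ] V` of a real vector space `V` -/

section Complexification

variable {V : Type*} [AddCommGroup V] [Module ℝ V]

/-- The element `u + i v` of the complexification. -/
noncomputable def cvec (u v : V) : ℂ ⊗[ℝ] V := (1 : ℂ) ⊗ₜ[ℝ] u + Complex.I ⊗ₜ[ℝ] v

/-- The real part `u` of `u + i v`. -/
noncomputable def rePart : ℂ ⊗[ℝ] V →ₗ[ℝ] V :=
  (TensorProduct.lid ℝ V).toLinearMap ∘ₗ Complex.reLm.rTensor V

/-- The imaginary part `v` of `u + i v`. -/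
noncomputable def imPart : ℂ ⊗[ℝ] V →ₗ[ℝ] V :=
  (TensorProduct.lid ℝ V).toLinearMap ∘ₗ Complex.imLm.rTensor V

/-- Complex conjugation `u + i v ↦ u - i v`. -/
noncomputable def conjVec : ℂ ⊗[ℝ] V →ₗ[ℝ] ℂ ⊗[ℝ] V :=
  Complex.conjAe.toLinearMap.rTensor V

@[simp] theorem rePart_cvec (u v : V) : rePart (cvec u v) = u := by
  simp [rePart, cvec]

@[simp] theorem imPart_cvec (u v : V) : imPart (cvec u v) = v := by
  simp [imPart, cvec]

@[simp] theorem conjVec_cvec (u v : V) : conjVec (cvec u v) = cvec u (-v) := by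
  simp [conjVec, cvec, TensorProduct.neg_tmul, TensorProduct.tmul_neg]

theorem cvec_rePart_imPart (w : ℂ ⊗[ℝ] V) : cvec (rePart w) (imPart w) = w := by
  induction w using TensorProduct.induction_on with
  | zero => simp [cvec]
  | tmul z v =>
    have hz : (z.re • (1 : ℂ) + z.im • Complex.I) = z := by
      apply Complex.ext <;> simp
    have h : cvec (z.re • v) (z.im • v) = z ⊗ₜ[ℝ] v := by
      rw [cvec, ← TensorProduct.smul_tmul, ← TensorProduct.smul_tmul, ← TensorProduct.add_tmul,
        hz]
    simpa [rePart, imPart] using h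
  | add x y hx hy =>
    have h : cvec (rePart x + rePart y) (imPart x + imPart y)
        = cvec (rePart x) (imPart x) + cvec (rePart y) (imPart y) := by
      simp only [cvec, TensorProduct.tmul_add]; abel
    rw [map_add, map_add, h, hx, hy]

theorem conjVec_smul (c : ℂ) (w : ℂ ⊗[ℝ] V) :
    conjVec (c • w) = (starRingEnd ℂ c) • conjVec w := by
  induction w using TensorProduct.induction_on with
  | zero => simp
  | tmul z v => simp [conjVec, TensorProduct.smul_tmul']
  | add x y hx hy => rw [smul_add, map_add, map_add, hx, hy, smul_add]

/-- The conjugate subspace: `u + i v` belongs to it iff `u - i v` belongs to `S`. -/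
def conjSub (S : Submodule ℂ (ℂ ⊗[ℝ] V)) : Submodule ℂ (ℂ ⊗[ℝ] V) where
  carrier := {w | conjVec w ∈ S}
  add_mem' := fun {a b} ha hb => by
    simp only [mem_ofPred_eq, map_add] at *
    exact S.add_mem ha hb
  zero_mem' := by simp
  smul_mem' := fun c w hw => by
    simp only [mem_ofPred_eq, conjVec_smul] at *
    exact S.smul_mem _ hw

/-- The real vectors contained in `S`, that is `S ∩ V`. -/
noncomputable def realVecs (S : Submodule ℂ (ℂ ⊗[ℝ] V)) : Submodule ℝ V :=
  (S.restrictScalars ℝ).comap (TensorProduct.mk ℝ ℂ V 1)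

/-- The real parts of the elements of `S`: all `u` such that `u + i v ∈ S` for some `v`. -/
noncomputable def realParts (S : Submodule ℂ (ℂ ⊗[ℝ] V)) : Submodule ℝ V :=
  (S.restrictScalars ℝ).map rePart

end Complexification

/-! ### Lipschitz objects on a smooth manifold -/

/-- Euclidean space of dimension `n`. -/
abbrev Euc (n : ℕ) : Type := EuclideanSpace ℝ (Fin n)

section Manifold

variable {n : ℕ} {M : Type*} [TopologicalSpace M] [ChartedSpace (Euc n) M]

/-- The complexified tangent space of `M` at `p`. -/
abbrev CTangent (n : ℕ) {M : Type*} [TopologicalSpace M] [ChartedSpace (Euc n) M] (p : M) : Type :=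
  ℂ ⊗[ℝ] TangentSpace (𝓡 n) p

/-- `P` holds at almost every point of `U`, for the Lebesgue measure class of the charts. -/
def AEOn (n : ℕ) {M : Type*} [TopologicalSpace M] [ChartedSpace (Euc n) M]
    (U : Set M) (P : M → Prop) : Prop :=
  ∀ c : M, ∀ᵐ y : Euc n, y ∈ (chartAt (Euc n) c).target →
    (chartAt (Euc n) c).symm y ∈ U → P ((chartAt (Euc n) c).symm y)

/-- A map from a manifold to a metric space is Lipschitz on `U`: read in any chart, it is
locally Lipschitz. -/
def IsLipMapOn (n : ℕ) {M : Type*} [TopologicalSpace M] [ChartedSpace (Euc n) M]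
    {Y : Type*} [PseudoEMetricSpace Y] (f : M → Y) (U : Set M) : Prop :=
  ∀ c : M, LocallyLipschitzOn
    ((chartAt (Euc n) c).target ∩ (chartAt (Euc n) c).symm ⁻¹' U)
    (fun y => f ((chartAt (Euc n) c).symm y))

/-- A map from a metric space to a manifold is Lipschitz on `T`: it is continuous there and,
read in any chart, it is locally Lipschitz. -/
def IsLipIntoOn (n : ℕ) {M : Type*} [TopologicalSpace M] [ChartedSpace (Euc n) M]
    {Y : Type*} [PseudoEMetricSpace Y] (g : Y → M) (T : Set Y) : Prop :=
  ContinuousOn g T ∧ ∀ c : M, LocallyLipschitzOn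
    (T ∩ g ⁻¹' (chartAt (Euc n) c).source) (fun y => chartAt (Euc n) c (g y))

/-- The components of a real vector field in the chart at `c`, as a function on the image of
that chart. -/
noncomputable def chartRep (c : M) (X : ∀ q : M, TangentSpace (𝓡 n) q) (y : Euc n) : Euc n :=
  mfderiv (𝓡 n) (𝓡 n) (chartAt (Euc n) c) ((chartAt (Euc n) c).symm y)
    (X ((chartAt (Euc n) c).symm y))

/-- A real vector field is Lipschitz on `U`: its components in any chart are locally
Lipschitz. -/
def IsLipFieldOn (X : ∀ q : M, TangentSpace (𝓡 n) q) (U : Set M) : Prop :=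
  ∀ c : M, LocallyLipschitzOn
    ((chartAt (Euc n) c).target ∩ (chartAt (Euc n) c).symm ⁻¹' U) (chartRep c X)

/-- A complex vector field is Lipschitz on `U`. -/
def IsLipCFieldOn (Z : ∀ q : M, CTangent n q) (U : Set M) : Prop :=
  IsLipFieldOn (fun q => rePart (Z q)) U ∧ IsLipFieldOn (fun q => imPart (Z q)) U

/-- The Lie bracket of complex vector fields, the complex bilinear extension of the bracket of
real vector fields. For Lipschitz fields it is meaningful at almost every point, namely
wherever both fields are differentiable. -/
noncomputable def cBracket (Z W : ∀ q : M, CTangent n q) (q : M) : CTangent n q :=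
  cvec
    (VectorField.mlieBracket (𝓡 n) (fun x => rePart (Z x)) (fun x => rePart (W x)) q
      - VectorField.mlieBracket (𝓡 n) (fun x => imPart (Z x)) (fun x => imPart (W x)) q)
    (VectorField.mlieBracket (𝓡 n) (fun x => rePart (Z x)) (fun x => imPart (W x)) q
      + VectorField.mlieBracket (𝓡 n) (fun x => imPart (Z x)) (fun x => rePart (W x)) q)

/-- `S` is a Lipschitz complex subbundle of the complexified tangent bundle over the open set
`U`: near each point of `U` it has a frame of Lipschitz complex vector fields. -/
def IsLipSubbundleOn (S : ∀ q : M, Submodule ℂ (CTangent n q)) (U : Set M) : Prop :=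
  ∀ p ∈ U, ∃ O : Set M, IsOpen O ∧ p ∈ O ∧ O ⊆ U ∧
    ∃ (r : ℕ) (Z : Fin r → ∀ q : M, CTangent n q),
      (∀ i, IsLipCFieldOn (Z i) O) ∧
      ∀ q ∈ O, LinearIndependent ℂ (fun i => Z i q) ∧
        Submodule.span ℂ (range fun i => Z i q) = S q

/-- `Z` is a Lipschitz section of `S` over `U`. -/
def IsLipSectionOn (S : ∀ q : M, Submodule ℂ (CTangent n q)) (Z : ∀ q : M, CTangent n q)
    (U : Set M) : Prop :=
  IsLipCFieldOn Z U ∧ ∀ q ∈ U, Z q ∈ S q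

/-- Involutivity over `U`: for Lipschitz sections `Z`, `W` of `S` over `U`, almost everywhere
in `U` the bracket `[Z, W]` lies in `S` and `[Z, conj W]` lies in `S + conj S`. (The
brackets of Lipschitz fields are automatically locally bounded.) -/
def IsInvolutiveOn (S : ∀ q : M, Submodule ℂ (CTangent n q)) (U : Set M) : Prop :=
  ∀ Z W : ∀ q : M, CTangent n q, IsLipSectionOn S Z U → IsLipSectionOn S W U →
    AEOn n U (fun q => cBracket Z W q ∈ S q) ∧
    AEOn n U (fun q => cBracket Z (fun x => conjVec (W x)) q ∈ S q ⊔ conjSub (S q))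

/-- Near each point there is a commuting Lipschitz frame of the bundle of real parts of `S`,
the first `l` members of which frame the bundle of real vectors in `S`. -/
def HypothesisV (S : ∀ q : M, Submodule ℂ (CTangent n q)) : Prop :=
  ∀ p : M, ∃ O : Set M, IsOpen O ∧ p ∈ O ∧
    ∃ (l k : ℕ) (_ : l ≤ k) (X : Fin k → ∀ q : M, TangentSpace (𝓡 n) q),
      (∀ i, IsLipFieldOn (X i) O) ∧
      (∀ q ∈ O, LinearIndependent ℝ (fun i => X i q) ∧
        Submodule.span ℝ (range fun i => X i q) = realParts (S q) ∧
        Submodule.span ℝ ((fun i => X i q) '' {i | (i : ℕ) < l}) = realVecs (S q)) ∧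
      ∀ i j, AEOn n O (fun q => VectorField.mlieBracket (𝓡 n) (X i) (X j) q = 0)

/-- `S` is a Lipschitz Levi-flat CR structure over the open set `U`. -/
def IsLeviFlatCROn (S : ∀ q : M, Submodule ℂ (CTangent n q)) (U : Set M) : Prop :=
  IsLipSubbundleOn S U ∧ (∀ q ∈ U, S q ⊓ conjSub (S q) = ⊥) ∧ IsInvolutiveOn S U

/-- `π` is a Lipschitz fibration of `U ⊆ M` onto `W`, with fibres of dimension `l`: it is
Lipschitz and onto, and over a neighbourhood of each point of `W` there is a bi-Lipschitz
trivialization whose fibre is an open subset of Euclidean `l`-space. -/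
def IsLipFibration {d : ℕ} (l : ℕ) (π : M → Euc d) (U : Set M) (W : Set (Euc d)) : Prop :=
  IsLipMapOn n π U ∧ π '' U = W ∧
    ∀ y ∈ W, ∃ W' : Set (Euc d), IsOpen W' ∧ y ∈ W' ∧ W' ⊆ W ∧
      ∃ (F : Set (Euc l)) (Ψ : OpenPartialHomeomorph M (Euc l × Euc d)), IsOpen F ∧
        Ψ.source = U ∩ π ⁻¹' W' ∧ Ψ.target = F ×ˢ W' ∧
        (∀ x ∈ Ψ.source, (Ψ x).2 = π x) ∧
        IsLipMapOn n Ψ Ψ.source ∧ IsLipIntoOn n Ψ.symm Ψ.target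

/-- The map `π` has the directional derivative `a` at `x` in the direction of the tangent
vector `u`. (The chart is immaterial when `π` is Lipschitz.) -/
def HasDirDeriv {d : ℕ} (π : M → Euc d) (x : M) (u : TangentSpace (𝓡 n) x) (a : Euc d) : Prop :=
  HasLineDerivAt ℝ (fun y => π ((chartAt (Euc n) x).symm y)) a (chartAt (Euc n) x x)
    (mfderiv (𝓡 n) (𝓡 n) (chartAt (Euc n) x) x u : Euc n)

/-- The fibre at `x` of `(Dπ)⁻¹ S'`: the complex tangent vectors `u + i v` along which `π` is
differentiable, in the sense that the directional derivatives `a` along `u` and `b` along `v`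
exist, and for which `a + i b` lies in the fibre of `S'` at `π x`. Wherever `π` is
differentiable, this is the preimage of that fibre under the complexified derivative of `π`:
see `mem_preimageFibre_iff` below. -/
def preimageFibre {d : ℕ} (π : M → Euc d) (S' : ∀ y : Euc d, Submodule ℂ (CTangent d y)) (x : M) :
    Set (CTangent n x) :=
  {w | ∃ a b : TangentSpace (𝓡 d) (π x),
    HasDirDeriv π x (rePart w) a ∧ HasDirDeriv π x (imPart w) b ∧ cvec a b ∈ S' (π x)}

theorem mem_preimageFibre_iff [IsManifold (𝓡 n) ∞ M] {d : ℕ} (π : M → Euc d)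
    (S' : ∀ y : Euc d, Submodule ℂ (CTangent d y)) (x : M)
    (hπ : MDifferentiableAt (𝓡 n) (𝓡 d) π x) (w : CTangent n x) :
    w ∈ preimageFibre π S' x ↔
      (mfderiv (𝓡 n) (𝓡 d) π x).toLinearMap.baseChange ℂ w ∈ S' (π x) := by
  have : IsManifold (𝓡 n) 1 M := IsManifold.of_le (n := ∞) (by simp)
  set e := chartAt (Euc n) x with he
  have hxe : x ∈ e.source := mem_chart_source _ x
  have hes : MDifferentiableAt (𝓡 n) (𝓡 n) e.symm (e x) :=
    mdifferentiableAt_atlas_symm (chart_mem_atlas _ x) (e.map_source hxe)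
  have hee : MDifferentiableAt (𝓡 n) (𝓡 n) e x :=
    mdifferentiableAt_atlas (chart_mem_atlas _ x) hxe
  have hπ' : MDifferentiableAt (𝓡 n) (𝓡 d) π (e.symm (e x)) := by
    rwa [e.left_inv hxe]
  have hg : MDifferentiableAt (𝓡 n) (𝓡 d) (fun y => π (e.symm y)) (e x) :=
    hπ'.comp (e x) hes
  have hD : ∀ u : TangentSpace (𝓡 n) x,
      HasDirDeriv π x u (mfderiv (𝓡 n) (𝓡 d) π x u) := by
    intro u
    have hgf := hg.differentiableAt.hasFDerivAt
    have hcomp : mfderiv (𝓡 n) (𝓡 d) π x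
        = (mfderiv (𝓡 n) (𝓡 d) (fun y => π (e.symm y)) (e x)).comp
            (mfderiv (𝓡 n) (𝓡 n) e x) := by
      rw [← mfderiv_comp x hg hee]
      apply Filter.EventuallyEq.mfderiv_eq
      filter_upwards [e.open_source.mem_nhds hxe] with y hy
      simp [e.left_inv hy]
    have := hgf.hasLineDerivAt (mfderiv (𝓡 n) (𝓡 n) e x u)
    rw [hcomp, mfderiv_eq_fderiv]
    exact this
  have hb : (mfderiv (𝓡 n) (𝓡 d) π x).toLinearMap.baseChange ℂ w
      = cvec (mfderiv (𝓡 n) (𝓡 d) π x (rePart w)) (mfderiv (𝓡 n) (𝓡 d) π x (imPart w)) := by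
    conv_lhs => rw [← cvec_rePart_imPart w]
    simp [cvec]
  rw [hb]
  constructor
  · rintro ⟨a, b, ha, hb, h⟩
    have hu : ∀ (u : TangentSpace (𝓡 n) x) (a a' : Euc d),
        HasDirDeriv π x u a → HasDirDeriv π x u a' → a = a' :=
      fun _ _ _ h h' => HasLineDerivAt.unique h h'
    rwa [← hu _ _ _ ha (hD _), ← hu _ _ _ hb (hD _)]
  · intro h
    exact ⟨_, _, hD _, hD _, h⟩

end Manifold

end ComplexFrobenius

open ComplexFrobenius

/-! Let `X` be the commuting Lipschitz frame of the real parts of `S`, read in a chart. It turns `S`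
into a Lipschitz family of subspaces `R_y ⊆ ℂ^k`, with `R_y = range (A y)`. The real parts of `R_y`
fill `ℝ^k`, and its real vectors are exactly those supported on the first `l` coordinates. The
theorem then rests on two facts: commuting Lipschitz fields have a bi-Lipschitz flow box, and `R_y`
does not change along the leaves of the first `l` fields. The projection `π` is the transversal
component of the inverse flow box. The quotient structure is the image of `R_y` under the
complexification of the map `D` that forgets the first `l` coordinates.

Flow box. The commutation relation holds only almost everywhere, so it says nothing directly on a
single trajectory. Mollifying at scale `r` gives smooth fields whose brackets are `O(r)` uniformly,
by Friedrichs' commutator estimate (`norm_bracket_mollify_le`). For smooth fields the dependence of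
the time one map on the coefficients is controlled by the brackets, with a final bound free of
second derivatives (`norm_flow_increment_le_of_smooth`), so the limit `r → 0` exists. The result in
`exists_flowBox` is the estimate `Φ (v + ι c) = Φ v + X (Φ v) c + O(‖c‖²)` at every point. It makes
every curve `s ↦ Φ (v + s • ι c)` an integral curve, and hence gives the directional derivatives of
`π` at every point (`hasLineDerivAt_box_snd`) together with the converse
(`exists_eq_of_hasLineDerivAt_box_snd`).

Constancy along leaves. Represent `R_y` by the projection `Q y` onto it with a kernel independent of
`y`. Since the frame commutes, brackets involve only derivatives of coefficients, and involutivity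
becomes the symmetry `(X_{Qv} Q) w = (X_{Qw} Q) v`, which is `StructureEq`. If `c` is real and
always lies in `R_y`, then `Q c = c` is constant, and the symmetry with `v = c` forces `X_c Q = 0`
almost everywhere. A second mollification shows that `Q` is constant along the corresponding curves,
so `Q` descends to a Lipschitz `Q'` on the base. Fubini carries the symmetry over to `Q'` almost
everywhere (`ae_structureEq_descend`).

Quotient. The symmetry for `Q'` gives back the involutivity of the bundle `projBundle D Q'`. This
bundle meets its conjugate only in zero because the kernel of `D` consists of exactly the real
vectors of `R_y`. As that kernel lies in `R_y`, the preimage under `Dπ` is all of `S` and nothing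
more, at every point. -/

set_option linter.unusedSectionVars false

/-! ### Mollification of Lipschitz maps and Friedrichs' commutator estimate -/

section Mollification

variable {E F : Type*} [NormedAddCommGroup E] [NormedSpace ℝ E] [FiniteDimensional ℝ E]
  [MeasurableSpace E] [BorelSpace E] [NormedAddCommGroup F] [NormedSpace ℝ F]
  [FiniteDimensional ℝ F]

open ContinuousLinearMap Convolution in
/-- The convolution of `g` with the normalized bump function `φ`. -/
noncomputable def mollify (μ : Measure E) (φ : ContDiffBump (0 : E)) (g : E → F) : E → F :=
  φ.normed μ ⋆[lsmul ℝ ℝ, μ] g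

variable {μ : Measure E} [μ.IsAddHaarMeasure] (φ : ContDiffBump (0 : E)) {g : E → F} {C : NNReal}

theorem mollify_apply (x : E) : mollify μ φ g x = ∫ y, φ.normed μ y • g (x - y) ∂μ := rfl

theorem integrable_normed_smul {G : Type*} [NormedAddCommGroup G] [NormedSpace ℝ G] {h : E → G}
    (hm : AEStronglyMeasurable h μ) {B : ℝ} (hB : ∀ y ∈ Metric.ball 0 φ.rOut, ‖h y‖ ≤ B) :
    Integrable (fun y => φ.normed μ y • h y) μ := by
  have hi : Integrable (fun y => B * φ.normed μ y) μ := φ.integrable_normed.const_mul B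
  refine hi.mono' (φ.integrable_normed.aestronglyMeasurable.smul hm) (ae_of_all _ fun y => ?_)
  by_cases hy : y ∈ Metric.ball (0 : E) φ.rOut
  · rw [norm_smul, Real.norm_of_nonneg (φ.nonneg_normed y), mul_comm]
    exact mul_le_mul_of_nonneg_right (hB y hy) (φ.nonneg_normed y)
  · have : φ.normed μ y = 0 := by
      rw [← Function.notMem_support, φ.support_normed_eq]; exact hy
    simp [this]

/-- The normalized bump is a probability density supported in the ball, so averaging against it
cannot increase a norm bound. All mollification estimates below reduce to this. -/
theorem norm_integral_normed_smul_le {G : Type*} [NormedAddCommGroup G] [NormedSpace ℝ G]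
    {h : E → G} {B : ℝ} (hB : ∀ᵐ y ∂μ, y ∈ Metric.ball 0 φ.rOut → ‖h y‖ ≤ B) :
    ‖∫ y, φ.normed μ y • h y ∂μ‖ ≤ B := by
  have hi : Integrable (fun y => B * φ.normed μ y) μ := φ.integrable_normed.const_mul B
  refine (norm_integral_le_of_norm_le hi ?_).trans ?_
  · filter_upwards [hB] with y hB
    by_cases hy : y ∈ Metric.ball (0 : E) φ.rOut
    · rw [norm_smul, Real.norm_of_nonneg (φ.nonneg_normed y), mul_comm]
      exact mul_le_mul_of_nonneg_right (hB hy) (φ.nonneg_normed y)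
    · have : φ.normed μ y = 0 := by
        rw [← Function.notMem_support, φ.support_normed_eq]; exact hy
      simp [this]
  · rw [integral_const_mul, φ.integral_normed, mul_one]

theorem integrable_normed_smul_of_continuous (hg : Continuous g) (x : E) :
    Integrable (fun y => φ.normed μ y • g (x - y)) μ := by
  have hc : Continuous fun y => g (x - y) := by fun_prop
  obtain ⟨B, hB⟩ := (isCompact_closedBall (0 : E) φ.rOut).exists_bound_of_continuousOn
    hc.continuousOn
  exact integrable_normed_smul φ hc.aestronglyMeasurable
    (fun y hy => hB y (Metric.ball_subset_closedBall hy))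

theorem LipschitzWith.mollify (hg : LipschitzWith C g) : LipschitzWith C (mollify μ φ g) := by
  refine LipschitzWith.of_dist_le_mul fun x y => ?_
  rw [dist_eq_norm, mollify_apply, mollify_apply,
    ← integral_sub (integrable_normed_smul_of_continuous φ hg.continuous x)
      (integrable_normed_smul_of_continuous φ hg.continuous y)]
  simp_rw [← smul_sub]
  refine norm_integral_normed_smul_le φ (ae_of_all _ fun z _ => ?_)
  rw [← dist_eq_norm]
  simpa using hg.dist_le_mul (x - z) (y - z)

theorem dist_mollify_le (hg : LipschitzWith C g) (x : E) :
    ‖mollify μ φ g x - g x‖ ≤ C * φ.rOut := by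
  rw [← dist_eq_norm]
  refine φ.dist_normed_convolution_le hg.continuous.aestronglyMeasurable fun y hy => ?_
  exact (hg.dist_le_mul y x).trans (by gcongr; exact (Metric.mem_ball.1 hy).le)

theorem contDiff_mollify (hg : Continuous g) : ContDiff ℝ ∞ (mollify μ φ g) :=
  φ.hasCompactSupport_normed.contDiff_convolution_left _ φ.contDiff_normed
    (hg.locallyIntegrable)

theorem HasCompactSupport.mollify (hg : HasCompactSupport g) :
    HasCompactSupport (mollify μ φ g) :=
  HasCompactSupport.convolution _ φ.hasCompactSupport_normed hg

theorem LipschitzWith.norm_fderiv_le (hg : LipschitzWith C g) (x : E) : ‖fderiv ℝ g x‖ ≤ C :=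
  norm_fderiv_le_of_lipschitz ℝ hg

/-- Differentiation under the integral sign: Rademacher provides the derivative for almost every
`y`, and the Lipschitz constant provides the dominating function. The derivative falls on `g`, not
on the bump, so no negative power of the radius appears. -/
theorem hasFDerivAt_mollify (hg : LipschitzWith C g) (x : E) :
    HasFDerivAt (mollify μ φ g) (∫ y, φ.normed μ y • fderiv ℝ g (x - y) ∂μ) x := by
  have hd : ∀ᵐ y ∂μ, DifferentiableAt ℝ g (x - y) :=
    (μ.measurePreserving_sub_left x).quasiMeasurePreserving.ae hg.ae_differentiableAt
  refine (hasFDerivAt_integral_of_dominated_loc_of_lip (F := fun x y => φ.normed μ y • g (x - y))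
    (bound := fun y => C * φ.normed μ y) Filter.univ_mem ?_
    (integrable_normed_smul_of_continuous φ hg.continuous x) ?_ ?_
    (φ.integrable_normed.const_mul _) ?_).2
  · exact Filter.Eventually.of_forall fun z =>
      (integrable_normed_smul_of_continuous φ hg.continuous z).aestronglyMeasurable
  · exact φ.integrable_normed.aestronglyMeasurable.smul
      ((measurable_fderiv ℝ g).comp (measurable_const.sub measurable_id)).aestronglyMeasurable
  · refine ae_of_all _ fun y => LipschitzWith.lipschitzOnWith
      (LipschitzWith.of_dist_le_mul fun a b => ?_)
    rw [dist_smul₀]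
    have := hg.dist_le_mul (a - y) (b - y)
    rw [dist_sub_right] at this
    simp only [Real.coe_nnabs, abs_mul, NNReal.abs_eq, Real.norm_eq_abs]
    nlinarith [abs_nonneg (φ.normed μ y)]
  · filter_upwards [hd] with y hy
    have h := hy.hasFDerivAt.comp x ((hasFDerivAt_id x).sub_const y)
    exact HasFDerivAt.const_smul (by simpa [Function.comp_def] using h) _

theorem aestronglyMeasurable_fderiv_apply {u : E → E} (hu : Continuous u) (x : E) :
    AEStronglyMeasurable (fun y => fderiv ℝ g (x - y) (u (x - y))) μ := by
  have h1 : Measurable fun y : E => fderiv ℝ g (x - y) :=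
    (measurable_fderiv ℝ g).comp (measurable_const.sub measurable_id)
  have h2 : Continuous fun y : E => u (x - y) := by fun_prop
  exact (ContinuousLinearMap.aestronglyMeasurable_comp₂ (ContinuousLinearMap.id ℝ (E →L[ℝ] F))
    h1.aestronglyMeasurable h2.aestronglyMeasurable)

theorem integrable_normed_smul_fderiv (hg : LipschitzWith C g) (x : E) :
    Integrable (fun y => φ.normed μ y • fderiv ℝ g (x - y)) μ :=
  integrable_normed_smul φ
    ((measurable_fderiv ℝ g).comp (measurable_const.sub measurable_id)).aestronglyMeasurable
    (fun y _ => hg.norm_fderiv_le (x - y))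

theorem integrable_normed_smul_fderiv_apply (hg : LipschitzWith C g) {u : E → E}
    (hu : Continuous u) (x : E) :
    Integrable (fun y => φ.normed μ y • fderiv ℝ g (x - y) (u (x - y))) μ := by
  have hc : Continuous fun y => u (x - y) := by fun_prop
  obtain ⟨B, hB⟩ := (isCompact_closedBall (0 : E) φ.rOut).exists_bound_of_continuousOn
    hc.continuousOn
  refine integrable_normed_smul φ (aestronglyMeasurable_fderiv_apply hu x) (B := C * B)
    fun y hy => ?_
  exact ((fderiv ℝ g (x - y)).le_opNorm _).trans (mul_le_mul (hg.norm_fderiv_le _)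
    (hB y (Metric.ball_subset_closedBall hy)) (norm_nonneg _) C.2)

/-- Friedrichs' commutator estimate. -/
theorem norm_fderiv_mollify_sub_le (hg : LipschitzWith C g) {u : E → E} (hu : Continuous u)
    {x w : E} {δ : ℝ} (hδ : ∀ y ∈ Metric.ball 0 φ.rOut, ‖w - u (x - y)‖ ≤ δ) :
    ‖fderiv ℝ (mollify μ φ g) x w - ∫ y, φ.normed μ y • fderiv ℝ g (x - y) (u (x - y)) ∂μ‖
      ≤ C * δ := by
  rw [(hasFDerivAt_mollify φ hg x).fderiv,
    ContinuousLinearMap.integral_apply (integrable_normed_smul_fderiv φ hg x), ← integral_sub]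
  -- Both terms average the same derivative of `g`; only the direction differs, by at most `δ` on
  -- the support of the bump.
  · have : ∀ y, (φ.normed μ y • fderiv ℝ g (x - y)) w
        - φ.normed μ y • fderiv ℝ g (x - y) (u (x - y))
        = φ.normed μ y • fderiv ℝ g (x - y) (w - u (x - y)) := fun y => by
      rw [smul_apply, map_sub, smul_sub]
    simp_rw [this]
    refine norm_integral_normed_smul_le φ (ae_of_all _ fun y hy => ?_)
    exact ((fderiv ℝ g (x - y)).le_opNorm _).trans (mul_le_mul (hg.norm_fderiv_le _)
      (hδ y hy) (norm_nonneg _) C.2)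
  · exact (integrable_normed_smul_fderiv φ hg x).apply_continuousLinearMap w
  · exact integrable_normed_smul_fderiv_apply φ hg hu x

theorem norm_mollify_le {M : ℝ} (hM : ∀ x, ‖g x‖ ≤ M) (x : E) : ‖mollify μ φ g x‖ ≤ M :=
  norm_integral_normed_smul_le φ (ae_of_all _ fun _ _ => hM _)

variable {K : Type*} [NormedAddCommGroup K] [NormedSpace ℝ K] [FiniteDimensional ℝ K]

theorem ae_ball_sub {P : E → Prop} {x : E} {r : ℝ} (h : ∀ᵐ y ∂μ, y ∈ Metric.ball x r → P y) :
    ∀ᵐ y ∂μ, y ∈ Metric.ball (0 : E) r → P (x - y) := by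
  filter_upwards [(μ.measurePreserving_sub_left x).quasiMeasurePreserving.ae h] with y hy hr
  exact hy (by simpa [dist_eq_norm] using hr)

/-- By Friedrichs' estimate each half of the mollified bracket is within `2 C² r ‖c‖ ‖c'‖` of the
average of the corresponding half for `X`, where `r` is the radius of the bump. The two averages
coincide because the original fields commute almost everywhere. The pointwise bound is what the flow
argument needs. -/
theorem norm_bracket_mollify_le {X : E → K →L[ℝ] E} (hX : LipschitzWith C X) {x : E}
    (hcomm : ∀ᵐ y ∂μ, y ∈ Metric.ball x φ.rOut →
      ∀ c c', fderiv ℝ X y (X y c) c' = fderiv ℝ X y (X y c') c) (c c' : K) :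
    ‖fderiv ℝ (mollify μ φ X) x (mollify μ φ X x c) c'
      - fderiv ℝ (mollify μ φ X) x (mollify μ φ X x c') c‖
      ≤ 4 * C ^ 2 * φ.rOut * ‖c‖ * ‖c'‖ := by
  have hXc := hX.continuous
  have key : ∀ c c' : K, ‖fderiv ℝ (mollify μ φ X) x (mollify μ φ X x c) c'
      - ∫ y, φ.normed μ y • fderiv ℝ X (x - y) (X (x - y) c) c' ∂μ‖
      ≤ 2 * C ^ 2 * φ.rOut * ‖c‖ * ‖c'‖ := by
    intro c c'
    have hu : Continuous fun y => X y c := by fun_prop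
    have h := norm_fderiv_mollify_sub_le (μ := μ) φ hX hu (x := x) (w := mollify μ φ X x c)
      -- One `C * φ.rOut` is the distance from the mollified field to `X x`, the other the
      -- oscillation of `X` over the ball.
      (δ := 2 * C * φ.rOut * ‖c‖) (fun y hy => by
        rw [← sub_apply]
        refine ((mollify μ φ X x - X (x - y)).le_opNorm c).trans ?_
        gcongr
        have h1 := dist_mollify_le (μ := μ) φ hX x
        have h2 : ‖X x - X (x - y)‖ ≤ C * φ.rOut := by
          refine (hX.norm_sub_le x (x - y)).trans ?_
          gcongr
          simpa using (mem_ball_zero_iff.1 hy).le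
        calc ‖mollify μ φ X x - X (x - y)‖ ≤ ‖mollify μ φ X x - X x‖ + ‖X x - X (x - y)‖ :=
              norm_sub_le_norm_sub_add_norm_sub ..
          _ ≤ 2 * C * φ.rOut := by linarith)
    have hint := integrable_normed_smul_fderiv_apply (μ := μ) φ hX hu x
    have e : ∫ y, φ.normed μ y • fderiv ℝ X (x - y) (X (x - y) c) c' ∂μ
        = (∫ y, φ.normed μ y • fderiv ℝ X (x - y) (X (x - y) c) ∂μ) c' := by
      rw [ContinuousLinearMap.integral_apply hint]
      rfl
    rw [e, ← sub_apply]
    refine (ContinuousLinearMap.le_opNorm _ c').trans ?_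
    calc _ ≤ (C * (2 * C * φ.rOut * ‖c‖)) * ‖c'‖ := by gcongr
      _ = _ := by ring
  have e : ∫ y, φ.normed μ y • fderiv ℝ X (x - y) (X (x - y) c) c' ∂μ
      = ∫ y, φ.normed μ y • fderiv ℝ X (x - y) (X (x - y) c') c ∂μ := by
    refine integral_congr_ae ?_
    filter_upwards [ae_ball_sub hcomm] with y hy
    by_cases h : y ∈ Metric.ball (0 : E) φ.rOut
    · simp only [hy h c c']
    · have : φ.normed μ y = 0 := by
        rw [← Function.notMem_support, φ.support_normed_eq]; exact h
      simp [this]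
  have h1 := key c c'
  have h2 := key c' c
  rw [← e, norm_sub_rev] at h2
  calc _ ≤ _ := norm_sub_le_norm_sub_add_norm_sub _
        (∫ y, φ.normed μ y • fderiv ℝ X (x - y) (X (x - y) c) c' ∂μ) _
    _ ≤ _ := by linarith

theorem norm_fderiv_mollify_apply_le {D : NNReal} {u : E → E} (hg : LipschitzWith C g)
    (hu : LipschitzWith D u) {x : E}
    (h0 : ∀ᵐ y ∂μ, y ∈ Metric.ball x φ.rOut → fderiv ℝ g y (u y) = 0) :
    ‖fderiv ℝ (mollify μ φ g) x (u x)‖ ≤ C * (D * φ.rOut) := by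
  have h := norm_fderiv_mollify_sub_le (μ := μ) φ hg hu.continuous (x := x) (w := u x)
    (δ := D * φ.rOut) (fun y hy => by
      refine (hu.norm_sub_le x (x - y)).trans ?_
      gcongr
      simpa using (mem_ball_zero_iff.1 hy).le)
  have e : ∫ y, φ.normed μ y • fderiv ℝ g (x - y) (u (x - y)) ∂μ = 0 := by
    refine integral_eq_zero_of_ae ?_
    filter_upwards [ae_ball_sub h0] with y hy
    by_cases h : y ∈ Metric.ball (0 : E) φ.rOut
    · simp [hy h]
    · have : φ.normed μ y = 0 := by
        rw [← Function.notMem_support, φ.support_normed_eq]; exact h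
      simp [this]
  rwa [e, sub_zero] at h

end Mollification

/-! ### Time one maps, Grönwall estimates and dependence on parameters -/

section Flow

variable {E : Type*} [NormedAddCommGroup E] [NormedSpace ℝ E]

/-- `γ` solves `γ' = f γ` on the unit interval with initial value `z`. -/
def IsUnitTimeSol (f : E → E) (z : E) (γ : ℝ → E) : Prop :=
  γ 0 = z ∧ ∀ s ∈ Icc (0 : ℝ) 1, HasDerivWithinAt γ (f (γ s)) (Icc 0 1) s

theorem exists_isUnitTimeSol [CompleteSpace E] {f : E → E} {L : NNReal} (hf : LipschitzWith L f)
    {M : ℝ} (hM : ∀ x, ‖f x‖ ≤ M) (z : E) : ∃ γ, IsUnitTimeSol f z γ := by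
  have hM0 : 0 ≤ M := (norm_nonneg _).trans (hM 0)
  lift M to NNReal using hM0
  have h : IsPicardLindelof (fun _ => f) (tmin := 0) (tmax := 1) ⟨0, by simp⟩ z M 0 M L :=
    IsPicardLindelof.of_time_independent (fun x _ => hM x) hf.lipschitzOnWith (by simp)
  exact h.exists_eq_forall_mem_Icc_hasDerivWithinAt₀

theorem HasDerivWithinAt.Ici_of_Icc {γ : ℝ → E} {v : E} {s : ℝ} (hs : s ∈ Ico (0 : ℝ) 1)
    (h : HasDerivWithinAt γ v (Icc 0 1) s) : HasDerivWithinAt γ v (Ici s) s :=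
  h.mono_of_mem_nhdsWithin (Icc_mem_nhdsGE_of_mem hs)

/-- The lower bound on `K` absorbs the quotient `ε / K` in Grönwall's bound. It is arranged below by
enlarging a Lipschitz constant `K` to `K + 1`, whence the factor `exp (K + 1)` everywhere. -/
theorem gronwallBound_le {δ ε K x : ℝ} (hε : 0 ≤ ε) (hδ : 0 ≤ δ) (hK : 1 ≤ K) (hx : x ≤ 1) :
    gronwallBound δ K ε x ≤ (δ + ε) * Real.exp K := by
  rw [gronwallBound_of_K_ne_0 (by positivity)]
  have h1 : Real.exp (K * x) ≤ Real.exp K := Real.exp_le_exp.2 (by nlinarith)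
  have h2 : ε / K ≤ ε := div_le_self hε hK
  have h3 : 0 < Real.exp K := Real.exp_pos K
  have h4 : 0 ≤ ε / K := by positivity
  nlinarith [mul_le_mul_of_nonneg_left h1 hδ, mul_le_mul_of_nonneg_left h1 h4,
    mul_le_mul_of_nonneg_right h2 h3.le]

namespace IsUnitTimeSol

variable {f g : E → E} {z w : E} {γ β : ℝ → E}

theorem continuousOn (h : IsUnitTimeSol f z γ) : ContinuousOn γ (Icc 0 1) :=
  fun s hs => (h.2 s hs).continuousWithinAt

theorem norm_sub_init_le (h : IsUnitTimeSol f z γ) {M : ℝ} (hM : ∀ x, ‖f x‖ ≤ M) {s : ℝ}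
    (hs : s ∈ Icc (0 : ℝ) 1) : ‖γ s - z‖ ≤ M := by
  have h1 := norm_image_sub_le_of_norm_deriv_le_segment' h.2 (fun s _ => hM (γ s)) s hs
  rw [h.1] at h1
  have := (norm_nonneg _).trans (hM 0)
  exact h1.trans (by nlinarith [hs.2])

/-- Comparison of a solution with an approximate solution. -/
theorem norm_sub_le_of_approx {K : ℝ} (hK : 0 ≤ K) (hf : LipschitzWith K.toNNReal f)
    (h : IsUnitTimeSol f z γ) {b b' : ℝ → E} {ε : ℝ}
    (hb : ∀ s ∈ Icc (0 : ℝ) 1, HasDerivWithinAt b (b' s) (Icc 0 1) s)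
    (hε : ∀ s ∈ Icc (0 : ℝ) 1, ‖b' s - f (b s)‖ ≤ ε) {s : ℝ} (hs : s ∈ Icc (0 : ℝ) 1) :
    ‖b s - γ s‖ ≤ (‖b 0 - z‖ + ε) * Real.exp (K + 1) := by
  have hε0 : 0 ≤ ε := (norm_nonneg _).trans (hε 0 (by simp))
  have h1 := dist_le_of_approx_trajectories_ODE (v := fun _ => f) (K := (K + 1).toNNReal)
    (εf := ε) (εg := 0) (δ := ‖b 0 - z‖) (f := b) (g := γ)
    (fun _ => hf.weaken (Real.toNNReal_le_toNNReal (by linarith)))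
    (fun s hs => (hb s hs).continuousWithinAt)
    (fun s hs => (hb s (Ico_subset_Icc_self hs)).Ici_of_Icc hs)
    (fun s hs => by rw [dist_eq_norm]; exact hε s (Ico_subset_Icc_self hs))
    h.continuousOn (fun s hs => (h.2 s (Ico_subset_Icc_self hs)).Ici_of_Icc hs)
    (fun s _ => by simp) (by rw [h.1, dist_eq_norm]) s hs
  rw [dist_eq_norm, Real.coe_toNNReal _ (by linarith), add_zero, sub_zero] at h1
  exact h1.trans (gronwallBound_le hε0 (norm_nonneg _) (by linarith) hs.2)

theorem norm_sub_le {K : ℝ} (hK : 0 ≤ K) (hf : LipschitzWith K.toNNReal f)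
    (h : IsUnitTimeSol f z γ) (h' : IsUnitTimeSol g w β) {ε : ℝ}
    (hε : ∀ x, ‖g x - f x‖ ≤ ε) {s : ℝ} (hs : s ∈ Icc (0 : ℝ) 1) :
    ‖β s - γ s‖ ≤ (‖w - z‖ + ε) * Real.exp (K + 1) := by
  have := h.norm_sub_le_of_approx hK hf h'.2 (fun s _ => hε _) hs
  rwa [h'.1] at this

end IsUnitTimeSol

/-- Add the increments over `N + 1` equal steps: the quadratic errors sum to `A / (N + 1)` and
vanish in the limit. This replaces differentiability in the parameter, and it discards `A`, which
will contain the uncontrolled second derivative bound. -/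
theorem norm_sub_le_of_increment_le {w : ℝ → E} {A B : ℝ}
    (h : ∀ a η : ℝ, 0 ≤ a → 0 < η → a + η ≤ 1 → ‖w (a + η) - w a‖ ≤ B * η + A * η ^ 2) :
    ‖w 1 - w 0‖ ≤ B := by
  have key : ∀ N : ℕ, ‖w 1 - w 0‖ ≤ B + A * (1 / ((N : ℝ) + 1)) := by
    intro N
    have hN : (0 : ℝ) < (N : ℝ) + 1 := by positivity
    have ind : ∀ m : ℕ, m ≤ N + 1 → ‖w (m * (1 / ((N : ℝ) + 1))) - w 0‖
        ≤ m * (B * (1 / ((N : ℝ) + 1)) + A * (1 / ((N : ℝ) + 1)) ^ 2) := by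
      intro m
      induction m with
      | zero => simp
      | succ m ih =>
        intro hm
        have h1 := ih (by omega)
        have hm' : (m : ℝ) + 1 ≤ N + 1 := by exact_mod_cast hm
        have h2 := h (m * (1 / ((N : ℝ) + 1))) (1 / ((N : ℝ) + 1)) (by positivity) (by positivity)
          (by rw [← add_one_mul, mul_one_div, div_le_one hN]; exact hm')
        push_cast
        rw [add_one_mul]
        calc _ ≤ _ := norm_sub_le_norm_sub_add_norm_sub _ (w (m * (1 / ((N : ℝ) + 1)))) _
          _ ≤ _ := by linarith
    have h1 := ind (N + 1) le_rfl
    push_cast at h1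
    rw [mul_one_div_cancel hN.ne'] at h1
    refine h1.trans (le_of_eq ?_)
    field_simp
  have hl : Filter.Tendsto (fun N : ℕ => B + A * (1 / ((N : ℝ) + 1))) Filter.atTop (𝓝 B) := by
    simpa using (tendsto_one_div_add_atTop_nhds_zero_nat (𝕜 := ℝ)).const_mul A |>.const_add B
  exact ge_of_tendsto' hl key

variable {K : Type*} [NormedAddCommGroup K] [NormedSpace ℝ K]

theorem LipschitzWith.apply_const {X : E → K →L[ℝ] E} {C : NNReal} (hX : LipschitzWith C X)
    (c : K) : LipschitzWith (C * ‖c‖).toNNReal fun y => X y c := by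
  refine LipschitzWith.of_dist_le_mul fun a b => ?_
  rw [dist_eq_norm, dist_eq_norm, Real.coe_toNNReal _ (by positivity), ← sub_apply]
  calc _ ≤ _ := (X a - X b).le_opNorm c
    _ ≤ (C * ‖a - b‖) * ‖c‖ := by gcongr; exact hX.norm_sub_le a b
    _ = _ := by ring

theorem norm_taylor_remainder_le {F : Type*} [NormedAddCommGroup F] [NormedSpace ℝ F]
    {g : E → F} (hg : Differentiable ℝ g) {C : NNReal} (hC : LipschitzWith C (fderiv ℝ g))
    (y v : E) : ‖g (y + v) - g y - fderiv ℝ g y v‖ ≤ C * ‖v‖ ^ 2 := by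
  have := (convex_segment y (y + v)).norm_image_sub_le_of_norm_fderiv_le' (𝕜 := ℝ) (f := g)
    (φ := fderiv ℝ g y) (C := C * ‖v‖) (fun x _ => hg x) (fun x hx => by
      refine (hC.norm_sub_le x y).trans ?_
      gcongr
      have := norm_sub_le_of_mem_segment hx
      simpa using this) (left_mem_segment ℝ _ _) (right_mem_segment ℝ _ _)
  rw [add_sub_cancel_left] at this
  linarith

/-- For a smooth linear family of vector fields whose brackets are small along the trajectories,
the time one map depends on the parameter through the fields themselves, to first order. -/
theorem norm_flow_increment_le_of_smooth {X : E → K →L[ℝ] E} {C C₂ : NNReal} {M δ : ℝ}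
    (hX : LipschitzWith C X) (hd : Differentiable ℝ X) (hX₂ : LipschitzWith C₂ (fderiv ℝ X))
    (hM : ∀ x, ‖X x‖ ≤ M) {c c' : K} (hc : ‖c‖ + ‖c'‖ ≤ 1) {z : E} {γ : ℝ → ℝ → E}
    (hγ : ∀ h ∈ Icc (0 : ℝ) 1, IsUnitTimeSol (fun y => X y (c + h • c')) z (γ h))
    (hδ : ∀ h ∈ Icc (0 : ℝ) 1, ∀ s ∈ Icc (0 : ℝ) 1,
      ‖fderiv ℝ X (γ h s) (X (γ h s) c) c' - fderiv ℝ X (γ h s) (X (γ h s) c') c‖ ≤ δ) :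
    ‖γ 1 1 - γ 0 1 - X (γ 0 1) c'‖ ≤ Real.exp (C + 1) * (δ + C * M * ‖c'‖ ^ 2) := by
  have hM0 : 0 ≤ M := (norm_nonneg _).trans (hM 0)
  have hδ0 : 0 ≤ δ := (norm_nonneg _).trans (hδ 0 (by simp) 0 (by simp))
  have hnorm : ∀ h ∈ Icc (0 : ℝ) 1, ‖c + h • c'‖ ≤ 1 := fun h hh => by
    refine (norm_add_le _ _).trans (le_trans ?_ hc)
    rw [norm_smul, Real.norm_of_nonneg hh.1]
    nlinarith [norm_nonneg c', hh.2]
  have hLip : ∀ h ∈ Icc (0 : ℝ) 1,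
      LipschitzWith (C : ℝ).toNNReal fun y => X y (c + h • c') := fun h hh =>
    (hX.apply_const _).weaken (Real.toNNReal_le_toNNReal
      (mul_le_of_le_one_right C.2 (hnorm h hh)))
  have hC0 : (0 : ℝ) ≤ C := C.2
  -- `C₂` enters only here, as part of the coefficient of `η ^ 2`, so it is absent from the
  -- conclusion. This is essential since `C₂` may blow up as the mollification radius tends to zero.
  set A : ℝ := C * M * ‖c'‖ ^ 2 + C₂ * (M * ‖c'‖) ^ 2 with hA
  have step : ∀ a η : ℝ, 0 ≤ a → 0 < η → a + η ≤ 1 →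
      ‖γ (a + η) 1 - γ a 1 - η • X (γ a 1) c'‖ ≤ (η * δ + A * η ^ 2) * Real.exp (C + 1) := by
    intro a η ha hη haη
    have haI : a ∈ Icc (0 : ℝ) 1 := ⟨ha, by linarith⟩
    have haI' : a + η ∈ Icc (0 : ℝ) 1 := ⟨by linarith, haη⟩
    set d := c + a • c' with hdd
    -- For commuting fields the derivative of `γ a s` in `a` would be `s • X (γ a s) c'`. The first
    -- order guess built from it is tested as an approximate trajectory for the coefficient vector
    -- `c + (a + η) • c'`.
    have hb : ∀ s ∈ Icc (0 : ℝ) 1, HasDerivWithinAt (fun s => γ a s + (η * s) • X (γ a s) c')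
        (X (γ a s) d + ((η * s) • (fderiv ℝ X (γ a s) (X (γ a s) d)) c' + η • X (γ a s) c'))
        (Icc 0 1) s := by
      intro s hs
      have h1 := (hγ a haI).2 s hs
      have h2 : HasDerivWithinAt (fun s => X (γ a s)) (fderiv ℝ X (γ a s) (X (γ a s) d))
          (Icc 0 1) s := (hd (γ a s)).hasFDerivAt.comp_hasDerivWithinAt s h1
      have h3 := h2.clm_apply (hasDerivWithinAt_const s (Icc (0 : ℝ) 1) c')
      have h4 : HasDerivWithinAt (fun s : ℝ => η * s) η (Icc 0 1) s := by
        simpa using (hasDerivWithinAt_id s (Icc (0 : ℝ) 1)).const_mul η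
      have h5 := h1.add (h4.smul h3)
      simp only [map_zero, add_zero] at h5
      exact h5
    have hε : ∀ s ∈ Icc (0 : ℝ) 1, ‖X (γ a s) d + ((η * s) •
        (fderiv ℝ X (γ a s) (X (γ a s) d)) c' + η • X (γ a s) c')
        - X (γ a s + (η * s) • X (γ a s) c') (c + (a + η) • c')‖ ≤ η * δ + A * η ^ 2 := by
      intro s hs
      set y := γ a s with hy
      set v := (η * s) • X y c' with hv
      have hηs : 0 ≤ η * s := mul_nonneg hη.le hs.1
      have hηs' : η * s ≤ η := mul_le_of_le_one_right hη.le hs.2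
      have hXc : ‖X y c'‖ ≤ M * ‖c'‖ := (X y).le_of_opNorm_le (hM y) c'
      have hvn : ‖v‖ ≤ η * (M * ‖c'‖) := by
        rw [hv, norm_smul, Real.norm_of_nonneg hηs]
        gcongr
      have hR := norm_taylor_remainder_le hd hX₂ y v
      set R := X (y + v) - X y - fderiv ℝ X y v with hRdef
      have hXe : X (y + v) = X y + fderiv ℝ X y v + R := by rw [hRdef]; abel
      have hde : c + (a + η) • c' = d + η • c' := by rw [hdd, add_smul, add_assoc]
      -- The terms of order `η` leave only the bracket of the fields `c` and `c'`; the rest is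
      -- quadratic in `η`.
      have e : X y d + ((η * s) • (fderiv ℝ X y (X y d)) c' + η • X y c')
          - X (y + v) (c + (a + η) • c')
          = (η * s) • (fderiv ℝ X y (X y c) c' - fderiv ℝ X y (X y c') c)
            - (η * (η * s)) • fderiv ℝ X y (X y c') c' - R (c + (a + η) • c') := by
        rw [hXe, add_apply, add_apply, hde]
        simp only [hdd, hv, map_add, map_smul, add_apply, smul_apply, smul_add, smul_sub,
          smul_smul]
        module
      rw [e]
      have n1 : ‖(η * s) • (fderiv ℝ X y (X y c) c' - fderiv ℝ X y (X y c') c)‖ ≤ η * δ := by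
        rw [norm_smul, Real.norm_of_nonneg hηs]
        gcongr
        exact hδ a haI s hs
      have n2 : ‖(η * (η * s)) • fderiv ℝ X y (X y c') c'‖ ≤ C * M * ‖c'‖ ^ 2 * η ^ 2 := by
        rw [norm_smul, Real.norm_of_nonneg (by positivity)]
        have : ‖fderiv ℝ X y (X y c') c'‖ ≤ (C * (M * ‖c'‖)) * ‖c'‖ := by
          refine (ContinuousLinearMap.le_opNorm _ _).trans ?_
          gcongr
          refine (ContinuousLinearMap.le_opNorm _ _).trans ?_
          gcongr
          exact norm_fderiv_le_of_lipschitz ℝ hX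
        calc _ ≤ (η * η) * ((C * (M * ‖c'‖)) * ‖c'‖) := by gcongr
          _ = _ := by ring
      have n3 : ‖R (c + (a + η) • c')‖ ≤ C₂ * (M * ‖c'‖) ^ 2 * η ^ 2 := by
        refine (ContinuousLinearMap.le_opNorm _ _).trans ?_
        calc ‖R‖ * ‖c + (a + η) • c'‖ ≤ (C₂ * (η * (M * ‖c'‖)) ^ 2) * 1 := by
              gcongr
              · exact hR.trans (by gcongr)
              · exact hnorm _ haI'
          _ = _ := by ring
      calc _ ≤ _ := norm_sub_le _ _
        _ ≤ _ := add_le_add_left (norm_sub_le _ _) _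
        _ ≤ _ := by rw [hA]; linarith
    have h1 := (hγ (a + η) haI').norm_sub_le_of_approx hC0 (hLip _ haI') hb hε
      (right_mem_Icc.2 zero_le_one)
    simp only [mul_zero, zero_smul, add_zero, mul_one, (hγ a haI).1, sub_self, norm_zero,
      zero_add] at h1
    rw [norm_sub_rev] at h1
    rwa [sub_sub]
  have hclose : ∀ a ∈ Icc (0 : ℝ) 1, ‖γ a 1 - γ 0 1‖ ≤ M * ‖c'‖ * Real.exp (C + 1) := by
    intro a ha
    have h0 : (0 : ℝ) ∈ Icc (0 : ℝ) 1 := by simp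
    have := (hγ 0 h0).norm_sub_le hC0 (hLip 0 h0) (hγ a ha) (ε := M * ‖c'‖) (fun x => by
      rw [zero_smul, add_zero, map_add, add_sub_cancel_left, map_smul, norm_smul,
        Real.norm_of_nonneg ha.1]
      have := (X x).le_of_opNorm_le (hM x) c'
      nlinarith [ha.2, norm_nonneg (X x c')]) (right_mem_Icc.2 zero_le_one)
    simpa using this
  -- The second summand of `B` pays for freezing the field at the endpoint `γ 0 1` instead of `γ a
  -- 1`.
  have := norm_sub_le_of_increment_le (w := fun h => γ h 1 - γ 0 1 - h • X (γ 0 1) c')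
    (A := A * Real.exp (C + 1)) (B := Real.exp (C + 1) * δ
      + C * (M * ‖c'‖ * Real.exp (C + 1)) * ‖c'‖) (fun a η ha hη haη => by
    have h1 := step a η ha hη haη
    have h2 : ‖η • (X (γ a 1) c' - X (γ 0 1) c')‖
        ≤ η * (C * (M * ‖c'‖ * Real.exp (C + 1)) * ‖c'‖) := by
      rw [norm_smul, Real.norm_of_nonneg hη.le, ← sub_apply]
      gcongr
      refine (ContinuousLinearMap.le_opNorm _ _).trans ?_
      gcongr
      refine (hX.norm_sub_le _ _).trans ?_
      gcongr
      exact hclose a ⟨ha, by linarith⟩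
    have e : (γ (a + η) 1 - γ 0 1 - (a + η) • X (γ 0 1) c')
        - (γ a 1 - γ 0 1 - a • X (γ 0 1) c')
        = (γ (a + η) 1 - γ a 1 - η • X (γ a 1) c') + η • (X (γ a 1) c' - X (γ 0 1) c') := by
      module
    simp only [e]
    refine (norm_add_le _ _).trans ?_
    linarith)
  simp only [one_smul, sub_self, zero_smul, sub_zero] at this
  refine this.trans (le_of_eq ?_)
  ring

end Flow

/-! ### The bi-Lipschitz flow box of commuting Lipschitz fields -/

section FlowBox

variable {E K : Type*} [NormedAddCommGroup E] [NormedSpace ℝ E] [FiniteDimensional ℝ E]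
  [MeasurableSpace E] [BorelSpace E] {μ : Measure E} [μ.IsAddHaarMeasure]
  [NormedAddCommGroup K] [NormedSpace ℝ K] [FiniteDimensional ℝ K]
  {X : E → K →L[ℝ] E} {C : NNReal} {M R : ℝ} {x₀ : E}

/-- For a linear family of Lipschitz vector fields that commute almost everywhere, the time one
map depends on the parameter through the fields themselves, to first order. -/
theorem norm_flow_increment_le (hX : LipschitzWith C X) (hXs : HasCompactSupport X)
    (hM : ∀ x, ‖X x‖ ≤ M)
    (hcomm : ∀ᵐ y ∂μ, y ∈ Metric.ball x₀ R →
      ∀ c c', fderiv ℝ X y (X y c) c' = fderiv ℝ X y (X y c') c)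
    {γ : K → E → ℝ → E} (hγ : ∀ c z, IsUnitTimeSol (fun y => X y c) z (γ c z))
    {c c' : K} (hc : ‖c‖ + ‖c'‖ ≤ 1) {z : E} (hz : ‖z - x₀‖ + M * (‖c‖ + ‖c'‖) < R) :
    ‖γ (c + c') z 1 - γ c z 1 - X (γ c z 1) c'‖
      ≤ Real.exp (C + 1) * (C * M * ‖c'‖ ^ 2) := by
  have hC0 : (0 : ℝ) ≤ C := C.2
  have hM0 : 0 ≤ M := (norm_nonneg _).trans (hM 0)
  set e := Real.exp (C + 1) with he
  have he0 : 0 < e := Real.exp_pos _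
  have hnorm : ∀ h ∈ Icc (0 : ℝ) 1, ‖c + h • c'‖ ≤ ‖c‖ + ‖c'‖ := fun h hh => by
    refine (norm_add_le _ _).trans ?_
    rw [norm_smul, Real.norm_of_nonneg hh.1]
    nlinarith [norm_nonneg c', hh.2]
  -- Trajectories keep at least this distance from the complement of the ball of radius `R`, so
  -- mollification at any smaller scale sees only points where commutation is known.
  set r₀ := R - (‖z - x₀‖ + M * (‖c‖ + ‖c'‖)) with hr₀
  have hr₀pos : 0 < r₀ := by rw [hr₀]; linarith
  have main : ∀ r : ℝ, 0 < r → r < r₀ → ‖γ (c + c') z 1 - γ c z 1 - X (γ c z 1) c'‖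
      ≤ e * (C * M * ‖c'‖ ^ 2) + r * (4 * C ^ 2 * e + 2 * (C * e) + C + C * (C * e)) := by
    intro r hr hrr
    let φ : ContDiffBump (0 : E) := ⟨r / 2, r, by positivity, by linarith⟩
    set Y := mollify μ φ X with hY
    have hYL : LipschitzWith C Y := LipschitzWith.mollify φ hX
    have hYM : ∀ x, ‖Y x‖ ≤ M := norm_mollify_le φ hM
    have hYd : ContDiff ℝ ∞ Y := contDiff_mollify φ hX.continuous
    have hYX : ∀ x, ‖Y x - X x‖ ≤ C * r := dist_mollify_le φ hX
    obtain ⟨C₂, hC₂⟩ : ∃ C₂, LipschitzWith C₂ (fderiv ℝ Y) :=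
      ContDiff.lipschitzWith_of_hasCompactSupport (𝕂 := ℝ) (n := 1)
        ((HasCompactSupport.mollify φ hXs).fderiv ℝ) (hYd.fderiv_right (by norm_cast)) (by simp)
    have hex : ∀ h : ℝ, ∃ g, IsUnitTimeSol (fun y => Y y (c + h • c')) z g := fun h =>
      exists_isUnitTimeSol (hYL.apply_const (c + h • c')) (M := M * ‖c + h • c'‖)
        (fun x => (Y x).le_of_opNorm_le (hYM x) _) z
    choose g hg using hex
    have hball : ∀ h ∈ Icc (0 : ℝ) 1, ∀ s ∈ Icc (0 : ℝ) 1,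
        Metric.ball (g h s) φ.rOut ⊆ Metric.ball x₀ R := by
      intro h hh s hs
      refine Metric.ball_subset_ball' ?_
      have h1 := (hg h).norm_sub_init_le (M := M * (‖c‖ + ‖c'‖)) (fun x =>
        ((Y x).le_of_opNorm_le (hYM x) _).trans (by gcongr; exact hnorm h hh)) hs
      have h2 : dist (g h s) x₀ ≤ M * (‖c‖ + ‖c'‖) + ‖z - x₀‖ := by
        rw [dist_eq_norm]
        exact (norm_sub_le_norm_sub_add_norm_sub _ z _).trans (by gcongr)
      change r + _ ≤ R
      linarith
    -- The smooth estimate applies to the mollified family with bracket bound `4 C² r`. All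
    -- comparisons with the original flow cost a multiple of `r`, so letting `r → 0` finishes the
    -- proof.
    have h1 := norm_flow_increment_le_of_smooth hYL (hYd.differentiable (by simp)) hC₂ hYM hc
      (fun h _ => hg h) (δ := 4 * C ^ 2 * r) (fun h hh s hs => by
        refine (norm_bracket_mollify_le (μ := μ) φ hX (x := g h s) ?_ c c').trans ?_
        · filter_upwards [hcomm] with y hy hy'
          exact hy (hball h hh s hs hy')
        · change 4 * (C : ℝ) ^ 2 * r * ‖c‖ * ‖c'‖ ≤ _
          have : ‖c‖ * ‖c'‖ ≤ 1 := by nlinarith [norm_nonneg c, norm_nonneg c']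
          calc _ = (4 * (C : ℝ) ^ 2 * r) * (‖c‖ * ‖c'‖) := by ring
            _ ≤ (4 * (C : ℝ) ^ 2 * r) * 1 := by gcongr
            _ = _ := by ring)
    have hdist : ∀ h ∈ Icc (0 : ℝ) 1, ‖g h 1 - γ (c + h • c') z 1‖ ≤ C * r * e := by
      intro h hh
      have hn := (hnorm h hh).trans hc
      have := (hγ (c + h • c') z).norm_sub_le hC0 ((hX.apply_const _).weaken
        (Real.toNNReal_le_toNNReal (mul_le_of_le_one_right C.2 hn))) (hg h) (ε := C * r)
        (fun x => by
          rw [← sub_apply]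
          refine ((Y x - X x).le_of_opNorm_le (hYX x) _).trans ?_
          exact mul_le_of_le_one_right (by positivity) hn) (right_mem_Icc.2 zero_le_one)
      simpa using this
    have d1 := hdist 1 (by simp)
    have d0 := hdist 0 (by simp)
    simp only [one_smul, zero_smul, add_zero] at d1 d0
    have hc' : ‖c'‖ ≤ 1 := by linarith [norm_nonneg c]
    have d2 : ‖Y (g 0 1) c' - X (γ c z 1) c'‖ ≤ C * r + C * (C * r * e) := by
      rw [← sub_apply]
      refine (ContinuousLinearMap.le_opNorm _ _).trans ?_
      refine (mul_le_of_le_one_right (norm_nonneg _) hc').trans ?_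
      refine (norm_sub_le_norm_sub_add_norm_sub _ (X (g 0 1)) _).trans ?_
      gcongr
      · exact hYX _
      · exact (hX.norm_sub_le _ _).trans (by gcongr)
    have e1 : γ (c + c') z 1 - γ c z 1 - X (γ c z 1) c'
        = (g 1 1 - g 0 1 - Y (g 0 1) c') - (g 1 1 - γ (c + c') z 1) + (g 0 1 - γ c z 1)
          + (Y (g 0 1) c' - X (γ c z 1) c') := by abel
    rw [e1]
    calc _ ≤ _ := norm_add_le _ _
      _ ≤ _ := add_le_add_left (norm_add_le _ _) _
      _ ≤ _ := add_le_add_left (add_le_add_left (norm_sub_le _ _) _) _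
      _ ≤ _ := by linarith
  have hl : Filter.Tendsto (fun r : ℝ => e * (C * M * ‖c'‖ ^ 2)
      + r * (4 * C ^ 2 * e + 2 * (C * e) + C + C * (C * e))) (𝓝[>] 0)
      (𝓝 (e * (C * M * ‖c'‖ ^ 2))) := by
    refine Filter.Tendsto.mono_left ?_ nhdsWithin_le_nhds
    have : Continuous (fun r : ℝ => e * (C * M * ‖c'‖ ^ 2)
      + r * (4 * C ^ 2 * e + 2 * (C * e) + C + C * (C * e))) := by fun_prop
    simpa using this.tendsto 0
  refine ge_of_tendsto hl ?_
  filter_upwards [Ioo_mem_nhdsGT hr₀pos] with r hr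
  exact main r hr.1 hr.2

variable {V : Type*} [NormedAddCommGroup V] [NormedSpace ℝ V]

/-- Over unit time a trajectory with small coefficient stays near `x₀`, where the field is nearly `X
x₀`. Comparing two trajectories gives strict differentiability at `0` in quantitative form, without
commutation. It feeds the Lipschitz inverse function theorem. -/
theorem exists_approximatesLinearOn_flow (hX : LipschitzWith C X) (hM : ∀ x, ‖X x‖ ≤ M)
    {γ : K → E → ℝ → E} (hγ : ∀ c z, IsUnitTimeSol (fun y => X y c) z (γ c z))
    (T : V →L[ℝ] K) (σ : V →L[ℝ] E) {κ : NNReal} (hκ : 0 < κ) :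
    ∃ ρ > 0, ∀ ρ' ≤ ρ, ApproximatesLinearOn (fun v => γ (T v) (x₀ + σ v) 1) (σ + (X x₀).comp T)
      (Metric.ball 0 ρ') κ := by
  have hC0 : (0 : ℝ) ≤ C := C.2
  have hM0 : 0 ≤ M := (norm_nonneg _).trans (hM 0)
  set e := Real.exp (C + 1) with he
  have he0 : 0 < e := Real.exp_pos _
  set S := ‖σ‖ + M * ‖T‖ with hS
  have hS0 : 0 ≤ S := by positivity
  -- `S * ‖v‖` bounds the distance of a trajectory from `x₀`, and `S * ‖v - w‖ * e` the distance
  -- between two trajectories. The summands `1` and `e` in `D` correspond to these two bounds.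
  set D := C * S * ‖T‖ * (1 + e) with hD
  have hD0 : 0 ≤ D := by positivity
  have hκ' : (0 : ℝ) < κ := hκ
  refine ⟨min (1 / (‖T‖ + 1)) (κ / (D + 1)), by positivity, fun ρ hρ => ?_⟩
  have hρ1 : ∀ v ∈ Metric.ball (0 : V) ρ, ‖T v‖ ≤ 1 := by
    intro v hv
    have h1 : ‖v‖ ≤ 1 / (‖T‖ + 1) :=
      (mem_ball_zero_iff.1 hv).le.trans (hρ.trans (min_le_left _ _))
    refine (T.le_opNorm v).trans ?_
    calc _ ≤ ‖T‖ * (1 / (‖T‖ + 1)) := by gcongr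
      _ ≤ 1 := by rw [mul_one_div, div_le_one (by positivity)]; linarith
  have hρ2 : ∀ v ∈ Metric.ball (0 : V) ρ, D * ‖v‖ ≤ κ := by
    intro v hv
    have h1 : ‖v‖ ≤ κ / (D + 1) :=
      (mem_ball_zero_iff.1 hv).le.trans (hρ.trans (min_le_right _ _))
    calc _ ≤ D * (κ / (D + 1)) := by gcongr
      _ = κ * (D / (D + 1)) := by ring
      _ ≤ κ * 1 := by gcongr; rw [div_le_one (by positivity)]; linarith
      _ = κ := mul_one _
  intro v hv w hw
  set a := γ (T v) (x₀ + σ v) with ha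
  set b := γ (T w) (x₀ + σ w) with hb
  have hav := hγ (T v) (x₀ + σ v)
  have hbw := hγ (T w) (x₀ + σ w)
  have hax : ∀ s ∈ Icc (0 : ℝ) 1, ‖a s - x₀‖ ≤ S * ‖v‖ := by
    intro s hs
    have h1 := hav.norm_sub_init_le (M := M * (‖T‖ * ‖v‖)) (fun x =>
      ((X x).le_of_opNorm_le (hM x) _).trans (by gcongr; exact T.le_opNorm v)) hs
    have h2 := norm_sub_le_norm_sub_add_norm_sub (a s) (x₀ + σ v) x₀
    rw [add_sub_cancel_left] at h2
    have h3 := σ.le_opNorm v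
    rw [hS]
    linarith
  have hab : ∀ s ∈ Icc (0 : ℝ) 1, ‖a s - b s‖ ≤ S * ‖v - w‖ * e := by
    intro s hs
    have h1 := hbw.norm_sub_le hC0 ((hX.apply_const _).weaken
        (Real.toNNReal_le_toNNReal (mul_le_of_le_one_right C.2 (hρ1 w hw)))) hav
        (ε := M * (‖T‖ * ‖v - w‖)) (fun x => by
          rw [← map_sub, ← map_sub]
          exact ((X x).le_of_opNorm_le (hM x) _).trans (by gcongr; exact T.le_opNorm _)) hs
    refine h1.trans ?_
    rw [add_sub_add_left_eq_sub, ← map_sub]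
    gcongr
    have h3 := σ.le_opNorm (v - w)
    rw [hS]
    linarith
  have hder : ∀ s ∈ Icc (0 : ℝ) 1, HasDerivWithinAt (fun s => a s - b s - s • X x₀ (T (v - w)))
      (X (a s) (T v) - X (b s) (T w) - (1 : ℝ) • X x₀ (T (v - w))) (Icc 0 1) s := fun s hs =>
    ((hav.2 s hs).sub (hbw.2 s hs)).sub ((hasDerivWithinAt_id s _).smul_const _)
  have := norm_image_sub_le_of_norm_deriv_le_segment_01' hder (C := κ * ‖v - w‖) (fun s hs => by
    have hs := Ico_subset_Icc_self hs
    have e1 : X (a s) (T v) - X (b s) (T w) - (1 : ℝ) • X x₀ (T (v - w))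
        = (X (a s) - X x₀) (T (v - w)) + (X (a s) - X (b s)) (T w) := by
      simp only [sub_apply, map_sub, one_smul]; abel
    rw [e1]
    have n1 : ‖(X (a s) - X x₀) (T (v - w))‖ ≤ C * S * ‖T‖ * ‖v‖ * ‖v - w‖ := by
      refine (ContinuousLinearMap.le_opNorm _ _).trans ?_
      calc _ ≤ (C * (S * ‖v‖)) * (‖T‖ * ‖v - w‖) := by
            gcongr
            · exact (hX.norm_sub_le _ _).trans (by gcongr; exact hax s hs)
            · exact T.le_opNorm _
        _ = _ := by ring
    have n2 : ‖(X (a s) - X (b s)) (T w)‖ ≤ C * S * ‖T‖ * e * ‖w‖ * ‖v - w‖ := by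
      refine (ContinuousLinearMap.le_opNorm _ _).trans ?_
      calc _ ≤ (C * (S * ‖v - w‖ * e)) * (‖T‖ * ‖w‖) := by
            gcongr
            · exact (hX.norm_sub_le _ _).trans (by gcongr; exact hab s hs)
            · exact T.le_opNorm _
        _ = _ := by ring
    have hmax : ∀ t : ℝ, (∀ u : V, u = v ∨ u = w → ‖u‖ ≤ t) → D * t ≤ κ →
        C * S * ‖T‖ * ‖v‖ * ‖v - w‖ + C * S * ‖T‖ * e * ‖w‖ * ‖v - w‖ ≤ κ * ‖v - w‖ := by
      intro t ht htκ
      have hv' := ht v (Or.inl rfl)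
      have hw' := ht w (Or.inr rfl)
      calc _ ≤ C * S * ‖T‖ * t * ‖v - w‖ + C * S * ‖T‖ * e * t * ‖v - w‖ := by gcongr
        _ = D * t * ‖v - w‖ := by rw [hD]; ring
        _ ≤ _ := by gcongr
    refine (norm_add_le _ _).trans ((add_le_add n1 n2).trans ?_)
    rcases le_total ‖v‖ ‖w‖ with h | h
    · exact hmax ‖w‖ (by rintro u (rfl | rfl); exacts [h, le_rfl]) (hρ2 w hw)
    · exact hmax ‖v‖ (by rintro u (rfl | rfl); exacts [le_rfl, h]) (hρ2 v hv))
  have h0a : a 0 = x₀ + σ v := hav.1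
  have h0b : b 0 = x₀ + σ w := hbw.1
  rw [h0a, h0b] at this
  refine le_trans (le_of_eq ?_) this
  congr 1
  simp only [add_apply, ContinuousLinearMap.comp_apply, map_sub, one_smul, zero_smul]
  abel

/-- The flow box of a linear family of commuting Lipschitz vector fields. -/
theorem exists_flowBox [FiniteDimensional ℝ V] (hX : LipschitzWith C X)
    (hXs : HasCompactSupport X) (hR : 0 < R)
    (hcomm : ∀ᵐ y ∂μ, y ∈ Metric.ball x₀ R →
      ∀ c c', fderiv ℝ X y (X y c) c' = fderiv ℝ X y (X y c') c)
    (ι : K →L[ℝ] V) (T : V →L[ℝ] K) (hT : ∀ c, T (ι c) = c)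
    (L : V ≃L[ℝ] E) (hL : ∀ c, L (ι c) = X x₀ c) :
    ∃ (ρ : ℝ) (Φ : OpenPartialHomeomorph V E) (D : NNReal) (A : ℝ),
      0 < ρ ∧ Φ.source = Metric.ball 0 ρ ∧ Φ 0 = x₀ ∧ Φ.target ⊆ Metric.ball x₀ R ∧
      LipschitzOnWith D Φ Φ.source ∧ LipschitzOnWith D Φ.symm Φ.target ∧
      ∀ v c, v ∈ Φ.source → v + ι c ∈ Φ.source →
        ‖Φ (v + ι c) - Φ v - X (Φ v) c‖ ≤ A * ‖c‖ ^ 2 := by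
  obtain ⟨M, hM⟩ := hXs.exists_bound_of_continuous hX.continuous
  have hM0 : 0 ≤ M := (norm_nonneg _).trans (hM 0)
  have hex : ∀ (c : K) (z : E), ∃ g, IsUnitTimeSol (fun y => X y c) z g := fun c z =>
    exists_isUnitTimeSol (hX.apply_const c) (M := M * ‖c‖)
      (fun x => (X x).le_of_opNorm_le (hM x) _) z
  choose γ hγ using hex
  -- With this choice the linear part at `0` is `L`, and `σ` kills the range of `ι`. Adding `ι c` to
  -- `v` therefore keeps the starting point and adds `c` to the coefficients, which is the situation
  -- of `norm_flow_increment_le`.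
  set σ : V →L[ℝ] E := (L : V →L[ℝ] E) - (X x₀).comp T with hσ
  have hσι : ∀ c, σ (ι c) = 0 := fun c => by simp [hσ, hL, hT]
  have hσL : σ + (X x₀).comp T = (L : V →L[ℝ] E) := by rw [hσ]; abel
  set N := ‖(L.symm : E →L[ℝ] V)‖₊ with hN
  obtain ⟨κ, hκ0, hκ⟩ : ∃ κ : NNReal, 0 < κ ∧ (Subsingleton V ∨ κ < N⁻¹) := by
    rcases subsingleton_or_nontrivial V with h | h
    · exact ⟨1, one_pos, Or.inl h⟩
    · have hNpos : 0 < N⁻¹ := by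
        rw [hN]
        exact inv_pos.2 (L.nnnorm_symm_pos)
      exact ⟨N⁻¹ / 2, half_pos hNpos, Or.inr (half_lt_self hNpos)⟩
  obtain ⟨ρ₀, hρ₀, happ⟩ := exists_approximatesLinearOn_flow (x₀ := x₀) hX hM hγ T σ hκ0
  rw [hσL] at happ
  -- The factor `3` allows for `‖T v‖ ≤ ‖T‖ ρ` together with `‖c‖ ≤ 2 ‖T‖ ρ`, the latter because `c
  -- = T (v + ι c) - T v`.
  set S := ‖σ‖ + M * (3 * ‖T‖) with hS
  have hS0 : 0 ≤ S := by positivity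
  set ρ := min ρ₀ (min (1 / (3 * ‖T‖ + 1)) (R / (S + 1))) with hρ
  have hρpos : 0 < ρ := by positivity
  have happρ := happ ρ (min_le_left _ _)
  set Φ := happρ.toOpenPartialHomeomorph _ _ hκ Metric.isOpen_ball with hΦ
  have hΦv : ∀ v, Φ v = γ (T v) (x₀ + σ v) 1 := fun v => rfl
  have hsrc : Φ.source = Metric.ball 0 ρ := rfl
  have htgt : Φ.target = (fun v => γ (T v) (x₀ + σ v) 1) '' Metric.ball 0 ρ := rfl
  have hρ1 : 3 * ‖T‖ * ρ ≤ 1 := by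
    have : ρ ≤ 1 / (3 * ‖T‖ + 1) := (min_le_right _ _).trans (min_le_left _ _)
    calc _ ≤ 3 * ‖T‖ * (1 / (3 * ‖T‖ + 1)) := by gcongr
      _ ≤ 1 := by rw [mul_one_div, div_le_one (by positivity)]; linarith
  have hρ2 : S * ρ < R := by
    have : ρ ≤ R / (S + 1) := (min_le_right _ _).trans (min_le_right _ _)
    calc _ ≤ S * (R / (S + 1)) := by gcongr
      _ = R * (S / (S + 1)) := by ring
      _ < R * 1 := by gcongr; rw [div_lt_one (by positivity)]; linarith
      _ = R := mul_one _
  have hTle : ∀ v ∈ Metric.ball (0 : V) ρ, ‖T v‖ ≤ ‖T‖ * ρ := fun v hv =>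
    (T.le_opNorm v).trans (by gcongr; exact (mem_ball_zero_iff.1 hv).le)
  have hσle : ∀ v ∈ Metric.ball (0 : V) ρ, ‖σ v‖ ≤ ‖σ‖ * ρ := fun v hv =>
    (σ.le_opNorm v).trans (by gcongr; exact (mem_ball_zero_iff.1 hv).le)
  have hanti := happρ.antilipschitz hκ
  refine ⟨ρ, Φ, max (‖(L : V →L[ℝ] E)‖₊ + κ) (N⁻¹ - κ)⁻¹, Real.exp (C + 1) * (C * M), hρpos,
    hsrc, ?_, ?_, ?_, ?_, ?_⟩
  · rw [hΦv, map_zero, map_zero, add_zero]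
    have := (hγ 0 x₀).norm_sub_init_le (M := 0) (fun x => by simp) (right_mem_Icc.2 zero_le_one)
    rwa [norm_le_zero_iff, sub_eq_zero] at this
  · rw [htgt]
    rintro _ ⟨v, hv, rfl⟩
    have h1 := (hγ (T v) (x₀ + σ v)).norm_sub_init_le (M := M * (‖T‖ * ρ)) (fun x =>
      ((X x).le_of_opNorm_le (hM x) _).trans (by gcongr; exact hTle v hv))
      (right_mem_Icc.2 zero_le_one)
    have h2 := norm_sub_le_norm_sub_add_norm_sub (γ (T v) (x₀ + σ v) 1) (x₀ + σ v) x₀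
    rw [add_sub_cancel_left] at h2
    have h3 := hσle v hv
    rw [Metric.mem_ball, dist_eq_norm]
    have h4 : 0 ≤ M * (‖T‖ * ρ) := by positivity
    have h5 : S * ρ = ‖σ‖ * ρ + 3 * (M * (‖T‖ * ρ)) := by rw [hS]; ring
    dsimp only
    linarith
  · rw [hsrc]
    exact (lipschitzOnWith_iff_restrict.2 happρ.lipschitz).weaken (le_max_left _ _)
  · refine LipschitzOnWith.weaken (K := (N⁻¹ - κ)⁻¹) ?_ (le_max_right _ _)
    refine LipschitzOnWith.of_dist_le_mul fun x hx y hy => ?_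
    have h := hanti.le_mul_dist ⟨Φ.symm x, Φ.map_target hx⟩ ⟨Φ.symm y, Φ.map_target hy⟩
    have hx' : γ (T (Φ.symm x)) (x₀ + σ (Φ.symm x)) 1 = x := Φ.right_inv hx
    have hy' : γ (T (Φ.symm y)) (x₀ + σ (Φ.symm y)) 1 = y := Φ.right_inv hy
    simpa [Subtype.dist_eq, hx', hy'] using h
  · intro v c hv hvc
    rw [hsrc] at hv hvc
    have h1 := hTle v hv
    have h2 : ‖c‖ ≤ 2 * (‖T‖ * ρ) := by
      have h3 := hTle _ hvc
      rw [map_add, hT] at h3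
      have := norm_sub_le (T v + c) (T v)
      rw [add_sub_cancel_left] at this
      linarith
    rw [hΦv, hΦv, map_add, map_add, hσι, add_zero, hT]
    have := norm_flow_increment_le hX hXs hM hcomm hγ (c := T v) (c' := c) (z := x₀ + σ v)
      (by linarith) (by
        rw [add_sub_cancel_left]
        have h3 := hσle v hv
        have h4 : M * (‖T v‖ + ‖c‖) ≤ M * (3 * (‖T‖ * ρ)) := by gcongr; linarith
        have h5 : S * ρ = ‖σ‖ * ρ + M * (3 * (‖T‖ * ρ)) := by rw [hS]; ring
        linarith)
    linarith

end FlowBox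

/-! ### Line derivatives of Lipschitz maps along curves -/

section LineDeriv

variable {E F : Type*} [NormedAddCommGroup E] [NormedSpace ℝ E] [NormedAddCommGroup F]
  [NormedSpace ℝ F]

/-- The line derivative of a Lipschitz function may be computed along any curve with the given
velocity. -/
theorem LipschitzOnWith.hasDerivAt_comp_iff_hasLineDerivAt {f : E → F} {C : NNReal} {s : Set E}
    (hf : LipschitzOnWith C f s) {x u : E} (hs : s ∈ 𝓝 x) {p : ℝ → E} (hp : HasDerivAt p u 0)
    (h0 : p 0 = x) {a : F} :
    HasDerivAt (fun t => f (p t)) a 0 ↔ HasLineDerivAt ℝ f a x u := by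
  have hq : HasDerivAt (fun t : ℝ => x + t • u) u 0 := by
    simpa using ((hasDerivAt_id (0 : ℝ)).smul_const u).const_add x
  have hpo : (fun t => p t - (x + t • u)) =o[𝓝 0] fun t => t := by
    have := (hp.sub hq)
    rw [hasDerivAt_iff_isLittleO] at this
    simpa [h0] using this
  have hps : ∀ᶠ t in 𝓝 (0 : ℝ), p t ∈ s :=
    hp.continuousAt.preimage_mem_nhds (by rwa [h0])
  have hqs : ∀ᶠ t in 𝓝 (0 : ℝ), x + t • u ∈ s :=
    hq.continuousAt.preimage_mem_nhds (by simpa using hs)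
  -- The curve and its tangent line separate by `o(t)`, and a Lipschitz map preserves this order.
  have hfo : (fun t => f (p t) - f (x + t • u)) =o[𝓝 0] fun t => t := by
    refine Asymptotics.IsBigO.trans_isLittleO ?_ hpo
    refine Asymptotics.IsBigO.of_bound C ?_
    filter_upwards [hps, hqs] with t h1 h2
    exact hf.norm_sub_le h1 h2
  have hfo' : (fun t : ℝ => f (p t) - f (x + t • u)) =o[𝓝 0] fun t => t - 0 := by simpa using hfo
  have hd : HasDerivAt (fun t => f (p t) - f (x + t • u)) 0 0 := by
    rw [hasDerivAt_iff_isLittleO]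
    simpa [h0] using hfo
  unfold HasLineDerivAt
  constructor
  · intro h
    exact ((h.sub hd).congr_of_eventuallyEq
      (Filter.Eventually.of_forall fun t => by simp)).congr_deriv (sub_zero a)
  · intro h
    exact ((hd.add h).congr_of_eventuallyEq
      (Filter.Eventually.of_forall fun t => by simp)).congr_deriv (zero_add a)

end LineDeriv

/-! ### Null sets under Lipschitz maps -/

section NullSets

variable {E F : Type*} [NormedAddCommGroup E] [NormedSpace ℝ E] [FiniteDimensional ℝ E]
  [MeasurableSpace E] [BorelSpace E] [NormedAddCommGroup F] [NormedSpace ℝ F]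
  [FiniteDimensional ℝ F] [MeasurableSpace F] [BorelSpace F]

/-- Lipschitz maps between spaces of the same dimension map null sets to null sets. -/
theorem LipschitzOnWith.measure_image_eq_zero {μ : Measure E} [μ.IsAddHaarMeasure]
    {ν : Measure F} [ν.IsAddHaarMeasure] (hd : Module.finrank ℝ E = Module.finrank ℝ F)
    {f : E → F} {C : NNReal} {s : Set E} (hf : LipschitzOnWith C f s) (hs : μ s = 0) :
    ν (f '' s) = 0 := by
  have h1 : (μH[Module.finrank ℝ E] : Measure E) s = 0 :=
    Measure.absolutelyContinuous_isAddHaarMeasure _ μ hs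
  have h2 : (μH[Module.finrank ℝ F] : Measure F) (f '' s) = 0 := by
    rw [← hd]
    have := hf.hausdorffMeasure_image_le (d := Module.finrank ℝ E) (by positivity)
    rw [h1, mul_zero] at this
    exact le_antisymm this (zero_le)
  exact Measure.absolutelyContinuous_isAddHaarMeasure ν _ h2

end NullSets

/-! ### Directional derivatives and constancy along leaves in a flow box -/

section Box

variable {E K V₁ V₂ : Type*} [NormedAddCommGroup E] [NormedSpace ℝ E] [FiniteDimensional ℝ E]
  [NormedAddCommGroup K] [NormedSpace ℝ K] [FiniteDimensional ℝ K]
  [NormedAddCommGroup V₁] [NormedSpace ℝ V₁] [FiniteDimensional ℝ V₁]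
  [NormedAddCommGroup V₂] [NormedSpace ℝ V₂] [FiniteDimensional ℝ V₂]
  {X : E → K →L[ℝ] E} {ι : K →L[ℝ] V₁ × V₂} {Φ : OpenPartialHomeomorph (V₁ × V₂) E} {A : ℝ}
  {D : NNReal}

/-- The quadratic increment estimate, applied at the point `v + t • ι c`, is exactly
differentiability of the curve there, with velocity given by the field. It holds at every point and
not merely almost everywhere. -/
theorem hasDerivAt_box
    (hinc : ∀ v c, v ∈ Φ.source → v + ι c ∈ Φ.source →
      ‖Φ (v + ι c) - Φ v - X (Φ v) c‖ ≤ A * ‖c‖ ^ 2) {v : V₁ × V₂} (c : K) {t : ℝ}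
    (hv : v + t • ι c ∈ Φ.source) :
    HasDerivAt (fun s : ℝ => Φ (v + s • ι c)) (X (Φ (v + t • ι c)) c) t := by
  rw [hasDerivAt_iff_isLittleO]
  have hc : Continuous fun s : ℝ => v + s • ι c := by fun_prop
  have h1 : (fun s : ℝ => Φ (v + s • ι c) - Φ (v + t • ι c) - (s - t) • X (Φ (v + t • ι c)) c)
      =O[𝓝 t] fun s => (s - t) ^ 2 := by
    refine Asymptotics.IsBigO.of_bound (A * ‖c‖ ^ 2) ?_
    filter_upwards [hc.continuousAt.preimage_mem_nhds (Φ.open_source.mem_nhds hv)] with s hs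
    have e : v + s • ι c = v + t • ι c + ι ((s - t) • c) := by
      rw [map_smul, add_assoc, ← add_smul, add_sub_cancel]
    have := hinc (v + t • ι c) ((s - t) • c) hv (by rw [← e]; exact hs)
    rw [← e, map_smul, norm_smul] at this
    refine this.trans (le_of_eq ?_)
    simp only [Real.norm_eq_abs, mul_pow, abs_pow]
    ring
  refine h1.trans_isLittleO ?_
  have := (Asymptotics.isLittleO_pow_id (𝕜 := ℝ) (n := 2) (by norm_num)).comp_tendsto
    (show Filter.Tendsto (fun s : ℝ => s - t) (𝓝 t) (𝓝 0) by
      have : Continuous fun s : ℝ => s - t := by fun_prop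
      simpa using this.tendsto t)
  exact this

/-- The derivative is computed along the integral curve through `x` instead of the straight line. On
that curve the inverse chart is affine, so its second component has constant velocity. -/
theorem hasLineDerivAt_box_snd
    (hinc : ∀ v c, v ∈ Φ.source → v + ι c ∈ Φ.source →
      ‖Φ (v + ι c) - Φ v - X (Φ v) c‖ ≤ A * ‖c‖ ^ 2)
    (hΦs : LipschitzOnWith D Φ.symm Φ.target) {x : E} (hx : x ∈ Φ.target) (c : K) :
    HasLineDerivAt ℝ (fun y => (Φ.symm y).2) (ι c).2 x (X x c) := by
  have hv : Φ.symm x + (0 : ℝ) • ι c ∈ Φ.source := by simpa using Φ.map_target hx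
  have hL : LipschitzOnWith (1 * D) (fun y => (Φ.symm y).2) Φ.target :=
    LipschitzWith.prod_snd.comp_lipschitzOnWith hΦs
  have hd := hasDerivAt_box hinc c hv
  have e0 : Φ (Φ.symm x + (0 : ℝ) • ι c) = x := by simp [Φ.right_inv hx]
  rw [e0] at hd
  rw [← hL.hasDerivAt_comp_iff_hasLineDerivAt (Φ.open_target.mem_nhds hx) hd e0]
  have hlin : HasDerivAt (fun s : ℝ => (Φ.symm x).2 + s • (ι c).2) (ι c).2 0 := by
    simpa using ((hasDerivAt_id (0 : ℝ)).smul_const (ι c).2).const_add (Φ.symm x).2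
  refine hlin.congr_of_eventuallyEq ?_
  have hc : Continuous fun s : ℝ => Φ.symm x + s • ι c := by fun_prop
  filter_upwards [hc.continuousAt.preimage_mem_nhds (Φ.open_source.mem_nhds hv)] with s hs
  rw [Φ.left_inv hs]
  rfl

/-- Pulled back to the box, the line in direction `u` moves transversally like `ι c` up to `o(s)`.
Correcting `c` along the leaf then reproduces the line to first order, which exhibits `u` as a
combination of the frame. No differentiability of the first component is needed, only its `O(s)`
bound. -/
theorem exists_eq_of_hasLineDerivAt_box_snd
    (hinc : ∀ v c, v ∈ Φ.source → v + ι c ∈ Φ.source →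
      ‖Φ (v + ι c) - Φ v - X (Φ v) c‖ ≤ A * ‖c‖ ^ 2)
    (hΦ : LipschitzOnWith D Φ Φ.source) (hΦs : LipschitzOnWith D Φ.symm Φ.target)
    (j : V₁ →L[ℝ] K) (hj : ∀ a, ι (j a) = (a, 0)) {x u : E} (hx : x ∈ Φ.target) {c : K}
    (h : HasLineDerivAt ℝ (fun y => (Φ.symm y).2) (ι c).2 x u) :
    ∃ c', (ι c').2 = (ι c).2 ∧ X x c' = u := by
  set v := Φ.symm x with hv
  have hvs : v ∈ Φ.source := Φ.map_target hx
  have hΦv : Φ v = x := Φ.right_inv hx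
  set q : ℝ → V₁ × V₂ := fun s => Φ.symm (x + s • u) with hq
  have hq0 : q 0 = v := by simp [hq, hv]
  have hcq : Continuous fun s : ℝ => x + s • u := by fun_prop
  have hqt : ∀ᶠ s in 𝓝 (0 : ℝ), x + s • u ∈ Φ.target :=
    hcq.continuousAt.preimage_mem_nhds (Φ.open_target.mem_nhds (by simpa using hx))
  have hqc : ContinuousAt q 0 := by
    refine ContinuousAt.comp (f := fun s : ℝ => x + s • u) (g := Φ.symm) ?_ hcq.continuousAt
    simpa using Φ.symm.continuousAt hx
  -- `a` and `b` are the leafwise and transversal deviations from the expected line in the box: `b =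
  -- o(s)` by hypothesis, `a = O(s)` because the inverse chart is Lipschitz.
  set a : ℝ → V₁ := fun s => (q s - (v + s • ι c)).1 with ha
  set b : ℝ → V₂ := fun s => (q s - (v + s • ι c)).2 with hb
  have hbo : b =o[𝓝 0] fun s => s := by
    unfold HasLineDerivAt at h
    rw [hasDerivAt_iff_isLittleO] at h
    simp only [sub_zero, zero_smul, add_zero] at h
    refine h.congr (fun s => ?_) (fun _ => rfl)
    simp only [hb, hq, hv, Prod.snd_sub, Prod.snd_add, Prod.smul_snd]
    abel
  have haO : a =O[𝓝 0] fun s => s := by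
    refine Asymptotics.IsBigO.of_bound (D * ‖u‖ + ‖ι c‖) ?_
    filter_upwards [hqt] with s hs
    have h1 := hΦs.norm_sub_le hs hx
    rw [add_sub_cancel_left, norm_smul] at h1
    calc ‖a s‖ ≤ ‖q s - (v + s • ι c)‖ := norm_fst_le _
      _ = ‖(q s - v) - s • ι c‖ := by rw [sub_sub]
      _ ≤ ‖q s - v‖ + ‖s • ι c‖ := norm_sub_le _ _
      _ ≤ D * (‖s‖ * ‖u‖) + ‖s‖ * ‖ι c‖ := by rw [norm_smul]; gcongr
      _ = _ := by ring
  have hac : Filter.Tendsto a (𝓝 0) (𝓝 0) := haO.trans_tendsto Filter.tendsto_id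
  set d : ℝ → K := fun s => s • c + j (a s) with hd
  have hdO : d =O[𝓝 0] fun s => s := by
    refine Asymptotics.IsBigO.add ?_ ?_
    · refine Asymptotics.IsBigO.of_bound ‖c‖ (Filter.Eventually.of_forall fun s => ?_)
      rw [norm_smul, mul_comm]
    · exact (j.isBigO_comp a _).trans haO
  have hd0 : Filter.Tendsto d (𝓝 0) (𝓝 0) := hdO.trans_tendsto Filter.tendsto_id
  have hde : ∀ s, v + ι (d s) = q s - (0, b s) := by
    intro s
    rw [hd, map_add, map_smul, hj]
    ext <;> simp [ha, hb] <;> abel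
  have hds : ∀ᶠ s in 𝓝 (0 : ℝ), v + ι (d s) ∈ Φ.source := by
    have : Filter.Tendsto (fun s => v + ι (d s)) (𝓝 0) (𝓝 v) := by
      simpa using ((ι.continuous.tendsto 0).comp hd0).const_add v
    exact this.eventually (Φ.open_source.mem_nhds hvs)
  have key : (fun s => s • (u - X x c) - X x (j (a s))) =o[𝓝 0] fun s => s := by
    -- The first bracket is `O(b s)` since `Φ` is Lipschitz; the second is `O(‖d s‖²)` by the
    -- increment estimate.
    have e : ∀ s, s • (u - X x c) - X x (j (a s))
        = ((x + s • u) - Φ (v + ι (d s))) + (Φ (v + ι (d s)) - Φ v - X (Φ v) (d s)) := by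
      intro s
      have : X x (d s) = s • X x c + X x (j (a s)) := by simp [hd]
      rw [hΦv, this]
      module
    refine Asymptotics.IsLittleO.congr_left ?_ (fun s => (e s).symm)
    refine Asymptotics.IsLittleO.add ?_ ?_
    · refine Asymptotics.IsBigO.trans_isLittleO (g := b) ?_ hbo
      refine Asymptotics.IsBigO.of_bound D ?_
      filter_upwards [hqt, hds] with s hs hs'
      have h1 := hΦ.norm_sub_le (Φ.map_target hs) hs'
      rw [Φ.right_inv hs, hde, hq, sub_sub_cancel] at h1
      rw [hde]
      simpa using h1
    · refine Asymptotics.IsBigO.trans_isLittleO (g := fun s : ℝ => s ^ 2) ?_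
        (by simpa using Asymptotics.isLittleO_pow_id (𝕜 := ℝ) (n := 2) (by norm_num))
      refine Asymptotics.IsBigO.trans (g := fun s => ‖d s‖ ^ 2) ?_ (hdO.norm_left.pow 2)
      refine Asymptotics.IsBigO.of_bound A ?_
      filter_upwards [hds] with s hs
      simpa using hinc v (d s) hvs hs
  -- The quotients `a s / s` need not converge, but their images under `X x ∘ j` do, and a finite
  -- dimensional subspace is closed.
  set W : Submodule ℝ E := LinearMap.range ((X x).comp j).toLinearMap with hW
  have hWc : IsClosed (W : Set E) := W.closed_of_finiteDimensional
  have hmem : u - X x c ∈ W := by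
    have hlim : Filter.Tendsto (fun s : ℝ => X x (j (s⁻¹ • a s))) (𝓝[≠] 0) (𝓝 (u - X x c)) := by
      have h1 := (key.tendsto_inv_smul_nhds_zero).mono_left
        (nhdsWithin_le_nhds (s := {(0 : ℝ)}ᶜ))
      have h2 := h1.const_sub (u - X x c)
      rw [sub_zero] at h2
      refine h2.congr' ?_
      filter_upwards [self_mem_nhdsWithin] with s hs
      have hs' : s ≠ 0 := hs
      rw [smul_sub, inv_smul_smul₀ hs', map_smul, map_smul]
      abel
    exact hWc.mem_of_tendsto hlim (Filter.Eventually.of_forall fun s => ⟨s⁻¹ • a s, rfl⟩)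
  obtain ⟨a', ha'⟩ := hmem
  refine ⟨c + j a', by simp [hj], ?_⟩
  have : X x (j a') = u - X x c := ha'
  rw [map_add, this]
  abel

variable [MeasurableSpace E] [BorelSpace E] {μ : Measure E} [μ.IsAddHaarMeasure]

/-- A Lipschitz function whose derivative along a Lipschitz vector field vanishes almost
everywhere is constant along the integral curves. -/
theorem eq_of_fderiv_eq_zero_along {F : Type*} [NormedAddCommGroup F] [NormedSpace ℝ F]
    [FiniteDimensional ℝ F] {g : E → F} {C C' : NNReal} (hg : LipschitzWith C g) {u : E → E}
    (hu : LipschitzWith C' u) {x₀ : E} {R : ℝ} (hR : 0 < R)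
    (h0 : ∀ᵐ y ∂μ, y ∈ Metric.ball x₀ R → fderiv ℝ g y (u y) = 0) {p : ℝ → E}
    (hp : ∀ t ∈ Icc (0 : ℝ) 1, HasDerivWithinAt p (u (p t)) (Icc 0 1) t)
    (hpR : ∀ t ∈ Icc (0 : ℝ) 1, p t ∈ Metric.ball x₀ (R / 2)) : g (p 1) = g (p 0) := by
  -- The curve may lie entirely in the exceptional null set, so the derivative is integrated for a
  -- mollification of `g`. Its derivative along `u` is `O(r)` at every point of the curve; the half
  -- radius leaves room for the averaging.
  have main : ∀ r : ℝ, 0 < r → r < R / 2 → ‖g (p 1) - g (p 0)‖ ≤ r * (C * C' + 2 * C) := by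
    intro r hr hrR
    let φ : ContDiffBump (0 : E) := ⟨r / 2, r, by positivity, by linarith⟩
    have hd : ∀ t ∈ Icc (0 : ℝ) 1, HasDerivWithinAt (fun t => mollify μ φ g (p t))
        (fderiv ℝ (mollify μ φ g) (p t) (u (p t))) (Icc 0 1) t := fun t ht =>
      ((contDiff_mollify φ hg.continuous).differentiable (by simp)
        (p t)).hasFDerivAt.comp_hasDerivWithinAt t (hp t ht)
    have h1 := norm_image_sub_le_of_norm_deriv_le_segment_01' hd (C := C * (C' * r))
      (fun t ht => norm_fderiv_mollify_apply_le φ hg hu (by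
        filter_upwards [h0] with y hy hy'
        refine hy (Metric.ball_subset_ball' ?_ hy')
        have := Metric.mem_ball.1 (hpR t (Ico_subset_Icc_self ht))
        change r + _ ≤ R
        linarith))
    have h2 : ∀ y, ‖mollify μ φ g y - g y‖ ≤ C * r := dist_mollify_le φ hg
    have e : g (p 1) - g (p 0) = (mollify μ φ g (p 1) - mollify μ φ g (p 0))
        - (mollify μ φ g (p 1) - g (p 1)) + (mollify μ φ g (p 0) - g (p 0)) := by abel
    rw [e]
    calc _ ≤ _ := norm_add_le _ _
      _ ≤ _ := add_le_add_left (norm_sub_le _ _) _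
      _ ≤ _ := by linarith [h2 (p 1), h2 (p 0)]
  have hl : Filter.Tendsto (fun r : ℝ => r * (C * C' + 2 * C : ℝ)) (𝓝[>] 0) (𝓝 0) := by
    refine Filter.Tendsto.mono_left ?_ nhdsWithin_le_nhds
    have : Continuous (fun r : ℝ => r * (C * C' + 2 * C : ℝ)) := by fun_prop
    simpa using this.tendsto 0
  have : ‖g (p 1) - g (p 0)‖ ≤ 0 := by
    refine ge_of_tendsto hl ?_
    filter_upwards [Ioo_mem_nhdsGT (half_pos hR)] with r hr
    exact main r hr.1 hr.2
  rwa [norm_le_zero_iff, sub_eq_zero] at this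

/-- Two points of the box on the same leaf differ by `ι (j a)`, and by convexity the segment between
them stays in the box. Its image is an integral curve of a field along which `g` has zero derivative
almost everywhere. -/
theorem box_eq_of_fderiv_eq_zero {F : Type*} [NormedAddCommGroup F] [NormedSpace ℝ F]
    [FiniteDimensional ℝ F]
    (hinc : ∀ v c, v ∈ Φ.source → v + ι c ∈ Φ.source →
      ‖Φ (v + ι c) - Φ v - X (Φ v) c‖ ≤ A * ‖c‖ ^ 2)
    {C C' : NNReal} (hX : LipschitzWith C' X) {x₀ : E} {R : ℝ} (hR : 0 < R)
    (hconv : Convex ℝ Φ.source) (htgt : Φ.target ⊆ Metric.ball x₀ (R / 2)) {g : E → F}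
    (hg : LipschitzWith C g) (j : V₁ →L[ℝ] K) (hj : ∀ a, ι (j a) = (a, 0))
    (h0 : ∀ᵐ y ∂μ, y ∈ Metric.ball x₀ R → ∀ a, fderiv ℝ g y (X y (j a)) = 0) {v w : V₁ × V₂}
    (hv : v ∈ Φ.source) (hw : w ∈ Φ.source) (hvw : v.2 = w.2) : g (Φ v) = g (Φ w) := by
  set c := j (w.1 - v.1) with hc
  have hιc : ι c = w - v := by rw [hc, hj]; ext <;> simp [hvw]
  have hseg : ∀ t ∈ Icc (0 : ℝ) 1, v + t • ι c ∈ Φ.source := by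
    intro t ht
    rw [hιc]
    exact hconv.add_smul_sub_mem hv hw ht
  have := eq_of_fderiv_eq_zero_along (μ := μ) hg (hX.apply_const c) hR (by
    filter_upwards [h0] with y hy hy'
    exact hy hy' _) (p := fun t => Φ (v + t • ι c))
    (fun t ht => (hasDerivAt_box hinc c (hseg t ht)).hasDerivWithinAt)
    (fun t ht => htgt (Φ.map_source (hseg t ht)))
  simp only [one_smul, zero_smul, add_zero, hιc, add_sub_cancel] at this
  exact this.symm

end Box

/-! ### Complex coordinate vectors and complexified linear maps -/

section ComplexExtension

variable {k : ℕ}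

/-- Componentwise real part. -/
noncomputable def reC : (Fin k → ℂ) →L[ℝ] (Fin k → ℝ) :=
  ContinuousLinearMap.pi fun i => Complex.reCLM.comp (ContinuousLinearMap.proj i)

/-- Componentwise imaginary part. -/
noncomputable def imC : (Fin k → ℂ) →L[ℝ] (Fin k → ℝ) :=
  ContinuousLinearMap.pi fun i => Complex.imCLM.comp (ContinuousLinearMap.proj i)

/-- The inclusion of real vectors into complex vectors. -/
noncomputable def toC : (Fin k → ℝ) →L[ℝ] (Fin k → ℂ) :=
  ContinuousLinearMap.pi fun i => Complex.ofRealCLM.comp (ContinuousLinearMap.proj i)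

@[simp] theorem reC_apply (c : Fin k → ℂ) (i : Fin k) : reC c i = (c i).re := rfl
@[simp] theorem imC_apply (c : Fin k → ℂ) (i : Fin k) : imC c i = (c i).im := rfl
@[simp] theorem toC_apply (c : Fin k → ℝ) (i : Fin k) : toC c i = (c i : ℂ) := rfl

@[simp] theorem reC_toC (c : Fin k → ℝ) : reC (toC c) = c := by ext; simp
@[simp] theorem imC_toC (c : Fin k → ℝ) : imC (toC c) = 0 := by ext; simp

theorem reC_smul (z : ℂ) (c : Fin k → ℂ) : reC (z • c) = z.re • reC c - z.im • imC c := by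
  ext; simp

theorem imC_smul (z : ℂ) (c : Fin k → ℂ) : imC (z • c) = z.re • imC c + z.im • reC c := by
  ext; simp

theorem toC_reC_add (c : Fin k → ℂ) : toC (reC c) + Complex.I • toC (imC c) = c := by
  ext i
  simp only [Pi.add_apply, toC_apply, reC_apply, Pi.smul_apply, imC_apply, smul_eq_mul]
  rw [mul_comm, Complex.re_add_im]

section

variable {F : Type*} [AddCommGroup F] [Module ℝ F] [Module ℂ F] [IsScalarTower ℝ ℂ F]

/-- The complex linear extension of a real linear map. -/
noncomputable def extC (B : (Fin k → ℝ) →ₗ[ℝ] F) : (Fin k → ℂ) →ₗ[ℂ] F where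
  toFun c := B (reC c) + Complex.I • B (imC c)
  map_add' c c' := by simp only [map_add, smul_add]; abel
  map_smul' z c := by
    have hc : ∀ (a : ℝ) (x : F), (a : ℂ) • x = a • x := fun a x => algebraMap_smul ℂ a x
    have hz : ∀ x : F, z • x = z.re • x + z.im • (Complex.I • x) := fun x => by
      conv_lhs => rw [← Complex.re_add_im z]
      rw [add_smul, mul_smul, hc, hc]
    have hI : ∀ (a : ℝ) (x : F), Complex.I • (a • x) = a • (Complex.I • x) := fun a x => by
      rw [← hc, ← hc, smul_smul, smul_smul, mul_comm]
    have hII : ∀ x : F, Complex.I • (Complex.I • x) = -x := fun x => by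
      rw [smul_smul, Complex.I_mul_I, neg_smul, one_smul]
    simp only [reC_smul, imC_smul, map_add, map_sub, map_smul, RingHom.id_apply, smul_add, hz,
      hI, hII]
    module

theorem extC_apply (B : (Fin k → ℝ) →ₗ[ℝ] F) (c : Fin k → ℂ) :
    extC B c = B (reC c) + Complex.I • B (imC c) := rfl

end

section

variable {T : Type*} [AddCommGroup T] [Module ℝ T]

/-- The complexification of a real linear map, on coordinate vectors. -/
noncomputable def cplx (D : (Fin k → ℝ) →ₗ[ℝ] T) : (Fin k → ℂ) →ₗ[ℂ] ℂ ⊗[ℝ] T :=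
  extC (TensorProduct.mk ℝ ℂ T 1 ∘ₗ D)

theorem cplx_apply (D : (Fin k → ℝ) →ₗ[ℝ] T) (c : Fin k → ℂ) :
    cplx D c = cvec (D (reC c)) (D (imC c)) := by
  simp [cplx, extC_apply, cvec, TensorProduct.smul_tmul']

@[simp] theorem rePart_cplx (D : (Fin k → ℝ) →ₗ[ℝ] T) (c : Fin k → ℂ) :
    rePart (cplx D c) = D (reC c) := by rw [cplx_apply, rePart_cvec]

@[simp] theorem imPart_cplx (D : (Fin k → ℝ) →ₗ[ℝ] T) (c : Fin k → ℂ) :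
    imPart (cplx D c) = D (imC c) := by rw [cplx_apply, imPart_cvec]

theorem cvec_ext {w w' : ℂ ⊗[ℝ] T} (h : rePart w = rePart w') (h' : imPart w = imPart w') :
    w = w' := by
  rw [← cvec_rePart_imPart w, ← cvec_rePart_imPart w', h, h']

theorem cplx_injective {D : (Fin k → ℝ) →ₗ[ℝ] T} (hD : Function.Injective D) :
    Function.Injective (cplx D) := by
  intro c c' h
  have h1 := congrArg rePart h
  have h2 := congrArg imPart h
  simp only [rePart_cplx, imPart_cplx] at h1 h2
  rw [← toC_reC_add c, ← toC_reC_add c', hD h1, hD h2]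

end

end ComplexExtension

/-! ### Brackets expressed in a commuting frame -/

section Bracket

variable {k : ℕ} {E : Type*} [NormedAddCommGroup E] [NormedSpace ℝ E]

/-- The product rule produces terms that differentiate the frame and terms that differentiate the
coefficients. The former cancel by commutation. -/
theorem lieBracket_frame {X : E → (Fin k → ℝ) →L[ℝ] E} {f g : E → Fin k → ℝ} {x : E}
    (hX : DifferentiableAt ℝ X x)
    (hcomm : ∀ c c', fderiv ℝ X x (X x c) c' = fderiv ℝ X x (X x c') c)
    (hf : DifferentiableAt ℝ f x) (hg : DifferentiableAt ℝ g x) :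
    VectorField.lieBracket ℝ (fun y => X y (f y)) (fun y => X y (g y)) x
      = X x (fderiv ℝ g x (X x (f x)) - fderiv ℝ f x (X x (g x))) := by
  rw [VectorField.lieBracket, fderiv_clm_apply hX hf, fderiv_clm_apply hX hg]
  simp only [add_apply, ContinuousLinearMap.comp_apply, ContinuousLinearMap.flip_apply, map_sub]
  rw [hcomm (f x) (g x)]
  abel

/-- The complex bilinear extension of the Lie bracket in a vector space. -/
noncomputable def flatCBracket (Zr Zi Wr Wi : E → E) (x : E) : ℂ ⊗[ℝ] E :=
  cvec (VectorField.lieBracket ℝ Zr Wr x - VectorField.lieBracket ℝ Zi Wi x)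
    (VectorField.lieBracket ℝ Zr Wi x + VectorField.lieBracket ℝ Zi Wr x)

theorem fderiv_reC {f : E → Fin k → ℂ} {x : E} (hf : DifferentiableAt ℝ f x) (u : E) :
    fderiv ℝ (fun y => reC (f y)) x u = reC (fderiv ℝ f x u) :=
  congrArg (fun A : E →L[ℝ] (Fin k → ℝ) => A u) (reC.hasFDerivAt.comp x hf.hasFDerivAt).fderiv

theorem fderiv_imC {f : E → Fin k → ℂ} {x : E} (hf : DifferentiableAt ℝ f x) (u : E) :
    fderiv ℝ (fun y => imC (f y)) x u = imC (fderiv ℝ f x u) :=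
  congrArg (fun A : E →L[ℝ] (Fin k → ℝ) => A u) (imC.hasFDerivAt.comp x hf.hasFDerivAt).fderiv

/-- The derivative of `g` along the complex combination `c` of the fields `X`. -/
noncomputable def frameDeriv {F : Type*} [NormedAddCommGroup F] [NormedSpace ℝ F]
    [NormedSpace ℂ F] [IsScalarTower ℝ ℂ F] (X : E → (Fin k → ℝ) →L[ℝ] E) (g : E → F) (x : E) :
    (Fin k → ℂ) →ₗ[ℂ] F :=
  extC ((fderiv ℝ g x).comp (X x)).toLinearMap

theorem frameDeriv_apply {F : Type*} [NormedAddCommGroup F] [NormedSpace ℝ F]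
    [NormedSpace ℂ F] [IsScalarTower ℝ ℂ F] (X : E → (Fin k → ℝ) →L[ℝ] E) (g : E → F) (x : E)
    (c : Fin k → ℂ) : frameDeriv X g x c
      = fderiv ℝ g x (X x (reC c)) + Complex.I • fderiv ℝ g x (X x (imC c)) := rfl

theorem flatCBracket_frame {X : E → (Fin k → ℝ) →L[ℝ] E} {f g : E → Fin k → ℂ} {x : E}
    (hX : DifferentiableAt ℝ X x)
    (hcomm : ∀ c c', fderiv ℝ X x (X x c) c' = fderiv ℝ X x (X x c') c)
    (hf : DifferentiableAt ℝ f x) (hg : DifferentiableAt ℝ g x) :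
    flatCBracket (fun y => X y (reC (f y))) (fun y => X y (imC (f y)))
        (fun y => X y (reC (g y))) (fun y => X y (imC (g y))) x
      = cplx (X x).toLinearMap (frameDeriv X g x (f x) - frameDeriv X f x (g x)) := by
  have hfr : DifferentiableAt ℝ (fun y => reC (f y)) x := by fun_prop
  have hfi : DifferentiableAt ℝ (fun y => imC (f y)) x := by fun_prop
  have hgr : DifferentiableAt ℝ (fun y => reC (g y)) x := by fun_prop
  have hgi : DifferentiableAt ℝ (fun y => imC (g y)) x := by fun_prop
  rw [flatCBracket, lieBracket_frame hX hcomm hfr hgr, lieBracket_frame hX hcomm hfi hgi,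
    lieBracket_frame hX hcomm hfr hgi, lieBracket_frame hX hcomm hfi hgr, cplx_apply]
  simp only [fderiv_reC hf, fderiv_reC hg, fderiv_imC hf, fderiv_imC hg, frameDeriv_apply,
    map_sub, map_add, reC_smul, imC_smul, Complex.I_re, Complex.I_im, zero_smul, one_smul,
    ContinuousLinearMap.coe_coe]
  congr 1 <;> abel

end Bracket

/-! ### The structure equation and invariance along leaves -/

section Leaves

variable {k : ℕ} {E : Type*} [NormedAddCommGroup E] [NormedSpace ℝ E] [FiniteDimensional ℝ E]

/-- Coefficient form of involutivity, for a family `Q` of projections onto the bundle. -/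
def StructureEq (X : E → (Fin k → ℝ) →L[ℝ] E)
    (Q : E → (Fin k → ℂ) →L[ℂ] (Fin k → ℂ)) (x : E) : Prop :=
  ∀ v w, frameDeriv X Q x (Q x v) w = frameDeriv X Q x (Q x w) v

/-- Put `v = toC c` in the structure equation. The right side differentiates the locally constant
map `y ↦ Q y (toC c)` and vanishes; the left side is the derivative of `Q` along `X x c`, applied to
`w`. -/
theorem fderiv_eq_zero_of_structureEq {X : E → (Fin k → ℝ) →L[ℝ] E}
    {Q : E → (Fin k → ℂ) →L[ℂ] (Fin k → ℂ)} {x : E} (hQ : DifferentiableAt ℝ Q x)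
    (h : StructureEq X Q x) {c : Fin k → ℝ} (hc : ∀ᶠ y in 𝓝 x, Q y (toC c) = toC c) :
    fderiv ℝ Q x (X x c) = 0 := by
  have h0 : ∀ u, fderiv ℝ Q x u (toC c) = 0 := by
    intro u
    have h1 : HasFDerivAt (fun y => Q y (toC c))
        (((ContinuousLinearMap.apply ℂ (Fin k → ℂ) (toC c)).restrictScalars ℝ).comp
          (fderiv ℝ Q x)) x :=
      ((ContinuousLinearMap.apply ℂ (Fin k → ℂ) (toC c)).restrictScalars ℝ).hasFDerivAt.comp x
        hQ.hasFDerivAt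
    have h2 : HasFDerivAt (fun y => Q y (toC c)) (0 : E →L[ℝ] (Fin k → ℂ)) x :=
      (hasFDerivAt_const (toC c) x).congr_of_eventuallyEq hc
    exact congrArg (fun A : E →L[ℝ] (Fin k → ℂ) => A u) (h1.unique h2)
  ext1 w
  have := h (toC c) w
  rw [hc.self_of_nhds, frameDeriv_apply, frameDeriv_apply] at this
  simpa [h0] using this

end Leaves

/-! ### Descent of the structure equation to the base of the flow box -/

section Descend

variable {k : ℕ} {E V₁ V₂ : Type*} [NormedAddCommGroup E] [NormedSpace ℝ E]
  [FiniteDimensional ℝ E] [MeasurableSpace E] [BorelSpace E] {μ : Measure E} [μ.IsAddHaarMeasure]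
  [NormedAddCommGroup V₁] [NormedSpace ℝ V₁] [FiniteDimensional ℝ V₁]
  [NormedAddCommGroup V₂] [NormedSpace ℝ V₂] [FiniteDimensional ℝ V₂]
  [MeasurableSpace V₂] [BorelSpace V₂] {ν₂ : Measure V₂} [ν₂.IsAddHaarMeasure]
  {X : E → (Fin k → ℝ) →L[ℝ] E} {ι : (Fin k → ℝ) →L[ℝ] V₁ × V₂}
  {Φ : OpenPartialHomeomorph (V₁ × V₂) E} {A ρ : ℝ} {D : NNReal}
  {Q : E → (Fin k → ℂ) →L[ℂ] (Fin k → ℂ)}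

/-- Both sides differentiate the same function along the curve `s ↦ Φ (v + s • ι c)`, which is an
integral curve upstairs and projects to a straight line downstairs. -/
theorem fderiv_descend
    (hinc : ∀ v c, v ∈ Φ.source → v + ι c ∈ Φ.source →
      ‖Φ (v + ι c) - Φ v - X (Φ v) c‖ ≤ A * ‖c‖ ^ 2)
    {Q' : V₂ → (Fin k → ℂ) →L[ℂ] (Fin k → ℂ)} (hQ' : ∀ v ∈ Φ.source, Q' v.2 = Q (Φ v))
    {v : V₁ × V₂} (hv : v ∈ Φ.source) (hd : DifferentiableAt ℝ Q (Φ v))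
    (hd' : DifferentiableAt ℝ Q' v.2) (c : Fin k → ℝ) :
    fderiv ℝ Q' v.2 (ι c).2 = fderiv ℝ Q (Φ v) (X (Φ v) c) := by
  have hv0 : v + (0 : ℝ) • ι c ∈ Φ.source := by simpa using hv
  have h1 := hasDerivAt_box hinc c hv0
  have h2 : HasDerivAt (fun s : ℝ => Q (Φ (v + s • ι c))) (fderiv ℝ Q (Φ v) (X (Φ v) c)) 0 := by
    have h := HasFDerivAt.comp_hasDerivAt (f := fun s : ℝ => Φ (v + s • ι c)) (l := Q)
      (l' := fderiv ℝ Q (Φ v)) 0 (by simpa using hd.hasFDerivAt) h1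
    simpa [Function.comp_def] using h
  have h3 : HasDerivAt (fun s : ℝ => Q' (v.2 + s • (ι c).2)) (fderiv ℝ Q' v.2 (ι c).2) 0 :=
    hd'.hasFDerivAt.hasLineDerivAt (ι c).2
  refine h3.unique (h2.congr_of_eventuallyEq ?_)
  have hc : Continuous fun s : ℝ => v + s • ι c := by fun_prop
  filter_upwards [hc.continuousAt.preimage_mem_nhds (Φ.open_source.mem_nhds hv0)] with s hs
  exact hQ' _ hs

/-- The exceptional set upstairs stays null under the Lipschitz inverse chart, so by Fubini some
slice `{a} × V₂` meets it in a null set. At the other points of that slice where `Q'` is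
differentiable, the derivatives of `Q` and `Q'` match. -/
theorem ae_structureEq_descend [MeasurableSpace V₁] [BorelSpace V₁] (ν₁ : Measure V₁)
    [ν₁.IsAddHaarMeasure] (hdim : Module.finrank ℝ E = Module.finrank ℝ (V₁ × V₂))
    (hinc : ∀ v c, v ∈ Φ.source → v + ι c ∈ Φ.source →
      ‖Φ (v + ι c) - Φ v - X (Φ v) c‖ ≤ A * ‖c‖ ^ 2)
    (hρ : 0 < ρ) (hsrc : Φ.source = Metric.ball 0 ρ)
    (hΦs : LipschitzOnWith D Φ.symm Φ.target) {C C' : NNReal} (hQ : LipschitzWith C Q)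
    (hst : ∀ᵐ x ∂μ, x ∈ Φ.target → StructureEq X Q x)
    {Q' : V₂ → (Fin k → ℂ) →L[ℂ] (Fin k → ℂ)} (hQ' : ∀ v ∈ Φ.source, Q' v.2 = Q (Φ v))
    (hQ'L : LipschitzOnWith C' Q' (Metric.ball 0 ρ)) :
    ∀ᵐ y ∂ν₂, y ∈ Metric.ball 0 ρ → DifferentiableAt ℝ Q' y ∧
      StructureEq (fun _ => (ContinuousLinearMap.snd ℝ V₁ V₂).comp ι) Q' y := by
  have hgood : ∀ᵐ x ∂μ, x ∈ Φ.target → DifferentiableAt ℝ Q x ∧ StructureEq X Q x := by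
    filter_upwards [hst, hQ.ae_differentiableAt] with x h1 h2 hx
    exact ⟨h2, h1 hx⟩
  set N := {x | ¬ (x ∈ Φ.target → DifferentiableAt ℝ Q x ∧ StructureEq X Q x)} with hN
  have hN0 : μ N = 0 := hgood
  have hNt : N ⊆ Φ.target := fun x hx => by
    by_contra h
    exact hx fun h' => absurd h' h
  have hN1 : (ν₁.prod ν₂) (Φ.symm '' N) = 0 :=
    (hΦs.mono hNt).measure_image_eq_zero hdim hN0
  have hbox : ∀ᵐ v ∂(ν₁.prod ν₂), v ∈ Φ.source →
      DifferentiableAt ℝ Q (Φ v) ∧ StructureEq X Q (Φ v) := by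
    filter_upwards [measure_eq_zero_iff_ae_notMem.1 hN1] with v hv hvs
    by_contra h
    exact hv ⟨Φ v, fun h' => h (h' (Φ.map_source hvs)), Φ.left_inv hvs⟩
  have hpos : ν₁ (Metric.ball 0 ρ) ≠ 0 := (Metric.measure_ball_pos ν₁ 0 hρ).ne'
  -- Otherwise every point of the ball would be exceptional for Fubini, contradicting its positive
  -- measure.
  obtain ⟨a, ha, hay⟩ : ∃ a ∈ Metric.ball (0 : V₁) ρ, ∀ᵐ y ∂ν₂, (a, y) ∈ Φ.source →
      DifferentiableAt ℝ Q (Φ (a, y)) ∧ StructureEq X Q (Φ (a, y)) := by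
    by_contra h
    refine hpos (measure_mono_null (fun a ha => ?_) (Measure.ae_ae_of_ae_prod hbox))
    exact fun h' => h ⟨a, ha, h'⟩
  have hdiff := hQ'L.ae_differentiableWithinAt_of_mem (μ := ν₂)
  filter_upwards [hay, hdiff] with y h1 h2 hy
  have hys : (a, y) ∈ Φ.source := by
    rw [hsrc, mem_ball_zero_iff, Prod.norm_def, max_lt_iff]
    exact ⟨mem_ball_zero_iff.1 ha, mem_ball_zero_iff.1 hy⟩
  have hd' : DifferentiableAt ℝ Q' y := (h2 hy).differentiableAt (Metric.isOpen_ball.mem_nhds hy)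
  obtain ⟨hd, hs⟩ := h1 hys
  refine ⟨hd', fun v w => ?_⟩
  have key : ∀ c, frameDeriv (fun _ => (ContinuousLinearMap.snd ℝ V₁ V₂).comp ι) Q' y c
      = frameDeriv X Q (Φ (a, y)) c := by
    intro c
    have h := fderiv_descend hinc hQ' hys hd hd'
    rw [frameDeriv_apply, frameDeriv_apply, ← h, ← h]
    rfl
  rw [key, key]
  have hQy := hQ' _ hys
  simp only at hQy
  rw [hQy]
  exact hs v w

end Descend

/-! ### Real derivatives of complex linear families -/

section ProductRule

variable {k : ℕ} {E : Type*} [NormedAddCommGroup E] [NormedSpace ℝ E]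
  {G F : Type*} [NormedAddCommGroup G] [NormedSpace ℝ G] [NormedSpace ℂ G] [IsScalarTower ℝ ℂ G]
  [NormedAddCommGroup F] [NormedSpace ℝ F] [NormedSpace ℂ F] [IsScalarTower ℝ ℂ F]

theorem hasFDerivAt_cclm_apply {Q : E → G →L[ℂ] F} {f : E → G} {x : E}
    (hQ : DifferentiableAt ℝ Q x) (hf : DifferentiableAt ℝ f x) :
    HasFDerivAt (fun y => Q y (f y)) ((((ContinuousLinearMap.restrictScalarsL ℂ G F ℝ ℝ).comp
      (fderiv ℝ Q x)).flip (f x)) + ((Q x).restrictScalars ℝ).comp (fderiv ℝ f x)) x := by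
  have h1 : HasFDerivAt (fun y => (Q y).restrictScalars ℝ)
      ((ContinuousLinearMap.restrictScalarsL ℂ G F ℝ ℝ).comp (fderiv ℝ Q x)) x :=
    (ContinuousLinearMap.restrictScalarsL ℂ G F ℝ ℝ).hasFDerivAt.comp x hQ.hasFDerivAt
  have h2 := h1.clm_apply hf.hasFDerivAt
  rw [add_comm] at h2
  exact h2

theorem fderiv_cclm_apply {Q : E → G →L[ℂ] F} {f : E → G} {x : E}
    (hQ : DifferentiableAt ℝ Q x) (hf : DifferentiableAt ℝ f x) (u : E) :
    fderiv ℝ (fun y => Q y (f y)) x u = fderiv ℝ Q x u (f x) + Q x (fderiv ℝ f x u) := by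
  rw [(hasFDerivAt_cclm_apply hQ hf).fderiv]
  rfl

theorem frameDeriv_cclm_apply {X : E → (Fin k → ℝ) →L[ℝ] E} {Q : E → G →L[ℂ] F} {f : E → G}
    {x : E} (hQ : DifferentiableAt ℝ Q x) (hf : DifferentiableAt ℝ f x) (c : Fin k → ℂ) :
    frameDeriv X (fun y => Q y (f y)) x c
      = frameDeriv X Q x c (f x) + Q x (frameDeriv X f x c) := by
  simp only [frameDeriv_apply, fderiv_cclm_apply hQ hf, map_add, map_smul, smul_add, add_apply,
    smul_apply]
  abel

end ProductRule

/-! ### The manifold notions specialized to Euclidean space -/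

section Euclidean

variable {d : ℕ}

theorem chartRep_euc (c : Euc d) (X : ∀ q : Euc d, TangentSpace (𝓡 d) q) (y : Euc d) :
    chartRep c X y = X y := by
  simp only [chartRep, chartAt_self_eq, OpenPartialHomeomorph.refl_symm]
  exact congrArg (fun A : Euc d →L[ℝ] Euc d => A (X y)) (mfderiv_id (I := 𝓡 d) (x := y))

theorem isLipFieldOn_euc {X : ∀ q : Euc d, TangentSpace (𝓡 d) q} {U : Set (Euc d)} :
    IsLipFieldOn X U ↔ LocallyLipschitzOn U (fun y => (X y : Euc d)) := by
  have h : ∀ c : Euc d, chartRep c X = fun y => (X y : Euc d) := fun c => funext (chartRep_euc c X)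
  simp only [IsLipFieldOn, h, chartAt_self_eq, OpenPartialHomeomorph.refl_target,
    OpenPartialHomeomorph.refl_symm, univ_inter]
  exact ⟨fun h => h 0, fun h _ => h⟩

theorem aeOn_euc {U : Set (Euc d)} {P : Euc d → Prop} :
    AEOn d U P ↔ ∀ᵐ y : Euc d, y ∈ U → P y := by
  simp only [AEOn, chartAt_self_eq, OpenPartialHomeomorph.refl_target, mem_univ, true_imp_iff,
    OpenPartialHomeomorph.refl_symm, OpenPartialHomeomorph.refl_apply]
  exact ⟨fun h => h 0, fun h _ => h⟩

theorem cBracket_euc (Z W : ∀ q : Euc d, CTangent d q) (y : Euc d) :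
    cBracket Z W y = flatCBracket (fun y => rePart (Z y)) (fun y => imPart (Z y))
      (fun y => rePart (W y)) (fun y => imPart (W y)) y := by
  have h : ∀ V W : (∀ q : Euc d, TangentSpace (𝓡 d) q), VectorField.mlieBracket (𝓡 d) V W y
      = VectorField.lieBracket ℝ V W y := fun V W => by
    rw [← VectorField.mlieBracketWithin_univ, VectorField.mlieBracketWithin_eq_lieBracketWithin]
    exact congrFun (VectorField.lieBracketWithin_univ (𝕜 := ℝ) (V := (V : Euc d → Euc d))) y
  rw [cBracket, flatCBracket]
  exact congrArg₂ cvec (congrArg₂ _ (h _ _) (h _ _)) (congrArg₂ _ (h _ _) (h _ _))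

end Euclidean

/-! ### Rademacher's theorem and composition for locally Lipschitz maps -/

section LocallyLipschitz

theorem LocallyLipschitzOn.ae_differentiableAt {E F : Type*} [NormedAddCommGroup E]
    [NormedSpace ℝ E] [FiniteDimensional ℝ E] [MeasurableSpace E] [BorelSpace E]
    [NormedAddCommGroup F] [NormedSpace ℝ F] [FiniteDimensional ℝ F] {μ : Measure E}
    [μ.IsAddHaarMeasure] {f : E → F} {s : Set E} (hf : LocallyLipschitzOn s f) (hs : IsOpen s) :
    ∀ᵐ x ∂μ, x ∈ s → DifferentiableAt ℝ f x := by
  have h0 : μ {x | x ∈ s ∧ ¬ DifferentiableAt ℝ f x} = 0 := by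
    refine measure_null_of_locally_null _ fun x hx => ?_
    obtain ⟨C, t, ht, hft⟩ := hf hx.1
    rw [hs.nhdsWithin_eq hx.1] at ht
    refine ⟨interior t ∩ {x | x ∈ s ∧ ¬ DifferentiableAt ℝ f x},
      Filter.inter_mem (mem_nhdsWithin_of_mem_nhds (interior_mem_nhds.2 ht)) self_mem_nhdsWithin, ?_⟩
    refine measure_mono_null ?_ ((hft.mono interior_subset).ae_differentiableWithinAt_of_mem)
    rintro y ⟨hy, -, hy'⟩ h
    exact hy' ((h hy).differentiableAt (isOpen_interior.mem_nhds hy))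
  rw [measure_eq_zero_iff_ae_notMem] at h0
  filter_upwards [h0] with x hx hxs
  by_contra h
  exact hx ⟨hxs, h⟩

theorem LipschitzWith.comp_locallyLipschitzOn {α β γ : Type*} [PseudoEMetricSpace α]
    [PseudoEMetricSpace β] [PseudoEMetricSpace γ] {g : β → γ} {f : α → β} {C : NNReal} {s : Set α}
    (hg : LipschitzWith C g) (hf : LocallyLipschitzOn s f) :
    LocallyLipschitzOn s fun x => g (f x) := fun x hx => by
  obtain ⟨K, t, ht, h⟩ := hf hx
  exact ⟨C * K, t, ht, hg.comp_lipschitzOnWith h⟩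

theorem LipschitzOnWith.locallyLipschitzOn {α β : Type*} [PseudoEMetricSpace α]
    [PseudoEMetricSpace β] {f : α → β} {C : NNReal} {s : Set α}
    (hf : LipschitzOnWith C f s) : LocallyLipschitzOn s f :=
  fun _ _ => ⟨C, s, self_mem_nhdsWithin, hf⟩

end LocallyLipschitz

/-! ### The quotient Levi-flat CR structure defined by a family of projections -/

section ProjBundle

variable {k d : ℕ}

@[simp] theorem reC_star (c : Fin k → ℂ) : reC (star c) = reC c := by ext; simp
@[simp] theorem imC_star (c : Fin k → ℂ) : imC (star c) = -imC c := by ext; simp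

theorem toC_reC_eq (c : Fin k → ℂ) : toC (reC c) = (1 / 2 : ℂ) • (c + star c) := by
  ext i
  simp only [toC_apply, reC_apply, Pi.smul_apply, Pi.add_apply, Pi.star_apply, smul_eq_mul]
  apply Complex.ext <;> (simp; try ring)

theorem toC_imC_eq (c : Fin k → ℂ) : toC (imC c) = (-Complex.I / 2) • (c - star c) := by
  ext i
  simp only [toC_apply, imC_apply, Pi.smul_apply, Pi.sub_apply, Pi.star_apply, smul_eq_mul]
  apply Complex.ext <;> (simp; try ring)

theorem conjVec_cplx {T : Type*} [AddCommGroup T] [Module ℝ T] (D : (Fin k → ℝ) →ₗ[ℝ] T)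
    (c : Fin k → ℂ) : conjVec (cplx D c) = cplx D (star c) := by
  rw [cplx_apply, cplx_apply, conjVec_cvec, reC_star, imC_star, map_neg]

theorem cplx_eq_zero {T : Type*} [AddCommGroup T] [Module ℝ T] {D : (Fin k → ℝ) →ₗ[ℝ] T}
    {c : Fin k → ℂ} : cplx D c = 0 ↔ D (reC c) = 0 ∧ D (imC c) = 0 := by
  refine ⟨fun h => ⟨?_, ?_⟩, fun h => ?_⟩
  · simpa using congrArg rePart h
  · simpa using congrArg imPart h
  · rw [cplx_apply, h.1, h.2]; simp [cvec]

/-- The bundle with fibre the image of the range of `Q y` under the complexification of `D`. -/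
noncomputable def projBundle (D : (Fin k → ℝ) →L[ℝ] Euc d)
    (Q : Euc d → (Fin k → ℂ) →L[ℂ] (Fin k → ℂ)) (y : Euc d) : Submodule ℂ (CTangent d y) :=
  (LinearMap.range (Q y).toLinearMap).map (cplx (T := Euc d) D.toLinearMap)

variable {D : (Fin k → ℝ) →L[ℝ] Euc d} {Q : Euc d → (Fin k → ℂ) →L[ℂ] (Fin k → ℂ)}
  {W : Set (Euc d)}

theorem mem_projBundle {y : Euc d} {w : CTangent d y} :
    w ∈ projBundle D Q y ↔ ∃ v, cplx (T := Euc d) D.toLinearMap (Q y v) = w := by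
  constructor
  · rintro ⟨_, ⟨v, rfl⟩, rfl⟩
    exact ⟨v, rfl⟩
  · rintro ⟨v, rfl⟩
    exact ⟨_, ⟨v, rfl⟩, rfl⟩

theorem fixed_of_cplx_eq_zero {Q : (Fin k → ℂ) →L[ℂ] (Fin k → ℂ)}
    (hker : ∀ c, D c = 0 → Q (toC c) = toC c) {c : Fin k → ℂ}
    (h : cplx (T := Euc d) D.toLinearMap c = 0) : Q c = c := by
  obtain ⟨h1, h2⟩ := cplx_eq_zero.1 h
  conv_lhs => rw [← toC_reC_add c]
  rw [map_add, map_smul, hker _ h1, hker _ h2, toC_reC_add]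

/-- A vector killed by the complexified `D` is fixed by every projection of the family. Hence `Q y v
= Q z (Q y v) = Q z v`, because the projections share their kernel. The vectors `v` that die in the
quotient thus do not depend on the base point. -/
theorem cplx_proj_eq_zero
    (hQQ : ∀ y ∈ W, ∀ z ∈ W, ∀ v, Q y (Q z v) = Q y v)
    (hker : ∀ y ∈ W, ∀ c, Q y (toC c) = toC c ↔ D c = 0) {y z : Euc d} (hy : y ∈ W) (hz : z ∈ W)
    {v : Fin k → ℂ} (h : cplx (T := Euc d) D.toLinearMap (Q y v) = 0) :
    cplx (T := Euc d) D.toLinearMap (Q z v) = 0 := by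
  have := fixed_of_cplx_eq_zero (Q := Q z) (fun c => (hker z hz c).2) h
  rw [hQQ z hz y hy] at this
  rw [this, h]

/-- Since the kernel of `v ↦ cplx D (Q y v)` does not depend on `y`, constant vectors that give a
basis of the image at one point do so at every point. This yields both the constant rank and a frame
as regular as `Q`. -/
theorem exists_frame_map_range {T : Type*} [AddCommGroup T] [Module ℝ T] [Module.Finite ℝ T]
    {D : (Fin k → ℝ) →ₗ[ℝ] T} {Y : Type*} {Q : Y → (Fin k → ℂ) →ₗ[ℂ] (Fin k → ℂ)} {W : Set Y}
    (h0 : ∀ y ∈ W, ∀ z ∈ W, ∀ v, cplx D (Q y v) = 0 → cplx D (Q z v) = 0) {y₀ : Y}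
    (hy₀ : y₀ ∈ W) : ∃ (r : ℕ) (v : Fin r → Fin k → ℂ), ∀ y ∈ W,
      LinearIndependent ℂ (fun a => cplx D (Q y (v a))) ∧
      Submodule.span ℂ (range fun a => cplx D (Q y (v a))) =
        (LinearMap.range (Q y)).map (cplx D) := by
  set S := (LinearMap.range (Q y₀)).map (cplx D) with hS
  set B := Module.finBasis ℂ S with hB
  have hv : ∀ a, ∃ v, cplx D (Q y₀ v) = B a := fun a => by
    obtain ⟨_, ⟨v, rfl⟩, h⟩ := (B a).2
    exact ⟨v, h⟩
  choose v hv using hv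
  have hcomb : ∀ (y : Y) (g : Fin (Module.finrank ℂ S) → ℂ),
      ∑ a, g a • cplx D (Q y (v a)) = cplx D (Q y (∑ a, g a • v a)) := fun y g => by
    simp only [map_sum, map_smul]
  refine ⟨Module.finrank ℂ S, v, fun y hy => ⟨?_, le_antisymm ?_ ?_⟩⟩
  · rw [Fintype.linearIndependent_iff]
    intro g hg
    rw [hcomb] at hg
    have h2 := h0 y hy y₀ hy₀ _ hg
    rw [← hcomb] at h2
    simp only [hv] at h2
    have h3 : ∑ a, g a • B a = 0 := by
      apply Subtype.ext
      simpa using h2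
    exact Fintype.linearIndependent_iff.1 B.linearIndependent g h3
  · rw [Submodule.span_le]
    rintro _ ⟨a, rfl⟩
    exact ⟨_, ⟨v a, rfl⟩, rfl⟩
  · rintro _ ⟨_, ⟨u, rfl⟩, rfl⟩
    set b : S := ⟨cplx D (Q y₀ u), ⟨_, ⟨u, rfl⟩, rfl⟩⟩ with hb
    have h1 : cplx D (Q y₀ (u - ∑ a, B.repr b a • v a)) = 0 := by
      rw [map_sub, map_sub, ← hcomb, sub_eq_zero]
      simp only [hv]
      have := congrArg S.subtype (B.sum_repr b)
      simp only [map_sum, map_smul, Submodule.subtype_apply] at this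
      exact this.symm
    have h2 := h0 y₀ hy₀ y hy _ h1
    rw [map_sub, map_sub, sub_eq_zero, ← hcomb] at h2
    rw [h2]
    exact Submodule.sum_mem _ fun a _ => Submodule.smul_mem _ _ (Submodule.subset_span ⟨a, rfl⟩)

/-- A real vector is half the sum of an element of the range of `Q` and its conjugate. The second
half of involutivity downstairs follows from this alone, since brackets take values in the image of
the complexified `D`. -/
theorem cplx_mem_sup_conjSub {T : Type*} [AddCommGroup T] [Module ℝ T]
    {D : (Fin k → ℝ) →ₗ[ℝ] T} {Q : (Fin k → ℂ) →ₗ[ℂ] (Fin k → ℂ)}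
    (hre : ∀ c, ∃ v, reC (Q v) = c) (c : Fin k → ℂ) :
    cplx D c ∈ (LinearMap.range Q).map (cplx D) ⊔ conjSub ((LinearMap.range Q).map (cplx D)) := by
  have hreal : ∀ c, cplx D (toC c)
      ∈ (LinearMap.range Q).map (cplx D) ⊔ conjSub ((LinearMap.range Q).map (cplx D)) := by
    intro c
    obtain ⟨v, rfl⟩ := hre c
    rw [toC_reC_eq, map_smul, map_add]
    refine Submodule.smul_mem _ _ (Submodule.add_mem_sup ⟨_, ⟨v, rfl⟩, rfl⟩ ?_)
    change conjVec _ ∈ (LinearMap.range Q).map (cplx D)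
    rw [conjVec_cplx, star_star]
    exact ⟨_, ⟨v, rfl⟩, rfl⟩
  rw [← toC_reC_add c, map_add, map_smul]
  exact Submodule.add_mem _ (hreal _) (Submodule.smul_mem _ _ (hreal _))

theorem isLipSubbundleOn_projBundle (hW : IsOpen W) {C : NNReal} (hQL : LipschitzOnWith C Q W)
    (hQQ : ∀ y ∈ W, ∀ z ∈ W, ∀ v, Q y (Q z v) = Q y v)
    (hker : ∀ y ∈ W, ∀ c, Q y (toC c) = toC c ↔ D c = 0) :
    IsLipSubbundleOn (projBundle D Q) W := by
  intro y₀ hy₀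
  obtain ⟨r, v, hv⟩ := exists_frame_map_range (T := Euc d) (D := D.toLinearMap)
    (Q := fun y => (Q y).toLinearMap) (W := W)
    (fun y hy z hz v h => cplx_proj_eq_zero hQQ hker hy hz h) hy₀
  refine ⟨W, hW, hy₀, subset_rfl, r, fun a y => cplx (T := Euc d) D.toLinearMap (Q y (v a)),
    fun a => ⟨?_, ?_⟩, fun y hy => hv y hy⟩
  · rw [isLipFieldOn_euc]
    have e : ∀ y, rePart (cplx (T := Euc d) D.toLinearMap (Q y (v a))) = D (reC (Q y (v a))) :=
      fun y => rePart_cplx _ _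
    have h := (((D.comp reC).comp (((ContinuousLinearMap.apply ℂ (Fin k → ℂ)
      (v a))).restrictScalars ℝ)).lipschitz.comp_lipschitzOnWith hQL).locallyLipschitzOn
    refine Eq.mp ?_ h
    congr 1
    exact funext fun y => (e y).symm
  · rw [isLipFieldOn_euc]
    have e : ∀ y, imPart (cplx (T := Euc d) D.toLinearMap (Q y (v a))) = D (imC (Q y (v a))) :=
      fun y => imPart_cplx _ _
    have h := (((D.comp imC).comp (((ContinuousLinearMap.apply ℂ (Fin k → ℂ)
      (v a))).restrictScalars ℝ)).lipschitz.comp_lipschitzOnWith hQL).locallyLipschitzOn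
    refine Eq.mp ?_ h
    congr 1
    exact funext fun y => (e y).symm

/-- If the image of `c` and its conjugate both lie in the bundle, then `star c` differs from the
range of `Q y` by a vector in the kernel, which that range contains. So the real and imaginary parts
of `c` are real vectors fixed by `Q y`, and `D` kills them. -/
theorem projBundle_inf_conjSub {y : Euc d} (hQQ : ∀ v, Q y (Q y v) = Q y v)
    (hker : ∀ c, Q y (toC c) = toC c ↔ D c = 0) :
    projBundle D Q y ⊓ conjSub (projBundle D Q y) = ⊥ := by
  rw [eq_bot_iff]
  rintro w ⟨h1, h2⟩
  obtain ⟨v, rfl⟩ := mem_projBundle.1 h1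
  set c := Q y v with hc
  have hQc : Q y c = c := hQQ v
  obtain ⟨v', hv'⟩ := mem_projBundle.1 (show conjVec (cplx (T := Euc d) D.toLinearMap c) ∈
    projBundle D Q y from h2)
  have h3 : cplx (T := Euc d) D.toLinearMap (star c - Q y v') = 0 := by
    rw [map_sub, hv', conjVec_cplx, sub_self]
  have h4 := fixed_of_cplx_eq_zero (fun c => (hker c).2) h3
  rw [map_sub, hQQ, sub_left_inj] at h4
  have h5 : D (reC c) = 0 := by
    rw [← hker, toC_reC_eq, map_smul, map_add, hQc, h4]
  have h6 : D (imC c) = 0 := by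
    rw [← hker, toC_imC_eq, map_smul, map_sub, hQc, h4]
  exact (Submodule.mem_bot ℂ).2 (cplx_eq_zero.2 ⟨h5, h6⟩)

/-- Here `D` need not be surjective: the frame spans only the real parts of the bundle. A section
over its range, extended arbitrarily, is enough to lift sections to coefficients linearly. -/
theorem exists_linear_section {E F : Type*} [NormedAddCommGroup E] [NormedSpace ℝ E]
    [NormedAddCommGroup F] [NormedSpace ℝ F] [FiniteDimensional ℝ F] (D : E →L[ℝ] F) :
    ∃ R : F →L[ℝ] E, ∀ c, D (R (D c)) = D c := by
  obtain ⟨g, hg⟩ := D.toLinearMap.rangeRestrict.exists_rightInverse_of_surjective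
    (LinearMap.range_rangeRestrict _)
  obtain ⟨G, hG⟩ := LinearMap.exists_extend g
  refine ⟨LinearMap.toContinuousLinearMap G, fun c => ?_⟩
  have h1 : G (D c) = g ⟨D c, ⟨c, rfl⟩⟩ := by
    rw [← hG]; rfl
  have h2 := congrArg Subtype.val (LinearMap.congr_fun hg ⟨D c, ⟨c, rfl⟩⟩)
  change D (G (D c)) = D c
  rw [h1]
  exact h2

theorem flatCBracket_congr {E : Type*} [NormedAddCommGroup E] [NormedSpace ℝ E]
    {a a' b b' c c' e e' : E → E} {x : E} (ha : a =ᶠ[𝓝 x] a') (hb : b =ᶠ[𝓝 x] b')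
    (hc : c =ᶠ[𝓝 x] c') (he : e =ᶠ[𝓝 x] e') :
    flatCBracket a b c e x = flatCBracket a' b' c' e' x := by
  rw [flatCBracket, flatCBracket, ha.lieBracket_vectorField_eq hc,
    hb.lieBracket_vectorField_eq he, ha.lieBracket_vectorField_eq he,
    hb.lieBracket_vectorField_eq hc]

/-- Lifting through a fixed linear section of `D` keeps the regularity. The lift differs from an
element of the range of `Q y` by a vector of the kernel, which the range contains, so it is itself
fixed by `Q y`. -/
theorem exists_coeff_of_section (hW : IsOpen W)
    (hQQ : ∀ y ∈ W, ∀ z ∈ W, ∀ v, Q y (Q z v) = Q y v)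
    (hker : ∀ y ∈ W, ∀ c, Q y (toC c) = toC c ↔ D c = 0) {Z : ∀ q : Euc d, CTangent d q}
    (hZ : IsLipSectionOn (projBundle D Q) Z W) :
    ∃ f : Euc d → Fin k → ℂ, (∀ᵐ y, y ∈ W → DifferentiableAt ℝ f y) ∧
      ∀ y ∈ W, Q y (f y) = f y ∧ Z y = cplx (T := Euc d) D.toLinearMap (f y) := by
  obtain ⟨R, hR⟩ := exists_linear_section D
  obtain ⟨⟨hr, hi⟩, hmem⟩ := hZ
  rw [isLipFieldOn_euc] at hr hi
  set zr : Euc d → Euc d := fun y => rePart (Z y) with hzr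
  set zi : Euc d → Euc d := fun y => imPart (Z y) with hzi
  set f : Euc d → Fin k → ℂ := fun y => toC (R (zr y)) + Complex.I • toC (R (zi y)) with hf
  have hfr : ∀ y, reC (f y) = R (zr y) := fun y => by
    simp [hf, reC_smul]
  have hfi : ∀ y, imC (f y) = R (zi y) := fun y => by
    simp [hf, imC_smul]
  refine ⟨f, ?_, fun y hy => ?_⟩
  · filter_upwards [hr.ae_differentiableAt (μ := volume) hW,
      hi.ae_differentiableAt (μ := volume) hW] with y h1 h2 hy
    have h1' := h1 hy
    have h2' := h2 hy
    simp only [hf]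
    fun_prop
  · obtain ⟨v, hv⟩ := mem_projBundle.1 (hmem y hy)
    have hzr' : zr y = D (reC (Q y v)) := by
      simp only [hzr]; rw [← hv]; exact rePart_cplx _ _
    have hzi' : zi y = D (imC (Q y v)) := by
      simp only [hzi]; rw [← hv]; exact imPart_cplx _ _
    have h1 : cplx (T := Euc d) D.toLinearMap (f y) = Z y := by
      rw [← hv, cplx_apply, cplx_apply, hfr, hfi, hzr', hzi']
      exact congrArg₂ cvec (hR _) (hR _)
    have h2 : cplx (T := Euc d) D.toLinearMap (f y - Q y v) = 0 := by
      rw [map_sub, sub_eq_zero]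
      exact h1.trans hv.symm
    have h3 := fixed_of_cplx_eq_zero (Q := Q y) (fun c => (hker y hy c).2) h2
    rw [map_sub, hQQ y hy y hy, sub_left_inj] at h3
    exact ⟨h3, h1.symm⟩

theorem isInvolutiveOn_projBundle (hW : IsOpen W)
    (hQQ : ∀ y ∈ W, ∀ z ∈ W, ∀ v, Q y (Q z v) = Q y v)
    (hker : ∀ y ∈ W, ∀ c, Q y (toC c) = toC c ↔ D c = 0)
    (hre : ∀ y ∈ W, ∀ c, ∃ v, reC (Q y v) = c)
    (hst : ∀ᵐ y, y ∈ W → DifferentiableAt ℝ Q y ∧ StructureEq (fun _ => D) Q y) :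
    IsInvolutiveOn (projBundle D Q) W := by
  intro Z Z' hZ hZ'
  obtain ⟨f, hfd, hf⟩ := exists_coeff_of_section hW hQQ hker hZ
  obtain ⟨g, hgd, hg⟩ := exists_coeff_of_section hW hQQ hker hZ'
  have hreZ : ∀ y ∈ W, (rePart (Z y) : Euc d) = D (reC (f y)) := fun y hy => by
    rw [(hf y hy).2]; exact rePart_cplx _ _
  have himZ : ∀ y ∈ W, (imPart (Z y) : Euc d) = D (imC (f y)) := fun y hy => by
    rw [(hf y hy).2]; exact imPart_cplx _ _
  have hreZ' : ∀ y ∈ W, (rePart (Z' y) : Euc d) = D (reC (g y)) := fun y hy => by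
    rw [(hg y hy).2]; exact rePart_cplx _ _
  have himZ' : ∀ y ∈ W, (imPart (Z' y) : Euc d) = D (imC (g y)) := fun y hy => by
    rw [(hg y hy).2]; exact imPart_cplx _ _
  have hcomm : ∀ y : Euc d, ∀ c c', fderiv ℝ (fun _ : Euc d => D) y (D c) c'
      = fderiv ℝ (fun _ : Euc d => D) y (D c') c := fun y c c' => by simp
  rw [aeOn_euc, aeOn_euc]
  constructor
  · filter_upwards [hfd, hgd, hst] with y h1 h2 h3 hy
    have hWn := hW.mem_nhds hy
    obtain ⟨hQd, hs⟩ := h3 hy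
    have e1 : cBracket Z Z' y = cplx (T := Euc d) D.toLinearMap
        (frameDeriv (fun _ => D) g y (f y) - frameDeriv (fun _ => D) f y (g y)) := by
      rw [cBracket_euc, ← flatCBracket_frame (X := fun _ => D) (differentiableAt_const D) (hcomm y)
        (h1 hy) (h2 hy)]
      exact flatCBracket_congr (Filter.mem_of_superset hWn hreZ)
        (Filter.mem_of_superset hWn himZ) (Filter.mem_of_superset hWn hreZ')
        (Filter.mem_of_superset hWn himZ')
    have hcoef : ∀ h : Euc d → Fin k → ℂ, DifferentiableAt ℝ h y → (∀ y ∈ W, Q y (h y) = h y) →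
        ∀ c, frameDeriv (fun _ => D) h y c = frameDeriv (fun _ => D) Q y c (h y)
          + Q y (frameDeriv (fun _ => D) h y c) := by
      intro h hd hfix c
      rw [← frameDeriv_cclm_apply hQd hd]
      have : (fun y => Q y (h y)) =ᶠ[𝓝 y] h := Filter.mem_of_superset hWn hfix
      rw [frameDeriv_apply, frameDeriv_apply, this.fderiv_eq]
    -- Differentiating `f = Q f` and `g = Q g` leaves, besides terms in the range of `Q y`, the two
    -- derivatives of `Q`. These cancel by the structure equation.
    have e2 : frameDeriv (fun _ => D) g y (f y) - frameDeriv (fun _ => D) f y (g y)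
        = Q y (frameDeriv (fun _ => D) g y (f y) - frameDeriv (fun _ => D) f y (g y)) := by
      have hs' := hs (f y) (g y)
      rw [(hf y hy).1, (hg y hy).1] at hs'
      have a1 := hcoef g (h2 hy) (fun y hy => (hg y hy).1) (f y)
      have a2 := hcoef f (h1 hy) (fun y hy => (hf y hy).1) (g y)
      rw [map_sub]
      conv_lhs => rw [a1, a2, hs']
      abel
    rw [e1, e2]
    exact mem_projBundle.2 ⟨_, rfl⟩
  · filter_upwards [hfd, hgd] with y h1 h2 hy
    have hWn := hW.mem_nhds hy
    have hgs : DifferentiableAt ℝ (fun y => star (g y)) y := (h2 hy).star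
    have e1 : cBracket Z (fun x => conjVec (Z' x)) y = cplx (T := Euc d) D.toLinearMap
        (frameDeriv (fun _ => D) (fun y => star (g y)) y (f y)
          - frameDeriv (fun _ => D) f y (star (g y))) := by
      rw [cBracket_euc, ← flatCBracket_frame (X := fun _ => D) (differentiableAt_const D) (hcomm y)
        (h1 hy) hgs]
      have hconj : ∀ y ∈ W, conjVec (Z' y) = cplx (T := Euc d) D.toLinearMap (star (g y)) :=
        fun y hy => by rw [(hg y hy).2]; exact conjVec_cplx _ _
      refine flatCBracket_congr (Filter.mem_of_superset hWn hreZ)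
        (Filter.mem_of_superset hWn himZ) (Filter.mem_of_superset hWn fun y hy => ?_)
        (Filter.mem_of_superset hWn fun y hy => ?_)
      · exact (congrArg rePart (hconj y hy)).trans (rePart_cplx _ _)
      · exact (congrArg imPart (hconj y hy)).trans (imPart_cplx _ _)
    rw [e1]
    exact cplx_mem_sup_conjSub (T := Euc d) (Q := (Q y).toLinearMap) (hre y hy) _

end ProjBundle

/-! ### Lipschitz calculus, compactly supported extension and linear complements -/

section Tools

theorem LocallyLipschitzOn.prodMk {α β γ : Type*} [PseudoEMetricSpace α]
    [PseudoEMetricSpace β] [PseudoEMetricSpace γ] {f : α → β} {g : α → γ} {s : Set α}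
    (hf : LocallyLipschitzOn s f) (hg : LocallyLipschitzOn s g) :
    LocallyLipschitzOn s fun x => (f x, g x) := fun x hx => by
  obtain ⟨K, t, ht, h⟩ := hf hx
  obtain ⟨K', t', ht', h'⟩ := hg hx
  exact ⟨max K K', t ∩ t', Filter.inter_mem ht ht',
    (h.mono inter_subset_left).prodMk (h'.mono inter_subset_right)⟩

theorem ContDiffAt.comp_locallyLipschitzOn {α E F : Type*} [PseudoEMetricSpace α]
    [NormedAddCommGroup E] [NormedSpace ℝ E] [NormedAddCommGroup F] [NormedSpace ℝ F]
    {g : E → F} {f : α → E} {s : Set α}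
    (hg : ∀ x ∈ s, ContDiffAt ℝ 1 g (f x)) (hf : LocallyLipschitzOn s f) :
    LocallyLipschitzOn s fun x => g (f x) := fun x hx => by
  obtain ⟨K, t, ht, h⟩ := hf hx
  obtain ⟨K', t', ht', h'⟩ := (hg x hx).exists_lipschitzOnWith
  refine ⟨K' * K, t ∩ f ⁻¹' t', Filter.inter_mem ht ((hf.continuousOn x hx) ht'), ?_⟩
  exact h'.comp (h.mono inter_subset_left) (fun y hy => hy.2)

theorem LocallyLipschitzOn.const {α β : Type*} [PseudoEMetricSpace α]
    [PseudoEMetricSpace β] (b : β) (s : Set α) : LocallyLipschitzOn s fun _ => b := fun _ _ =>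
  ⟨0, s, self_mem_nhdsWithin, (LipschitzWith.const b).lipschitzOnWith⟩

theorem LocallyLipschitzOn.clm_comp {α 𝕜 E F G : Type*} [PseudoMetricSpace α]
    [NontriviallyNormedField 𝕜] [SeminormedAddCommGroup E] [NormedSpace 𝕜 E]
    [SeminormedAddCommGroup F] [NormedSpace 𝕜 F] [SeminormedAddCommGroup G] [NormedSpace 𝕜 G]
    {f : α → F →L[𝕜] G} {g : α → E →L[𝕜] F} {s : Set α} (hf : LocallyLipschitzOn s f)
    (hg : LocallyLipschitzOn s g) : LocallyLipschitzOn s fun x => (f x).comp (g x) := by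
  intro x hx
  obtain ⟨K, t, ht, h⟩ := hf hx
  obtain ⟨K', t', ht', h'⟩ := hg hx
  have hfb := ((hf.continuousOn x hx).norm).eventually_lt_const (lt_add_one ‖f x‖)
  have hgb := ((hg.continuousOn x hx).norm).eventually_lt_const (lt_add_one ‖g x‖)
  refine ⟨K * (‖g x‖₊ + 1) + (‖f x‖₊ + 1) * K', _, Filter.inter_mem (Filter.inter_mem ht ht')
    (Filter.inter_mem hfb hgb), LipschitzOnWith.of_dist_le_mul fun y hy z hz => ?_⟩
  have h1 := h.dist_le_mul y hy.1.1 z hz.1.1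
  have h2 := h'.dist_le_mul y hy.1.2 z hz.1.2
  have e : (f y).comp (g y) - (f z).comp (g z)
      = (f y - f z).comp (g y) + (f z).comp (g y - g z) := by
    rw [ContinuousLinearMap.sub_comp, ContinuousLinearMap.comp_sub]
    abel
  rw [dist_eq_norm, e]
  push_cast
  have hgy : ‖g y‖ ≤ ‖g x‖ + 1 := le_of_lt hy.2.2
  have hfz : ‖f z‖ ≤ ‖f x‖ + 1 := le_of_lt hz.2.1
  calc _ ≤ ‖f y - f z‖ * ‖g y‖ + ‖f z‖ * ‖g y - g z‖ :=
        (norm_add_le _ _).trans (add_le_add (ContinuousLinearMap.opNorm_comp_le _ _)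
          (ContinuousLinearMap.opNorm_comp_le _ _))
    _ ≤ (K * dist y z) * (‖g x‖ + 1) + (‖f x‖ + 1) * (K' * dist y z) := by
        rw [← dist_eq_norm, ← dist_eq_norm (g y)]
        gcongr
    _ = _ := by ring

/-- A locally Lipschitz map agrees near each interior point with a compactly supported Lipschitz
map. -/
theorem LocallyLipschitzOn.exists_lipschitzWith_hasCompactSupport {E F : Type*}
    [NormedAddCommGroup E] [NormedSpace ℝ E] [FiniteDimensional ℝ E] [NormedAddCommGroup F]
    [NormedSpace ℝ F] [FiniteDimensional ℝ F] {f : E → F} {s : Set E}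
    (hf : LocallyLipschitzOn s f) {x : E} (hs : s ∈ 𝓝 x) :
    ∃ (g : E → F) (C : NNReal), LipschitzWith C g ∧ HasCompactSupport g ∧ g =ᶠ[𝓝 x] f := by
  obtain ⟨r, hr, hrs⟩ := Metric.nhds_basis_closedBall.mem_iff.1 hs
  obtain ⟨K, hK⟩ := (hf.mono hrs).exists_lipschitzOnWith_of_compact (isCompact_closedBall x r)
  obtain ⟨h, hL, heq⟩ := hK.extend_finite_dimension
  set L := lipschitzExtensionConstant F * K with hLdef
  let χ : ContDiffBump x := ⟨r / 2, r, by positivity, by linarith⟩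
  have hχs : HasCompactSupport χ := χ.hasCompactSupport
  obtain ⟨Lχ, hLχ⟩ : ∃ C, LipschitzWith C χ :=
    ContDiff.lipschitzWith_of_hasCompactSupport (𝕂 := ℝ) (n := 1) hχs χ.contDiff (by simp)
  obtain ⟨B, hB⟩ := (isCompact_closedBall x r).exists_bound_of_continuousOn
    hL.continuous.continuousOn
  have hB0 : 0 ≤ B := (norm_nonneg _).trans (hB x (by simp [hr.le]))
  refine ⟨fun y => χ y • h y, Lχ * B.toNNReal + L, LipschitzWith.of_dist_le_mul ?_,
    hχs.smul_right, ?_⟩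
  -- The splitting multiplies the increment of the cutoff by `h y` alone, so a bound on `h` is
  -- needed at one of the two points only. If both are outside the ball, both values vanish.
  · have key : ∀ y z, y ∈ Metric.closedBall x r →
        dist (χ y • h y) (χ z • h z) ≤ (Lχ * B + L) * dist y z := by
      intro y z hy
      have e : χ y • h y - χ z • h z = (χ y - χ z) • h y + χ z • (h y - h z) := by module
      rw [dist_eq_norm, e]
      refine (norm_add_le _ _).trans ?_
      rw [norm_smul, norm_smul, Real.norm_of_nonneg χ.nonneg, add_mul]
      have h1 : ‖χ y - χ z‖ ≤ Lχ * dist y z := hLχ.norm_sub_le y z |>.trans_eq (by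
        rw [dist_eq_norm])
      have h2 : ‖h y - h z‖ ≤ L * dist y z := hL.norm_sub_le y z |>.trans_eq (by
        rw [dist_eq_norm])
      calc _ ≤ (Lχ * dist y z) * B + 1 * (L * dist y z) := by
            gcongr
            · exact hB y hy
            · exact χ.le_one
        _ = _ := by ring
    intro y z
    simp only [NNReal.coe_add, NNReal.coe_mul, Real.coe_toNNReal _ hB0]
    by_cases hy : y ∈ Metric.closedBall x r
    · exact key y z hy
    by_cases hz : z ∈ Metric.closedBall x r
    · rw [dist_comm, dist_comm y]
      exact key z y hz
    have hz0 : ∀ y, y ∉ Metric.closedBall x r → χ y = 0 := fun y hy =>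
      χ.zero_of_le_dist (le_of_lt (not_le.1 hy))
    rw [hz0 y hy, hz0 z hz, zero_smul, zero_smul, dist_self]
    positivity
  · filter_upwards [χ.eventuallyEq_one, Metric.closedBall_mem_nhds x hr] with y h1 h2
    rw [h1, Pi.one_apply, one_smul, heq h2]

theorem exists_continuousLinearEquiv_extend {K V E : Type*} [NormedAddCommGroup K]
    [NormedSpace ℝ K] [FiniteDimensional ℝ K] [NormedAddCommGroup V] [NormedSpace ℝ V]
    [FiniteDimensional ℝ V] [NormedAddCommGroup E] [NormedSpace ℝ E] [FiniteDimensional ℝ E]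
    (hd : Module.finrank ℝ V = Module.finrank ℝ E) {f : K →L[ℝ] V} {g : K →L[ℝ] E}
    (hf : Function.Injective f) (hg : Function.Injective g) :
    ∃ L : V ≃L[ℝ] E, ∀ c, L (f c) = g c := by
  obtain ⟨P, hP⟩ := f.toLinearMap.range.exists_isCompl
  obtain ⟨P', hP'⟩ := g.toLinearMap.range.exists_isCompl
  let e₁ := LinearEquiv.ofInjective f.toLinearMap hf
  let e₂ := LinearEquiv.ofInjective g.toLinearMap hg
  have h1 := Submodule.finrank_add_eq_of_isCompl hP
  have h2 := Submodule.finrank_add_eq_of_isCompl hP'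
  rw [← e₁.finrank_eq] at h1
  rw [← e₂.finrank_eq] at h2
  have e₃ : P ≃ₗ[ℝ] P' := LinearEquiv.ofFinrankEq _ _ (by omega)
  let L := (Submodule.prodEquivOfIsCompl _ _ hP).symm ≪≫ₗ
    ((e₁.symm ≪≫ₗ e₂).prodCongr e₃) ≪≫ₗ Submodule.prodEquivOfIsCompl _ _ hP'
  refine ⟨L.toContinuousLinearEquiv, fun c => ?_⟩
  have h3 : (Submodule.prodEquivOfIsCompl _ _ hP).symm (f c) = (e₁ c, 0) :=
    Submodule.prodEquivOfIsCompl_symm_apply_left _ _ hP (e₁ c)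
  change Submodule.prodEquivOfIsCompl _ _ hP' (((e₁.symm ≪≫ₗ e₂).prodCongr e₃)
    ((Submodule.prodEquivOfIsCompl _ _ hP).symm (f c))) = g c
  rw [h3]
  simp [e₂]

end Tools

/-! ### Projections with fixed kernel and the structure equation from involutivity -/

section Projections

variable {k r : ℕ} {E : Type*} [NormedAddCommGroup E] [NormedSpace ℝ E]

/-- Modulo the range of `A x`, the antisymmetrized derivative of `Q = A G Θ` is that of `A`, which
lies in this range by involutivity. As `Θ Q = Θ` is constant, `Θ` kills it as well, and `Θ` is
injective on the range of `A x`. -/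
theorem structureEq_of_involutive {X : E → (Fin k → ℝ) →L[ℝ] E}
    {A : E → (Fin r → ℂ) →L[ℂ] (Fin k → ℂ)} {G : E → (Fin r → ℂ) →L[ℂ] (Fin r → ℂ)}
    {Θ : (Fin k → ℂ) →L[ℂ] (Fin r → ℂ)} {Q : E → (Fin k → ℂ) →L[ℂ] (Fin k → ℂ)} {x : E}
    (hA : DifferentiableAt ℝ A x) (hG : DifferentiableAt ℝ G x) (hQ : DifferentiableAt ℝ Q x)
    (hQe : ∀ᶠ y in 𝓝 x, ∀ v, Q y v = A y (G y (Θ v))) (hΘ : ∀ᶠ y in 𝓝 x, ∀ v, Θ (Q y v) = Θ v)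
    (hGA : ∀ m, Θ (A x m) = 0 → m = 0)
    (hinv : ∀ v w, frameDeriv X A x (A x v) w - frameDeriv X A x (A x w) v
      ∈ LinearMap.range (A x).toLinearMap) : StructureEq X Q x := by
  intro v w
  have hQv : ∀ v c, frameDeriv X (fun y => Q y v) x c = frameDeriv X Q x c v := fun v c => by
    rw [frameDeriv_cclm_apply hQ (differentiableAt_const v)]
    simp [frameDeriv_apply X (fun _ => v)]
  have hdiff : ∀ v, DifferentiableAt ℝ (fun y => Q y v) x := fun v =>
    (hasFDerivAt_cclm_apply hQ (differentiableAt_const v)).differentiableAt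
  have h1 : ∀ v c, frameDeriv X Q x c v = frameDeriv X A x c (G x (Θ v))
      + A x (frameDeriv X (fun y => G y (Θ v)) x c) := fun v c => by
    have hm : DifferentiableAt ℝ (fun y => G y (Θ v)) x :=
      (hasFDerivAt_cclm_apply hG (differentiableAt_const (Θ v))).differentiableAt
    rw [← hQv, ← frameDeriv_cclm_apply hA hm]
    have : (fun y => Q y v) =ᶠ[𝓝 x] fun y => A y (G y (Θ v)) := hQe.mono fun y h => h v
    rw [frameDeriv_apply, frameDeriv_apply, this.fderiv_eq]
  have h2 : ∀ v c, Θ (frameDeriv X Q x c v) = 0 := fun v c => by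
    have h := frameDeriv_cclm_apply (X := X) (differentiableAt_const Θ) (hdiff v) c
    simp only [frameDeriv_apply X (fun _ => Θ), fderiv_fun_const, Pi.zero_apply, zero_apply,
      smul_zero, add_zero, zero_add, hQv] at h
    rw [← h]
    have : (fun y => Θ (Q y v)) =ᶠ[𝓝 x] fun _ => Θ v := hΘ.mono fun y h => h v
    rw [frameDeriv_apply, this.fderiv_eq]
    simp
  have hx : ∀ v, Q x v = A x (G x (Θ v)) := hQe.self_of_nhds
  obtain ⟨m, hm⟩ := hinv (G x (Θ v)) (G x (Θ w))
  rw [← hx, ← hx] at hm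
  have h3 : A x (m + frameDeriv X (fun y => G y (Θ w)) x (Q x v)
      - frameDeriv X (fun y => G y (Θ v)) x (Q x w))
      = frameDeriv X Q x (Q x v) w - frameDeriv X Q x (Q x w) v := by
    have hm' : A x m = _ := hm
    rw [map_sub, map_add, hm', h1 w, h1 v]
    abel
  have h4 := hGA _ (by rw [h3, map_sub, h2, h2, sub_zero])
  rw [h4, map_zero] at h3
  exact (sub_eq_zero.1 h3.symm)

/-- Lipschitz projections with a fixed kernel onto the ranges of a Lipschitz family of injective
maps. -/
theorem exists_projections {A : E → (Fin r → ℂ) →L[ℂ] (Fin k → ℂ)} {O : Set E} (hO : IsOpen O)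
    {x₀ : E} (hx₀ : x₀ ∈ O) (hA : LocallyLipschitzOn O A) (hinj : Function.Injective (A x₀)) :
    ∃ (Θ : (Fin k → ℂ) →L[ℂ] (Fin r → ℂ)) (G : E → (Fin r → ℂ) →L[ℂ] (Fin r → ℂ)) (O' : Set E),
      IsOpen O' ∧ x₀ ∈ O' ∧ O' ⊆ O ∧ LocallyLipschitzOn O' G ∧
      LocallyLipschitzOn O' (fun y => (A y).comp ((G y).comp Θ)) ∧
      ∀ y ∈ O', ∀ v, Θ (A y (G y v)) = v ∧ G y (Θ (A y v)) = v := by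
  -- With `Θ` a left inverse of `A x₀`, the map `Θ (A y)` is invertible near `x₀`. Taking `G y` to
  -- be its inverse, `A y ∘ G y ∘ Θ` projects onto the range of `A y` along the kernel of `Θ`.
  obtain ⟨θ, hθ⟩ := (A x₀).toLinearMap.exists_leftInverse_of_injective (LinearMap.ker_eq_bot.2 hinj)
  set Θ := LinearMap.toContinuousLinearMap θ with hΘ
  let B : E → (Fin r → ℂ) →L[ℂ] (Fin r → ℂ) := fun y => Θ.comp (A y)
  have hB : LocallyLipschitzOn O B := (LocallyLipschitzOn.const Θ O).clm_comp hA
  have hB0 : B x₀ = 1 := by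
    ext1 v
    exact LinearMap.congr_fun hθ v
  set O' := O ∩ B ⁻¹' {b | IsUnit b} with hO'
  have hO'o : IsOpen O' := hB.continuousOn.isOpen_inter_preimage hO Units.isOpen
  have hG : LocallyLipschitzOn O' fun y => Ring.inverse (B y) :=
    ContDiffAt.comp_locallyLipschitzOn (fun y hy => by
      obtain ⟨u, hu⟩ := hy.2
      rw [← hu]
      exact (contDiffAt_ringInverse ℂ u).restrict_scalars ℝ) (hB.mono inter_subset_left)
  refine ⟨Θ, fun y => Ring.inverse (B y), O', hO'o, ⟨hx₀, by simp [hB0]⟩, inter_subset_left,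
    hG, ?_, fun y hy v => ⟨?_, ?_⟩⟩
  · exact (hA.mono inter_subset_left).clm_comp
      (hG.clm_comp (LocallyLipschitzOn.const Θ O'))
  · have := Ring.mul_inverse_cancel _ hy.2
    exact congrArg (fun b : (Fin r → ℂ) →L[ℂ] (Fin r → ℂ) => b v) this
  · have := Ring.inverse_mul_cancel _ hy.2
    exact congrArg (fun b : (Fin r → ℂ) →L[ℂ] (Fin r → ℂ) => b v) this

end Projections

/-! ### The local fibration in Euclidean space -/

section FlatFibration

/-- The first `l` frame coordinates become the fibre `Euc l`; the others fill the first `k - l`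
coordinates of the base `Euc d`, and zeros fill the rest. The inclusion `j` lists the leaf
directions, and the second component of `ι` is the later `D`. -/
theorem exists_coordinate_split {l k d : ℕ} (hlk : l ≤ k) (hkd : k ≤ l + d) :
    ∃ (ι : (Fin k → ℝ) →L[ℝ] Euc l × Euc d) (T : Euc l × Euc d →L[ℝ] (Fin k → ℝ))
      (j : Euc l →L[ℝ] (Fin k → ℝ)), (∀ c, T (ι c) = c) ∧ (∀ a, ι (j a) = (a, 0)) ∧
      ∀ c, (ι c).2 = 0 ↔ ∀ i : Fin k, l ≤ (i : ℕ) → c i = 0 := by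
  let ι : (Fin k → ℝ) →ₗ[ℝ] Euc l × Euc d :=
    { toFun := fun c => (WithLp.toLp 2 fun i => c (Fin.castLE hlk i),
        WithLp.toLp 2 fun i : Fin d => if h : l + i < k then c ⟨l + i, h⟩ else 0)
      map_add' := fun c c' => by
        ext i
        · rfl
        · simp only [Prod.snd_add, PiLp.add_apply, Pi.add_apply]
          split_ifs <;> simp
      map_smul' := fun a c => by
        ext i
        · rfl
        · simp only [Prod.smul_snd, PiLp.smul_apply, Pi.smul_apply, RingHom.id_apply]
          split_ifs <;> simp }
  let T : Euc l × Euc d →ₗ[ℝ] (Fin k → ℝ) :=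
    { toFun := fun v i => if h : (i : ℕ) < l then v.1 ⟨i, h⟩ else v.2 ⟨i - l, by omega⟩
      map_add' := fun v v' => by
        ext i
        simp only [Pi.add_apply]
        split_ifs <;> rfl
      map_smul' := fun a v => by
        ext i
        simp only [Pi.smul_apply]
        split_ifs <;> rfl }
  let j : Euc l →ₗ[ℝ] (Fin k → ℝ) :=
    { toFun := fun a i => if h : (i : ℕ) < l then a ⟨i, h⟩ else 0
      map_add' := fun v v' => by
        ext i
        simp only [Pi.add_apply]
        split_ifs <;> simp
      map_smul' := fun a v => by
        ext i
        simp only [Pi.smul_apply]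
        split_ifs <;> simp }
  refine ⟨LinearMap.toContinuousLinearMap ι, LinearMap.toContinuousLinearMap T,
    LinearMap.toContinuousLinearMap j, fun c => ?_, fun a => ?_, fun c => ⟨fun h i hi => ?_,
      fun h => ?_⟩⟩
  · ext i
    by_cases h : (i : ℕ) < l
    · simp [ι, T, h]
    · have h1 : l + (i - l) = (i : ℕ) := by omega
      simp [ι, T, h, h1]
  · refine Prod.ext ?_ ?_
    · ext i
      simp [ι, j]
    · ext i
      simp [ι, j]
  · have := congrArg (fun b : Euc d => b ⟨i - l, by omega⟩) h
    have h1 : l + (i - l) = (i : ℕ) := by omega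
    simpa [ι, h1] using this
  · ext i
    by_cases hi : l + i < k
    · simp [ι, hi, h ⟨l + i, hi⟩ (by simp)]
    · simp [ι, hi]

variable {n l k d r : ℕ}

/-- A Levi-flat structure in Euclidean space whose real parts are framed by commuting Lipschitz
fields is locally pulled back from a Levi-flat CR structure along a Lipschitz submersion. -/
theorem exists_flat_fibration (hlk : l ≤ k) (hkd : k ≤ l + d) (hn : l + d = n)
    {O : Set (Euc n)} (hO : IsOpen O) {x₀ : Euc n} (hx₀ : x₀ ∈ O)
    {X : Euc n → (Fin k → ℝ) →L[ℝ] Euc n} {A : Euc n → (Fin r → ℂ) →L[ℂ] (Fin k → ℂ)}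
    (hX : LocallyLipschitzOn O X) (hA : LocallyLipschitzOn O A)
    (hXi : Function.Injective (X x₀)) (hAi : Function.Injective (A x₀))
    (hcomm : ∀ᵐ y : Euc n, y ∈ O → ∀ c c', fderiv ℝ X y (X y c) c' = fderiv ℝ X y (X y c') c)
    (hinv : ∀ᵐ y : Euc n, y ∈ O → ∀ v w, frameDeriv X A y (A y v) w - frameDeriv X A y (A y w) v
      ∈ LinearMap.range (A y).toLinearMap)
    (hker : ∀ y ∈ O, ∀ c, toC c ∈ LinearMap.range (A y).toLinearMap ↔
      ∀ i : Fin k, l ≤ (i : ℕ) → c i = 0)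
    (hre : ∀ y ∈ O, ∀ c, ∃ v, reC (A y v) = c) :
    ∃ (ρ : ℝ) (Φ : OpenPartialHomeomorph (Euc l × Euc d) (Euc n)) (C : NNReal)
      (D : (Fin k → ℝ) →L[ℝ] Euc d) (Q : Euc d → (Fin k → ℂ) →L[ℂ] (Fin k → ℂ)),
      0 < ρ ∧ Φ.source = Metric.ball 0 ρ ∧ x₀ ∈ Φ.target ∧ Φ.target ⊆ O ∧
      LipschitzOnWith C Φ Φ.source ∧ LipschitzOnWith C Φ.symm Φ.target ∧
      IsLeviFlatCROn (projBundle D Q) (Metric.ball 0 ρ) ∧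
      ∀ x ∈ Φ.target, (∀ c, HasLineDerivAt ℝ (fun y => (Φ.symm y).2) (D c) x (X x c)) ∧
        (∀ c u, HasLineDerivAt ℝ (fun y => (Φ.symm y).2) (D c) x u →
          ∃ c', D c' = D c ∧ X x c' = u) ∧
        LinearMap.range (Q (Φ.symm x).2).toLinearMap = LinearMap.range (A x).toLinearMap ∧
        ∀ c, D c = 0 → toC c ∈ LinearMap.range (A x).toLinearMap := by
  obtain ⟨Θ, G, O', hO', hx₀', hO'O, hG, hQL, hid⟩ := exists_projections hO hx₀ hA hAi
  -- The flow and mollification estimates need global Lipschitz constants, so `X` and the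
  -- projections are replaced by global maps equal to them near `x₀`.
  obtain ⟨X₁, C₁, hX₁, hX₁s, hX₁e⟩ :=
    hX.exists_lipschitzWith_hasCompactSupport (hO.mem_nhds hx₀)
  obtain ⟨Q₁, C₂, hQ₁, -, hQ₁e⟩ :=
    hQL.exists_lipschitzWith_hasCompactSupport (hO'.mem_nhds hx₀')
  obtain ⟨ι, T, j, hT, hj, hι⟩ := exists_coordinate_split hlk hkd
  have hX₁0 : X₁ x₀ = X x₀ := hX₁e.self_of_nhds
  have hdim : Module.finrank ℝ (Euc l × Euc d) = Module.finrank ℝ (Euc n) := by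
    simp [hn]
  obtain ⟨L, hL⟩ := exists_continuousLinearEquiv_extend hdim (f := ι) (g := X x₀)
    (fun a b h => by rw [← hT a, h, hT]) hXi
  obtain ⟨R, hR, hRs⟩ := Metric.mem_nhds_iff.1
    (Filter.inter_mem (Filter.inter_mem hX₁e hQ₁e) (hO'.mem_nhds hx₀'))
  have hXe : ∀ y ∈ Metric.ball x₀ R, X₁ =ᶠ[𝓝 y] X := fun y hy =>
    Filter.mem_of_superset (Metric.isOpen_ball.mem_nhds hy) fun z hz => (hRs hz).1.1
  have hQe : ∀ y ∈ Metric.ball x₀ R, Q₁ =ᶠ[𝓝 y] fun y => (A y).comp ((G y).comp Θ) := fun y hy =>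
    Filter.mem_of_superset (Metric.isOpen_ball.mem_nhds hy) fun z hz => (hRs hz).1.2
  have hRO' : Metric.ball x₀ R ⊆ O' := fun z hz => (hRs hz).2
  have hQv : ∀ y ∈ Metric.ball x₀ R, ∀ v, Q₁ y v = A y (G y (Θ v)) := fun y hy v => by
    rw [(hQe y hy).self_of_nhds]; rfl
  have hΘQ : ∀ y ∈ Metric.ball x₀ R, ∀ v, Θ (Q₁ y v) = Θ v := fun y hy v => by
    rw [hQv y hy, (hid y (hRO' hy) _).1]
  have hrange : ∀ y ∈ Metric.ball x₀ R, LinearMap.range (Q₁ y).toLinearMap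
      = LinearMap.range (A y).toLinearMap := fun y hy => by
    ext w
    constructor
    · rintro ⟨v, rfl⟩
      exact ⟨G y (Θ v), (hQv y hy v).symm⟩
    · rintro ⟨v, rfl⟩
      refine ⟨A y v, (hQv y hy _).trans ?_⟩
      rw [(hid y (hRO' hy) v).2]
      rfl
  have hQQ : ∀ y ∈ Metric.ball x₀ R, ∀ z ∈ Metric.ball x₀ R, ∀ v, Q₁ y (Q₁ z v) = Q₁ y v :=
    fun y hy z hz v => by rw [hQv y hy, hΘQ z hz, hQv y hy]
  have hQfix : ∀ y ∈ Metric.ball x₀ R, ∀ w, Q₁ y w = w ↔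
      w ∈ LinearMap.range (A y).toLinearMap := fun y hy w => by
    rw [← hrange y hy]
    refine ⟨fun h => ⟨w, h⟩, ?_⟩
    rintro ⟨v, rfl⟩
    exact hQQ y hy y hy v
  have hQker : ∀ y ∈ Metric.ball x₀ R, ∀ c, Q₁ y (toC c) = toC c ↔ (ι c).2 = 0 := fun y hy c => by
    rw [hQfix y hy, hker y (hO'O (hRO' hy)), hι]
  have hst : ∀ᵐ y : Euc n, y ∈ Metric.ball x₀ R → StructureEq X₁ Q₁ y := by
    filter_upwards [hinv, hA.ae_differentiableAt (μ := volume) hO,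
      hG.ae_differentiableAt (μ := volume) hO', hQ₁.ae_differentiableAt] with y h1 h2 h3 h4 hy
    have hyO := hO'O (hRO' hy)
    refine structureEq_of_involutive (Θ := Θ) (h2 hyO) (h3 (hRO' hy)) h4 ?_ ?_ ?_ fun v w => ?_
    · exact (Metric.isOpen_ball.eventually_mem hy).mono fun z hz => hQv z hz
    · exact (Metric.isOpen_ball.eventually_mem hy).mono fun z hz => hΘQ z hz
    · intro m hm
      rw [← (hid y (hRO' hy) m).2, hm, map_zero]
    · have := h1 hyO v w
      rw [frameDeriv_apply, frameDeriv_apply] at this ⊢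
      rwa [(hXe y hy).self_of_nhds]
  -- The box is built in the half ball so that its curves keep the distance from the boundary
  -- required by `box_eq_of_fderiv_eq_zero`.
  have hcomm₁ : ∀ᵐ y : Euc n, y ∈ Metric.ball x₀ (R / 2) →
      ∀ c c', fderiv ℝ X₁ y (X₁ y c) c' = fderiv ℝ X₁ y (X₁ y c') c := by
    filter_upwards [hcomm] with y h hy
    have hy' : y ∈ Metric.ball x₀ R := Metric.ball_subset_ball (by linarith) hy
    rw [(hXe y hy').fderiv_eq, (hXe y hy').self_of_nhds]
    exact h (hO'O (hRO' hy'))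
  obtain ⟨ρ, Φ, C, B, hρ, hsrc, hΦ0, htgt, hΦ, hΦs, hinc⟩ :=
    exists_flowBox (μ := volume) hX₁ hX₁s (half_pos hR) hcomm₁ ι T hT L
      (fun c => by rw [hL, hX₁0])
  have htR : Φ.target ⊆ Metric.ball x₀ R :=
    htgt.trans (Metric.ball_subset_ball (by linarith))
  have hmem : ∀ y ∈ Metric.ball (0 : Euc d) ρ, ((0 : Euc l), y) ∈ Φ.source := fun y hy => by
    rw [hsrc, ← Prod.mk_zero_zero, ← ball_prod_same]
    exact ⟨Metric.mem_ball_self hρ, hy⟩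
  have hsnd : ∀ v ∈ Φ.source, v.2 ∈ Metric.ball (0 : Euc d) ρ := fun v hv => by
    rw [hsrc, ← Prod.mk_zero_zero, ← ball_prod_same] at hv
    exact hv.2
  -- The projections are read on the transversal through `x₀`; constancy on leaves makes the choice
  -- of transversal immaterial.
  let Q : Euc d → (Fin k → ℂ) →L[ℂ] (Fin k → ℂ) := fun y => Q₁ (Φ (0, y))
  have hbox : ∀ y ∈ Metric.ball (0 : Euc d) ρ, Φ (0, y) ∈ Metric.ball x₀ R := fun y hy =>
    htR (Φ.map_source (hmem y hy))
  have hzero : ∀ᵐ y : Euc n, y ∈ Metric.ball x₀ R → ∀ a, fderiv ℝ Q₁ y (X₁ y (j a)) = 0 := by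
    filter_upwards [hst, hQ₁.ae_differentiableAt] with y h1 h2 hy a
    refine fderiv_eq_zero_of_structureEq h2 (h1 hy)
      ((Metric.isOpen_ball.eventually_mem hy).mono fun z hz => ?_)
    rw [hQker z hz, hj]
  have hQdesc : ∀ v ∈ Φ.source, Q v.2 = Q₁ (Φ v) := fun v hv =>
    box_eq_of_fderiv_eq_zero (μ := volume) hinc hX₁ hR (by rw [hsrc]; exact convex_ball _ _)
      htgt hQ₁ j hj hzero (hmem _ (hsnd v hv)) hv rfl
  have hQ'L : LipschitzOnWith (C₂ * C) Q (Metric.ball 0 ρ) := by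
    refine hQ₁.comp_lipschitzOnWith (LipschitzOnWith.of_dist_le_mul fun y hy z hz => ?_)
    refine (hΦ.dist_le_mul _ (hmem y hy) _ (hmem z hz)).trans_eq ?_
    simp [Prod.dist_eq]
  let D : (Fin k → ℝ) →L[ℝ] Euc d := (ContinuousLinearMap.snd ℝ (Euc l) (Euc d)).comp ι
  have hstD := ae_structureEq_descend (μ := volume) (ν₂ := volume) volume hdim.symm hinc hρ hsrc
    hΦs hQ₁ (hst.mono fun y h hy => h (htR hy)) hQdesc hQ'L
  have hQQ' : ∀ y ∈ Metric.ball (0 : Euc d) ρ, ∀ z ∈ Metric.ball (0 : Euc d) ρ, ∀ v,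
      Q y (Q z v) = Q y v := fun y hy z hz v => hQQ _ (hbox y hy) _ (hbox z hz) v
  have hker' : ∀ y ∈ Metric.ball (0 : Euc d) ρ, ∀ c, Q y (toC c) = toC c ↔ D c = 0 :=
    fun y hy c => hQker _ (hbox y hy) c
  have hre' : ∀ y ∈ Metric.ball (0 : Euc d) ρ, ∀ c, ∃ v, reC (Q y v) = c := fun y hy c => by
    obtain ⟨v, hv⟩ := hre _ (hO'O (hRO' (hbox y hy))) c
    refine ⟨A (Φ (0, y)) v, ?_⟩
    rw [← hv]
    exact congrArg reC ((hQfix _ (hbox y hy) _).2 ⟨v, rfl⟩)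
  have hx₀s : (0 : Euc l × Euc d) ∈ Φ.source := by
    rw [hsrc]
    exact Metric.mem_ball_self hρ
  refine ⟨ρ, Φ, C, D, Q, hρ, hsrc, hΦ0 ▸ Φ.map_source hx₀s, htR.trans (hRO'.trans hO'O), hΦ, hΦs,
    ⟨isLipSubbundleOn_projBundle Metric.isOpen_ball hQ'L hQQ' hker',
      fun y hy => projBundle_inf_conjSub (hQQ' y hy y hy) (hker' y hy),
      isInvolutiveOn_projBundle Metric.isOpen_ball hQQ' hker' hre' hstD⟩, fun x hx => ?_⟩
  have hXx : X₁ x = X x := (hXe x (htR hx)).self_of_nhds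
  refine ⟨fun c => ?_, fun c u h => ?_, ?_, fun c hc => ?_⟩
  · rw [← hXx]
    exact hasLineDerivAt_box_snd hinc hΦs hx c
  · rw [← hXx]
    exact exists_eq_of_hasLineDerivAt_box_snd hinc hΦ hΦs j hj hx h
  · rw [hQdesc _ (Φ.map_target hx), Φ.right_inv hx, hrange x (htR hx)]
  · exact (hker x (hO'O (hRO' (htR hx))) c).2 ((hι c).1 hc)

end FlatFibration

/-! ### Vector fields and their brackets read in a chart -/

section Charts

variable {n : ℕ} {M : Type*} [TopologicalSpace M] [ChartedSpace (Euc n) M]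
  [IsManifold (𝓡 n) ∞ M]

theorem isInvertible_mfderiv_chartAt (c : M) {q : M} (hq : q ∈ (chartAt (Euc n) c).source) :
    (mfderiv (𝓡 n) (𝓡 n) (chartAt (Euc n) c) q).IsInvertible := by
  have : IsManifold (𝓡 n) 1 M := IsManifold.of_le (n := ∞) (by simp)
  exact ⟨(mdifferentiable_chart c).mfderiv hq, rfl⟩

theorem mfderiv_chartAt_injective (c : M) {q : M} (hq : q ∈ (chartAt (Euc n) c).source) :
    Function.Injective (mfderiv (𝓡 n) (𝓡 n) (chartAt (Euc n) c) q) :=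
  (isInvertible_mfderiv_chartAt c hq).injective

/-- The components of a vector field in a chart, as a vector field on Euclidean space. -/
noncomputable def chartField (c : M) (V : ∀ q : M, TangentSpace (𝓡 n) q) :
    ∀ z : Euc n, TangentSpace (𝓡 n) z := fun z => chartRep c V z

theorem mpullback_chartField {c : M} (V : ∀ q : M, TangentSpace (𝓡 n) q) {q : M}
    (hq : q ∈ (chartAt (Euc n) c).source) :
    VectorField.mpullback (𝓡 n) (𝓡 n) (chartAt (Euc n) c) (chartField c V) q = V q := by
  rw [VectorField.mpullback_apply, (isInvertible_mfderiv_chartAt c hq).inverse_apply_eq]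
  change chartRep c V _ = _
  rw [chartRep, (chartAt (Euc n) c).left_inv hq]

theorem mdifferentiableAt_chartField {c : M} {V : ∀ q : M, TangentSpace (𝓡 n) q} {y : Euc n}
    (h : DifferentiableAt ℝ (chartRep c V) y) :
    MDifferentiableAt (𝓡 n) (𝓡 n).tangent
      (fun z => (⟨z, chartField c V z⟩ : TangentBundle (𝓡 n) (Euc n))) y := by
  rw [mdifferentiableAt_section]
  refine h.mdifferentiableAt.congr_of_eventuallyEq (Filter.Eventually.of_forall fun z => ?_)
  simp
  rfl

/-- Naturality of the bracket under the chart: `V` and `W` are locally pullbacks of their chart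
representatives. Differentiability of these representatives at the single point `y` is enough. -/
theorem lieBracket_chartRep {V W : ∀ q : M, TangentSpace (𝓡 n) q} {c : M} {y : Euc n}
    (hy : y ∈ (chartAt (Euc n) c).target) (hV : DifferentiableAt ℝ (chartRep c V) y)
    (hW : DifferentiableAt ℝ (chartRep c W) y) :
    VectorField.lieBracket ℝ (chartRep c V) (chartRep c W) y =
      mfderiv (𝓡 n) (𝓡 n) (chartAt (Euc n) c) ((chartAt (Euc n) c).symm y)
        (VectorField.mlieBracket (𝓡 n) V W ((chartAt (Euc n) c).symm y)) := by
  have h2 : minSmoothness ℝ 2 ≤ ∞ := by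
    rw [minSmoothness_of_isRCLikeNormedField]
    exact WithTop.coe_le_coe.2 le_top
  have : IsManifold (𝓡 n) (minSmoothness ℝ 2) M := IsManifold.of_le (n := ∞) h2
  have hq := (chartAt (Euc n) c).map_target hy
  have key : ∀ V : ∀ q : M, TangentSpace (𝓡 n) q,
      VectorField.mpullback (𝓡 n) (𝓡 n) (chartAt (Euc n) c) (chartField c V)
        =ᶠ[𝓝 ((chartAt (Euc n) c).symm y)] V := fun V => by
    filter_upwards [(chartAt (Euc n) c).open_source.mem_nhds hq] with q hq
    exact mpullback_chartField V hq
  have h := VectorField.mpullback_mlieBracket (I := 𝓡 n) (I' := 𝓡 n) (f := chartAt (Euc n) c)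
    (n := ∞) (V := chartField c V) (W := chartField c W) (x₀ := (chartAt (Euc n) c).symm y)
    (by rw [(chartAt (Euc n) c).right_inv hy]; exact mdifferentiableAt_chartField hV)
    (by rw [(chartAt (Euc n) c).right_inv hy]; exact mdifferentiableAt_chartField hW)
    ((contMDiffOn_chart (I := 𝓡 n) (x := c)).contMDiffAt
      ((chartAt (Euc n) c).open_source.mem_nhds hq)) h2
  rw [(key V).mlieBracket_vectorField_eq (key W), VectorField.mpullback_apply,
    (isInvertible_mfderiv_chartAt c hq).inverse_apply_eq] at h
  refine Eq.trans ?_ h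
  have h3 : VectorField.mlieBracket (𝓡 n) (chartField c V) (chartField c W)
      = VectorField.lieBracket ℝ (chartRep c V) (chartRep c W) := by
    rw [← VectorField.mlieBracketWithin_univ, VectorField.mlieBracketWithin_eq_lieBracketWithin]
    exact (VectorField.lieBracketWithin_univ (𝕜 := ℝ) (V := chartRep c V) (W := chartRep c W))
  rw [h3, (chartAt (Euc n) c).right_inv hy]

end Charts

/-! ### Real and imaginary parts under complexified linear maps -/

section BaseChange

variable {T T' : Type*} [AddCommGroup T] [Module ℝ T] [AddCommGroup T'] [Module ℝ T']

theorem baseChange_eq_cvec (f : T →ₗ[ℝ] T') (w : ℂ ⊗[ℝ] T) :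
    f.baseChange ℂ w = cvec (f (rePart w)) (f (imPart w)) := by
  conv_lhs => rw [← cvec_rePart_imPart w]
  simp [cvec]

theorem rePart_baseChange (f : T →ₗ[ℝ] T') (w : ℂ ⊗[ℝ] T) :
    rePart (f.baseChange ℂ w) = f (rePart w) := by
  rw [baseChange_eq_cvec, rePart_cvec]

theorem imPart_baseChange (f : T →ₗ[ℝ] T') (w : ℂ ⊗[ℝ] T) :
    imPart (f.baseChange ℂ w) = f (imPart w) := by
  rw [baseChange_eq_cvec, imPart_cvec]

theorem baseChange_complex_injective {f : T →ₗ[ℝ] T'} (hf : Function.Injective f) :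
    Function.Injective (f.baseChange ℂ) := fun w w' h => by
  refine cvec_ext (hf ?_) (hf ?_)
  · rw [← rePart_baseChange, h, rePart_baseChange]
  · rw [← imPart_baseChange, h, imPart_baseChange]

/-- The imaginary part of `w` is the real part of `-i w`, and `S` is a complex subspace. -/
theorem imPart_mem_realParts {S : Submodule ℂ (ℂ ⊗[ℝ] T)} {w : ℂ ⊗[ℝ] T} (hw : w ∈ S) :
    imPart w ∈ realParts S := by
  refine ⟨(-Complex.I) • w, S.smul_mem _ hw, ?_⟩
  conv_lhs => rw [← cvec_rePart_imPart w]
  simp [cvec, rePart, TensorProduct.smul_tmul']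

end BaseChange

/-! ### Cutting off local Lipschitz sections -/

section Cutoff

theorem LocallyLipschitzOn.smul {α F : Type*} [PseudoEMetricSpace α] [NormedAddCommGroup F]
    [NormedSpace ℝ F] {f : α → ℝ} {g : α → F} {s : Set α} (hf : LocallyLipschitzOn s f)
    (hg : LocallyLipschitzOn s g) : LocallyLipschitzOn s fun x => f x • g x :=
  ContDiffAt.comp_locallyLipschitzOn (g := fun p : ℝ × F => p.1 • p.2)
    (fun _ _ => contDiff_smul.contDiffAt) (hf.prodMk hg)

theorem LocallyLipschitzOn.clm_apply {α E F : Type*} [PseudoEMetricSpace α]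
    [NormedAddCommGroup E] [NormedSpace ℝ E] [NormedAddCommGroup F] [NormedSpace ℝ F]
    {f : α → E →L[ℝ] F} {g : α → E} {s : Set α} (hf : LocallyLipschitzOn s f)
    (hg : LocallyLipschitzOn s g) : LocallyLipschitzOn s fun x => f x (g x) :=
  ContDiffAt.comp_locallyLipschitzOn (g := fun p : (E →L[ℝ] F) × E => p.1 p.2)
    (fun _ _ => isBoundedBilinearMap_apply.contDiff.contDiffAt) (hf.prodMk hg)

variable {n : ℕ} {M : Type*} [TopologicalSpace M] [ChartedSpace (Euc n) M]

variable [IsManifold (𝓡 n) ∞ M]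

theorem ComplexFrobenius.IsLipFieldOn.smul_of_tsupport_subset {V : ∀ q : M, TangentSpace (𝓡 n) q} {O : Set M}
    (hO : IsOpen O) (hV : IsLipFieldOn V O) {χ : M → ℝ} (hχ : ContMDiff (𝓡 n) 𝓘(ℝ, ℝ) ∞ χ)
    (hs : tsupport χ ⊆ O) : IsLipFieldOn (fun q => χ q • V q) univ := by
  intro c
  set e := chartAt (Euc n) c with he
  have hrep : ∀ y, chartRep c (fun q => χ q • V q) y = χ (e.symm y) • chartRep c V y := fun y =>
    map_smul (mfderiv (𝓡 n) (𝓡 n) e (e.symm y)) (χ (e.symm y)) (V (e.symm y))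
  have hχe : LocallyLipschitzOn e.target fun y => χ (e.symm y) := by
    refine ContDiffAt.comp_locallyLipschitzOn (g := fun y => χ (e.symm y)) (f := id)
      (fun y hy => ?_) (LocallyLipschitz.id.locallyLipschitzOn)
    have h1 : ContMDiffAt (𝓡 n) 𝓘(ℝ, ℝ) ∞ (fun y => χ (e.symm y)) y :=
      (hχ _).comp y ((contMDiffOn_chart_symm (I := 𝓡 n) (x := c)).contMDiffAt
        (e.open_target.mem_nhds hy))
    exact h1.contDiffAt.of_le (by simp)
  rw [preimage_univ, inter_univ]
  have hloc : LocallyLipschitzOn (e.target ∩ e.symm ⁻¹' O) (chartRep c fun q => χ q • V q) := by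
    rw [funext hrep]
    exact (hχe.mono inter_subset_left).smul (hV c)
  intro y hy
  by_cases hyO : e.symm y ∈ O
  · obtain ⟨K, t, ht, h⟩ := hloc ⟨hy, hyO⟩
    refine ⟨K, t, mem_nhdsWithin_of_mem_nhds ?_, h⟩
    rwa [(e.isOpen_inter_preimage_symm hO).nhdsWithin_eq ⟨hy, hyO⟩] at ht
  -- A point outside `O` has a neighbourhood missing the closed support of `χ`, where the product is
  -- zero.
  · refine ⟨0, e.target ∩ e.symm ⁻¹' (tsupport χ)ᶜ, mem_nhdsWithin_of_mem_nhds
      ((e.isOpen_inter_preimage_symm (isClosed_tsupport χ).isOpen_compl).mem_nhds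
        ⟨hy, fun h => hyO (hs h)⟩), ?_⟩
    intro a ha b hb
    have h0 : ∀ a ∈ e.target ∩ e.symm ⁻¹' (tsupport χ)ᶜ,
        chartRep c (fun q => χ q • V q) a = 0 := fun a ha => by
      rw [hrep, image_eq_zero_of_notMem_tsupport ha.2, zero_smul]
    rw [h0 a ha, h0 b hb, edist_self]
    exact zero_le

/-- Lipschitz sections over an open set agree near a given point with global ones. -/
theorem exists_global_sections [T2Space M] {S : ∀ q : M, Submodule ℂ (CTangent n q)} {O : Set M}
    (hO : IsOpen O) {p : M} (hp : p ∈ O) {ι : Type*} {Z : ι → ∀ q : M, CTangent n q}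
    (hZ : ∀ i, IsLipCFieldOn (Z i) O) (hZS : ∀ i, ∀ q ∈ O, Z i q ∈ S q) :
    ∃ (O' : Set M) (Z' : ι → ∀ q : M, CTangent n q), IsOpen O' ∧ p ∈ O' ∧ O' ⊆ O ∧
      ∀ i, IsLipSectionOn S (Z' i) univ ∧ ∀ q ∈ O', Z' i q = Z i q := by
  obtain ⟨χ, -, hχ⟩ := (SmoothBumpFunction.nhds_basis_tsupport (I := 𝓡 n) p).mem_iff.1
    (hO.mem_nhds hp)
  obtain ⟨O₁, hO₁, hO₁o, hpO₁⟩ := mem_nhds_iff.1 χ.eventuallyEq_one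
  refine ⟨O₁ ∩ O, fun i q => χ q • Z i q, hO₁o.inter hO, ⟨hpO₁, hp⟩, inter_subset_right,
    fun i => ⟨⟨⟨?_, ?_⟩, fun q _ => ?_⟩, fun q hq => ?_⟩⟩
  · have := IsLipFieldOn.smul_of_tsupport_subset hO (hZ i).1 χ.contMDiff hχ
    simpa only [map_smul] using this
  · have := IsLipFieldOn.smul_of_tsupport_subset hO (hZ i).2 χ.contMDiff hχ
    simpa only [map_smul] using this
  · by_cases hq : q ∈ O
    · exact (S q).smul_of_tower_mem (χ q) (hZS i q hq)
    · change χ q • Z i q ∈ S q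
      rw [image_eq_zero_of_notMem_tsupport (fun h => hq (hχ h)), zero_smul]
      exact (S q).zero_mem
  · have : χ q = 1 := hO₁ hq.1
    change χ q • Z i q = Z i q
    rw [this, one_smul]

end Cutoff

/-! ### Complex brackets in a chart -/

section ChartBracket

variable {n : ℕ} {M : Type*} [TopologicalSpace M] [ChartedSpace (Euc n) M]
  [IsManifold (𝓡 n) ∞ M]

/-- The derivative of a chart, as a linear map into Euclidean space. -/
noncomputable def chartDeriv (c q : M) : TangentSpace (𝓡 n) q →ₗ[ℝ] Euc n :=
  (mfderiv (𝓡 n) (𝓡 n) (chartAt (Euc n) c) q).toLinearMap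

theorem chartDeriv_injective (c : M) {q : M} (hq : q ∈ (chartAt (Euc n) c).source) :
    Function.Injective (chartDeriv (n := n) c q) :=
  mfderiv_chartAt_injective c hq

theorem flatCBracket_chartRep {Z W : ∀ q : M, CTangent n q} {c : M} {y : Euc n}
    (hy : y ∈ (chartAt (Euc n) c).target)
    (h1 : DifferentiableAt ℝ (chartRep c fun q => rePart (Z q)) y)
    (h2 : DifferentiableAt ℝ (chartRep c fun q => imPart (Z q)) y)
    (h3 : DifferentiableAt ℝ (chartRep c fun q => rePart (W q)) y)
    (h4 : DifferentiableAt ℝ (chartRep c fun q => imPart (W q)) y) :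
    flatCBracket (chartRep c fun q => rePart (Z q)) (chartRep c fun q => imPart (Z q))
        (chartRep c fun q => rePart (W q)) (chartRep c fun q => imPart (W q)) y
      = (chartDeriv c ((chartAt (Euc n) c).symm y)).baseChange ℂ
        (cBracket Z W ((chartAt (Euc n) c).symm y)) := by
  rw [baseChange_eq_cvec, cBracket, rePart_cvec, imPart_cvec, map_sub, map_add, flatCBracket,
    lieBracket_chartRep hy h1 h3, lieBracket_chartRep hy h2 h4, lieBracket_chartRep hy h1 h4,
    lieBracket_chartRep hy h2 h3]
  rfl

end ChartBracket

/-! ### Frames as Lipschitz families of linear maps -/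

section Frames

theorem LocallyLipschitzOn.pi {α ι : Type*} [PseudoEMetricSpace α] [Fintype ι] {F : ι → Type*}
    [∀ i, PseudoEMetricSpace (F i)] {f : ∀ i, α → F i} {s : Set α}
    (hf : ∀ i, LocallyLipschitzOn s (f i)) : LocallyLipschitzOn s fun x i => f i x := fun x hx => by
  choose K t ht h using fun i => hf i hx
  refine ⟨∑ i, K i, ⋂ i, t i, Filter.iInter_mem.2 ht, fun a ha b hb => ?_⟩
  refine edist_pi_le_iff.2 fun i => ?_
  refine (h i (mem_iInter.1 ha i) (mem_iInter.1 hb i)).trans ?_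
  gcongr
  exact Finset.single_le_sum (f := K) (fun _ _ => bot_le) (Finset.mem_univ i)

/-- The linear map sending the standard basis to a given family of vectors. -/
noncomputable def frameCLM (𝕜 : Type*) [RCLike 𝕜] {k : ℕ} {F : Type*} [NormedAddCommGroup F]
    [NormedSpace 𝕜 F] (v : Fin k → F) : (Fin k → 𝕜) →L[𝕜] F :=
  LinearMap.toContinuousLinearMap (Fintype.linearCombination 𝕜 v)

theorem frameCLM_apply (𝕜 : Type*) [RCLike 𝕜] {k : ℕ} {F : Type*} [NormedAddCommGroup F]
    [NormedSpace 𝕜 F] (v : Fin k → F) (c : Fin k → 𝕜) : frameCLM 𝕜 v c = ∑ i, c i • v i := by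
  simp [frameCLM, Fintype.linearCombination_apply]

/-- The map is linear in the tuple of vectors, on a finite dimensional space. -/
theorem exists_lipschitzWith_frameCLM (𝕜 : Type*) [RCLike 𝕜] (k : ℕ) (F : Type*)
    [NormedAddCommGroup F] [NormedSpace 𝕜 F] [FiniteDimensional 𝕜 F] :
    ∃ C, LipschitzWith C (frameCLM 𝕜 : (Fin k → F) → (Fin k → 𝕜) →L[𝕜] F) := by
  let B : (Fin k → F) →ₗ[𝕜] ((Fin k → 𝕜) →L[𝕜] F) :=
    { toFun := frameCLM 𝕜
      map_add' := fun v w => by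
        ext1 c
        simp [frameCLM_apply, Finset.sum_add_distrib]
      map_smul' := fun a v => by
        ext1 c
        simp [frameCLM_apply, Finset.smul_sum, smul_comm a] }
  exact ⟨_, (LinearMap.toContinuousLinearMap B).lipschitz⟩

theorem LocallyLipschitzOn.frameCLM {α : Type*} [PseudoEMetricSpace α] (𝕜 : Type*) [RCLike 𝕜]
    {k : ℕ} {F : Type*} [NormedAddCommGroup F] [NormedSpace 𝕜 F] [FiniteDimensional 𝕜 F]
    {v : Fin k → α → F} {s : Set α} (hv : ∀ i, LocallyLipschitzOn s (v i)) :
    LocallyLipschitzOn s fun x => _root_.frameCLM 𝕜 fun i => v i x := by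
  obtain ⟨C, hC⟩ := exists_lipschitzWith_frameCLM 𝕜 k F
  exact hC.comp_locallyLipschitzOn (LocallyLipschitzOn.pi hv)

/-- Take a left inverse `Θ` at `x₀` and correct it by the inverse of `Θ (X y)`, which is invertible
nearby. It serves to read off coefficients of Lipschitz fields in a Lipschitz frame without losing
regularity. -/
theorem exists_locallyLipschitzOn_leftInverse {E K F : Type*} [NormedAddCommGroup E]
    [NormedSpace ℝ E] [NormedAddCommGroup K] [NormedSpace ℝ K] [FiniteDimensional ℝ K]
    [NormedAddCommGroup F] [NormedSpace ℝ F] [FiniteDimensional ℝ F]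
    {X : E → K →L[ℝ] F} {O : Set E} (hO : IsOpen O) {x₀ : E} (hx₀ : x₀ ∈ O)
    (hX : LocallyLipschitzOn O X) (hinj : Function.Injective (X x₀)) :
    ∃ (Λ : E → F →L[ℝ] K) (O' : Set E), IsOpen O' ∧ x₀ ∈ O' ∧ O' ⊆ O ∧ LocallyLipschitzOn O' Λ ∧
      ∀ y ∈ O', ∀ c, Λ y (X y c) = c := by
  have : CompleteSpace K := FiniteDimensional.complete ℝ K
  obtain ⟨θ, hθ⟩ := (X x₀).toLinearMap.exists_leftInverse_of_injective (LinearMap.ker_eq_bot.2 hinj)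
  let Θ := LinearMap.toContinuousLinearMap θ
  let B : E → K →L[ℝ] K := fun y => Θ.comp (X y)
  have hB : LocallyLipschitzOn O B := (LocallyLipschitzOn.const Θ O).clm_comp hX
  have hB0 : B x₀ = 1 := by
    ext1 v
    exact LinearMap.congr_fun hθ v
  have hG : LocallyLipschitzOn (O ∩ B ⁻¹' {b | IsUnit b}) fun y => Ring.inverse (B y) :=
    ContDiffAt.comp_locallyLipschitzOn (fun y hy => by
      obtain ⟨u, hu⟩ := hy.2
      rw [← hu]
      exact contDiffAt_ringInverse ℝ u) (hB.mono inter_subset_left)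
  refine ⟨fun y => (Ring.inverse (B y)).comp Θ, _,
    hB.continuousOn.isOpen_inter_preimage hO Units.isOpen, ⟨hx₀, by simp [hB0]⟩,
    inter_subset_left, hG.clm_comp (LocallyLipschitzOn.const Θ _), fun y hy c => ?_⟩
  exact congrArg (fun b : K →L[ℝ] K => b c) (Ring.inverse_mul_cancel _ hy.2)

end Frames

/-! ### Fibrewise linear algebra: `S` as a subspace of `ℂ^k` -/

section FibreAlgebra

variable {k r l : ℕ} {T E : Type*} [AddCommGroup T] [Module ℝ T] [AddCommGroup E] [Module ℝ E]

theorem cplx_toC (D : (Fin k → ℝ) →ₗ[ℝ] E) (c : Fin k → ℝ) : cplx D (toC c) = cvec (D c) 0 := by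
  rw [cplx_apply, reC_toC, imC_toC, map_zero]

theorem mem_realVecs {S : Submodule ℂ (ℂ ⊗[ℝ] T)} {u : T} : u ∈ realVecs S ↔ cvec u 0 ∈ S := by
  rw [realVecs, Submodule.mem_comap, cvec, TensorProduct.tmul_zero, add_zero]
  rfl

theorem exists_linearCombination_of_mem_span {R N ι : Type*} [Semiring R] [AddCommMonoid N]
    [Module R N] [Fintype ι] {x : ι → N} {u : N} (h : u ∈ Submodule.span R (range x)) :
    ∃ c : ι → R, ∑ i, c i • x i = u :=
  (Submodule.mem_span_range_iff_exists_fun R).1 h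

theorem sum_mem_span_image_iff {x : Fin k → T} (hx : LinearIndependent ℝ x) {c : Fin k → ℝ} :
    ∑ i, c i • x i ∈ Submodule.span ℝ (x '' {i | (i : ℕ) < l}) ↔
      ∀ i : Fin k, l ≤ (i : ℕ) → c i = 0 := by
  constructor
  · intro h i hi
    rw [Finsupp.mem_span_image_iff_linearCombination] at h
    obtain ⟨f, hf, hfc⟩ := h
    have h1 : ∑ i, f i • x i = ∑ i, c i • x i := by
      rw [← hfc, Finsupp.linearCombination_apply, Finsupp.sum_fintype]
      simp
    have h2 := Fintype.linearIndependent_iff.1 hx (fun i => f i - c i)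
      (by simp only [sub_smul, Finset.sum_sub_distrib, h1, sub_self]) i
    have h3 : f i = 0 := by
      by_contra h0
      have := (Finsupp.mem_supported ℝ f).1 hf (Finsupp.mem_support_iff.2 h0)
      exact absurd this (not_lt.2 hi)
    rw [h3, zero_sub, neg_eq_zero] at h2
    exact h2
  · intro h
    refine Submodule.sum_mem _ fun i _ => ?_
    by_cases hi : (i : ℕ) < l
    · exact Submodule.smul_mem _ _ (Submodule.subset_span ⟨i, hi, rfl⟩)
    · rw [h i (not_lt.1 hi), zero_smul]
      exact Submodule.zero_mem _

variable {S : Submodule ℂ (ℂ ⊗[ℝ] T)} {x : Fin k → T} {z : Fin r → ℂ ⊗[ℝ] T} {ε : T →ₗ[ℝ] E}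
  {X : (Fin k → ℝ) →ₗ[ℝ] E} {Λ : E →ₗ[ℝ] (Fin k → ℝ)}
  {A : (Fin r → ℂ) →ₗ[ℂ] (Fin k → ℂ)}

/-- In this section `ε` is the derivative of a chart, `x` the frame of real parts of `S`, `X` that
frame in the chart, `Λ` a left inverse of `X`, and `A` the matrix of the frame `z` of `S` in terms
of `x`. -/
theorem frame_leftInverse_apply (hspan : Submodule.span ℝ (range x) = realParts S)
    (hX : ∀ c, X c = ε (∑ i, c i • x i)) (hΛ : ∀ c, Λ (X c) = c) {u : T} (hu : u ∈ realParts S) :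
    X (Λ (ε u)) = ε u := by
  rw [← hspan] at hu
  obtain ⟨c, rfl⟩ := exists_linearCombination_of_mem_span hu
  rw [← hX, hΛ]

theorem baseChange_eq_cplx_coeff (hspan : Submodule.span ℝ (range x) = realParts S)
    (hX : ∀ c, X c = ε (∑ i, c i • x i)) (hΛ : ∀ c, Λ (X c) = c) {w : ℂ ⊗[ℝ] T} (hw : w ∈ S) :
    ε.baseChange ℂ w = cplx X (toC (Λ (ε (rePart w))) + Complex.I • toC (Λ (ε (imPart w)))) := by
  rw [baseChange_eq_cvec, cplx_apply]
  simp only [map_add, reC_smul, imC_smul, reC_toC, imC_toC, Complex.I_re, Complex.I_im, zero_smul, one_smul, smul_zero,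
    sub_zero, add_zero, zero_add]
  rw [frame_leftInverse_apply hspan hX hΛ ⟨w, hw, rfl⟩,
    frame_leftInverse_apply hspan hX hΛ (imPart_mem_realParts hw)]

theorem baseChange_sum_eq_cplx (hspan : Submodule.span ℝ (range x) = realParts S)
    (hX : ∀ c, X c = ε (∑ i, c i • x i)) (hΛ : ∀ c, Λ (X c) = c)
    (hz : Submodule.span ℂ (range z) = S)
    (hA : ∀ v, A v = ∑ a, v a •
      (toC (Λ (ε (rePart (z a)))) + Complex.I • toC (Λ (ε (imPart (z a)))))) (v : Fin r → ℂ) :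
    ε.baseChange ℂ (∑ a, v a • z a) = cplx X (A v) := by
  rw [hA, map_sum, map_sum]
  refine Finset.sum_congr rfl fun a _ => ?_
  rw [map_smul, map_smul, baseChange_eq_cplx_coeff hspan hX hΛ
    (hz ▸ Submodule.subset_span (mem_range_self a))]

/-- The frame `z` of `S` corresponds to the columns of `A`, and the complexified chart derivative is
injective; so membership in `S` is membership of the coefficient vector in the range of `A`. -/
theorem mem_iff_baseChange_mem (hε : Function.Injective ε)
    (hspan : Submodule.span ℝ (range x) = realParts S)
    (hX : ∀ c, X c = ε (∑ i, c i • x i)) (hΛ : ∀ c, Λ (X c) = c)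
    (hz : Submodule.span ℂ (range z) = S)
    (hA : ∀ v, A v = ∑ a, v a •
      (toC (Λ (ε (rePart (z a)))) + Complex.I • toC (Λ (ε (imPart (z a))))))
    {w : ℂ ⊗[ℝ] T} : w ∈ S ↔ ∃ v, cplx X (A v) = ε.baseChange ℂ w := by
  constructor
  · intro hw
    rw [← hz] at hw
    obtain ⟨v, rfl⟩ := exists_linearCombination_of_mem_span hw
    exact ⟨v, (baseChange_sum_eq_cplx hspan hX hΛ hz hA v).symm⟩
  · rintro ⟨v, hv⟩
    rw [← baseChange_sum_eq_cplx hspan hX hΛ hz hA] at hv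
    rw [← baseChange_complex_injective hε hv, ← hz]
    exact Submodule.sum_mem _ fun a _ =>
      Submodule.smul_mem _ _ (Submodule.subset_span (mem_range_self a))

theorem coeff_injective (hε : Function.Injective ε)
    (hspan : Submodule.span ℝ (range x) = realParts S)
    (hX : ∀ c, X c = ε (∑ i, c i • x i)) (hΛ : ∀ c, Λ (X c) = c)
    (hz : Submodule.span ℂ (range z) = S) (hzi : LinearIndependent ℂ z)
    (hA : ∀ v, A v = ∑ a, v a •
      (toC (Λ (ε (rePart (z a)))) + Complex.I • toC (Λ (ε (imPart (z a)))))) :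
    Function.Injective A := by
  rw [← LinearMap.ker_eq_bot, LinearMap.ker_eq_bot']
  intro v hv
  have h := baseChange_sum_eq_cplx hspan hX hΛ hz hA v
  rw [hv, map_zero, ← map_zero (ε.baseChange ℂ)] at h
  exact funext (Fintype.linearIndependent_iff.1 hzi v (baseChange_complex_injective hε h))

theorem toC_mem_range_iff (hε : Function.Injective ε) (hxi : LinearIndependent ℝ x)
    (hspan : Submodule.span ℝ (range x) = realParts S)
    (hspan' : Submodule.span ℝ (x '' {i | (i : ℕ) < l}) = realVecs S)
    (hX : ∀ c, X c = ε (∑ i, c i • x i)) (hΛ : ∀ c, Λ (X c) = c)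
    (hz : Submodule.span ℂ (range z) = S)
    (hA : ∀ v, A v = ∑ a, v a •
      (toC (Λ (ε (rePart (z a)))) + Complex.I • toC (Λ (ε (imPart (z a)))))) {c : Fin k → ℝ} :
    toC c ∈ LinearMap.range A ↔ ∀ i : Fin k, l ≤ (i : ℕ) → c i = 0 := by
  have hXi : Function.Injective X := fun a b h => by rw [← hΛ a, h, hΛ]
  rw [← sum_mem_span_image_iff hxi, hspan', mem_realVecs,
    mem_iff_baseChange_mem hε hspan hX hΛ hz hA, baseChange_eq_cvec, rePart_cvec, imPart_cvec,
    map_zero, ← hX, ← cplx_toC]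
  exact exists_congr fun v => (cplx_injective hXi).eq_iff.symm

theorem exists_reC_eq (hε : Function.Injective ε)
    (hspan : Submodule.span ℝ (range x) = realParts S)
    (hX : ∀ c, X c = ε (∑ i, c i • x i)) (hΛ : ∀ c, Λ (X c) = c)
    (hz : Submodule.span ℂ (range z) = S)
    (hA : ∀ v, A v = ∑ a, v a •
      (toC (Λ (ε (rePart (z a)))) + Complex.I • toC (Λ (ε (imPart (z a)))))) (c : Fin k → ℝ) :
    ∃ v, reC (A v) = c := by
  have h : ∑ i, c i • x i ∈ realParts S := by
    rw [← hspan]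
    exact Submodule.sum_mem _ fun i _ =>
      Submodule.smul_mem _ _ (Submodule.subset_span (mem_range_self i))
  obtain ⟨w, hw, hwc⟩ := h
  obtain ⟨v, hv⟩ := (mem_iff_baseChange_mem hε hspan hX hΛ hz hA).1 hw
  refine ⟨v, ?_⟩
  have h1 := congrArg rePart hv
  rw [cplx_apply, rePart_cvec, rePart_baseChange, hwc, ← hX] at h1
  rw [← hΛ (reC (A v)), h1, hΛ]

theorem finrank_span_image_lt {x : Fin k → T} (hx : LinearIndependent ℝ x) (hlk : l ≤ k) :
    Module.finrank ℝ (Submodule.span ℝ (x '' {i | (i : ℕ) < l})) = l := by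
  have h : x '' {i | (i : ℕ) < l} = range (x ∘ Fin.castLE hlk) := by
    ext u
    constructor
    · rintro ⟨i, hi, rfl⟩
      exact ⟨⟨i, hi⟩, rfl⟩
    · rintro ⟨i, rfl⟩
      exact ⟨Fin.castLE hlk i, i.2, rfl⟩
  rw [h, finrank_span_eq_card (hx.comp _ (Fin.castLE_injective hlk)), Fintype.card_fin]

end FibreAlgebra

/-! ### Commutation and involutivity in coefficient form -/

section FlatData

theorem LocallyLipschitzOn.toC_add_I_smul {α : Type*} [PseudoEMetricSpace α] {k : ℕ}
    {f g : α → Fin k → ℝ} {s : Set α} (hf : LocallyLipschitzOn s f)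
    (hg : LocallyLipschitzOn s g) :
    LocallyLipschitzOn s fun x => toC (f x) + Complex.I • toC (g x) := by
  refine LocallyLipschitzOn.pi (f := fun i x => (f x i : ℂ) + Complex.I * (g x i : ℂ)) fun i => ?_
  refine ContDiffAt.comp_locallyLipschitzOn (f := fun x => (f x, g x))
    (g := fun u : (Fin k → ℝ) × (Fin k → ℝ) => (u.1 i : ℂ) + Complex.I * (u.2 i : ℂ))
    (fun y _ => ?_) (hf.prodMk hg)
  have h : ∀ i, ContDiff ℝ 1 fun u : Fin k → ℝ => (u i : ℂ) := fun i =>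
    Complex.ofRealCLM.contDiff.comp (contDiff_apply ℝ ℝ i)
  exact (((h i).comp contDiff_fst).add (contDiff_const.mul ((h i).comp contDiff_snd))).contDiffAt

variable {k r : ℕ} {E : Type*} [NormedAddCommGroup E] [NormedSpace ℝ E]

/-- The defect is bilinear in `c` and `c'`, and on basis vectors it is the bracket of two frame
fields. -/
theorem fderiv_frame_symm_of_lieBracket_eq_zero {X : E → (Fin k → ℝ) →L[ℝ] E} {y : E}
    (hX : DifferentiableAt ℝ X y)
    (h : ∀ i j : Fin k, VectorField.lieBracket ℝ (fun z => X z (Pi.single i 1))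
      (fun z => X z (Pi.single j 1)) y = 0) (c c' : Fin k → ℝ) :
    fderiv ℝ X y (X y c) c' = fderiv ℝ X y (X y c') c := by
  have hd : ∀ c u, fderiv ℝ (fun z => X z c) y u = fderiv ℝ X y u c := fun c u => by
    rw [fderiv_clm_apply hX (differentiableAt_const c)]
    simp
  let L : (Fin k → ℝ) →L[ℝ] (Fin k → ℝ) →L[ℝ] E := (fderiv ℝ X y).comp (X y)
  let B : (Fin k → ℝ) →ₗ[ℝ] (Fin k → ℝ) →ₗ[ℝ] E :=
    LinearMap.mk₂ ℝ (fun c c' => L c c' - L c' c)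
      (fun a b c => by simp only [map_add, add_apply]; abel)
      (fun a b c => by simp only [map_smul, smul_apply, smul_sub])
      (fun a b c => by simp only [map_add, add_apply]; abel)
      (fun a b c => by simp only [map_smul, smul_apply, smul_sub])
  have hB : B = 0 := by
    refine LinearMap.ext_basis (Pi.basisFun ℝ (Fin k)) (Pi.basisFun ℝ (Fin k)) fun i j => ?_
    have := h i j
    rw [VectorField.lieBracket, hd, hd] at this
    simpa [B, L] using this
  exact sub_eq_zero.1 (LinearMap.congr_fun₂ hB c c')

/-- Modulo the range of `A y` the expression is complex bilinear in `v` and `w`, so basis vectors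
suffice. On these it is the coefficient vector of a bracket of two frame sections, which lies in the
range by hypothesis. -/
theorem frameDeriv_sub_mem_range {X : E → (Fin k → ℝ) →L[ℝ] E}
    {A : E → (Fin r → ℂ) →L[ℂ] (Fin k → ℂ)} {y : E} (hX : DifferentiableAt ℝ X y)
    (hA : DifferentiableAt ℝ A y) (hXi : Function.Injective (X y))
    (hcomm : ∀ c c', fderiv ℝ X y (X y c) c' = fderiv ℝ X y (X y c') c) {P Q : Fin r → E → E}
    (hP : ∀ a, P a =ᶠ[𝓝 y] fun z => X z (reC (A z (Pi.single a 1))))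
    (hQ : ∀ a, Q a =ᶠ[𝓝 y] fun z => X z (imC (A z (Pi.single a 1))))
    (hb : ∀ a b, ∃ v, cplx (X y).toLinearMap (A y v) = flatCBracket (P a) (Q a) (P b) (Q b) y)
    (v w : Fin r → ℂ) : frameDeriv X A y (A y v) w - frameDeriv X A y (A y w) v
      ∈ LinearMap.range (A y).toLinearMap := by
  have hAv : ∀ v, DifferentiableAt ℝ (fun z => A z v) y := fun v =>
    (hasFDerivAt_cclm_apply hA (differentiableAt_const v)).differentiableAt
  have hAd : ∀ v c, frameDeriv X (fun z => A z v) y c = frameDeriv X A y c v := fun v c => by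
    rw [frameDeriv_cclm_apply hA (differentiableAt_const v)]
    simp [frameDeriv_apply X (fun _ => v)]
  let R := LinearMap.range (A y).toLinearMap
  let B : (Fin r → ℂ) →ₗ[ℂ] (Fin r → ℂ) →ₗ[ℂ] ((Fin k → ℂ) ⧸ R) :=
    LinearMap.mk₂ ℂ (fun v w => R.mkQ (frameDeriv X A y (A y v) w - frameDeriv X A y (A y w) v))
      (fun a b c => by rw [← map_add]; congr 1; simp only [map_add, add_apply]; abel)
      (fun a b c => by rw [← map_smul]; congr 1; simp only [map_smul, smul_apply, smul_sub])
      (fun a b c => by rw [← map_add]; congr 1; simp only [map_add, add_apply]; abel)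
      (fun a b c => by rw [← map_smul]; congr 1; simp only [map_smul, smul_apply, smul_sub])
  have hB : B = 0 := by
    refine LinearMap.ext_basis (Pi.basisFun ℂ (Fin r)) (Pi.basisFun ℂ (Fin r)) fun a b => ?_
    obtain ⟨m, hm⟩ := hb a b
    rw [flatCBracket_congr (hP a) (hQ a) (hP b) (hQ b),
      flatCBracket_frame hX hcomm (hAv _) (hAv _), hAd, hAd] at hm
    have h := cplx_injective (D := (X y).toLinearMap) hXi hm
    refine (Submodule.Quotient.mk_eq_zero R).2 ?_
    rw [Pi.basisFun_apply, Pi.basisFun_apply]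
    exact ⟨m, h⟩
  exact (Submodule.Quotient.mk_eq_zero R).1 (LinearMap.congr_fun₂ hB v w)

end FlatData

/-! ### Reduction of the manifold hypotheses to coefficient data -/

section LocalCoordinates

variable {n : ℕ} {M : Type*} [TopologicalSpace M] [T2Space M] [ChartedSpace (Euc n) M]
  [IsManifold (𝓡 n) ∞ M]

/-- The data of an involutive structure satisfying the commuting frame hypothesis, read in a
chart. -/
theorem exists_flat_data {S : ∀ q : M, Submodule ℂ (CTangent n q)}
    (hS : IsLipSubbundleOn S univ) (hinv : IsInvolutiveOn S univ) (hV : HypothesisV S) (p : M) :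
    ∃ (l k r : ℕ) (O : Set (Euc n)) (X : Euc n → (Fin k → ℝ) →L[ℝ] Euc n)
      (A : Euc n → (Fin r → ℂ) →L[ℂ] (Fin k → ℂ)),
      l ≤ k ∧ k ≤ n ∧ Module.finrank ℝ (realVecs (S p)) = l ∧ IsOpen O ∧
      chartAt (Euc n) p p ∈ O ∧ O ⊆ (chartAt (Euc n) p).target ∧
      LocallyLipschitzOn O X ∧ LocallyLipschitzOn O A ∧
      (∀ y ∈ O, Function.Injective (X y)) ∧ (∀ y ∈ O, Function.Injective (A y)) ∧
      (∀ᵐ y : Euc n, y ∈ O → ∀ c c', fderiv ℝ X y (X y c) c' = fderiv ℝ X y (X y c') c) ∧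
      (∀ᵐ y : Euc n, y ∈ O → ∀ v w, frameDeriv X A y (A y v) w - frameDeriv X A y (A y w) v
        ∈ LinearMap.range (A y).toLinearMap) ∧
      (∀ y ∈ O, ∀ c, toC c ∈ LinearMap.range (A y).toLinearMap ↔
        ∀ i : Fin k, l ≤ (i : ℕ) → c i = 0) ∧
      (∀ y ∈ O, ∀ c, ∃ v, reC (A y v) = c) ∧
      ∀ y ∈ O, ∀ w : CTangent n ((chartAt (Euc n) p).symm y),
        w ∈ S ((chartAt (Euc n) p).symm y) ↔ ∃ v, cplx (X y).toLinearMap (A y v)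
          = (chartDeriv p ((chartAt (Euc n) p).symm y)).baseChange ℂ w := by
  set e := chartAt (Euc n) p with he
  have hpe : p ∈ e.source := mem_chart_source _ p
  obtain ⟨O₁, hO₁, hpO₁, l, k, hlk, x, hx, hxf, hxc⟩ := hV p
  obtain ⟨O₂, hO₂, hpO₂, -, r, Z₀, hZ₀, hZ₀f⟩ := hS p (mem_univ p)
  -- Involutivity is a statement on sections over all of `M`, so the local frame is replaced by
  -- global sections that agree with it near `p`.
  obtain ⟨O₃, Z, hO₃, hpO₃, hO₃₂, hZ⟩ := exists_global_sections (S := S) hO₂ hpO₂ hZ₀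
    fun i q hq => by
      rw [← (hZ₀f q hq).2]
      exact Submodule.subset_span (mem_range_self i)
  have hZf : ∀ q ∈ O₃, LinearIndependent ℂ (fun i => Z i q) ∧
      Submodule.span ℂ (range fun i => Z i q) = S q := fun q hq => by
    have : (fun i => Z i q) = fun i => Z₀ i q := funext fun i => (hZ i).2 q hq
    rw [this]
    exact hZ₀f q (hO₃₂ hq)
  let O₀ := e.target ∩ e.symm ⁻¹' (O₁ ∩ O₃)
  have hO₀ : IsOpen O₀ := e.isOpen_inter_preimage_symm (hO₁.inter hO₃)
  have hx₀ : e p ∈ O₀ := ⟨e.map_source hpe, by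
    rw [mem_preimage, e.left_inv hpe]
    exact ⟨hpO₁, hpO₃⟩⟩
  have hsrc : ∀ y ∈ O₀, e.symm y ∈ e.source := fun y hy => e.map_target hy.1
  let X : Euc n → (Fin k → ℝ) →L[ℝ] Euc n := fun y => frameCLM ℝ fun i => chartRep p (x i) y
  have hX : LocallyLipschitzOn O₀ X := LocallyLipschitzOn.frameCLM ℝ fun i =>
    (hx i p).mono (inter_subset_inter_right _ (preimage_mono inter_subset_left))
  have hXapp : ∀ y c, X y c = chartDeriv p (e.symm y) (∑ i, c i • x i (e.symm y)) := fun y c => by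
    rw [frameCLM_apply, map_sum]
    simp only [map_smul]
    rfl
  have hXi : ∀ y ∈ O₀, Function.Injective (X y) := fun y hy => by
    refine (injective_iff_map_eq_zero (X y)).2 fun c hc => ?_
    rw [hXapp, ← map_zero (chartDeriv p (e.symm y))] at hc
    exact funext (Fintype.linearIndependent_iff.1 (hxf _ hy.2.1).1 c
      (chartDeriv_injective p (hsrc y hy) hc))
  obtain ⟨Λ, O, hO, hx₀', hOO₀, hΛ, hΛX⟩ :=
    exists_locallyLipschitzOn_leftInverse hO₀ hx₀ hX (hXi _ hx₀)
  let a : Fin r → Euc n → Fin k → ℂ := fun i y =>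
    toC (Λ y (chartRep p (fun q => rePart (Z i q)) y))
      + Complex.I • toC (Λ y (chartRep p (fun q => imPart (Z i q)) y))
  let A : Euc n → (Fin r → ℂ) →L[ℂ] (Fin k → ℂ) := fun y => frameCLM ℂ fun i => a i y
  have hZl : ∀ i, LocallyLipschitzOn O (chartRep p fun q => rePart (Z i q)) ∧
      LocallyLipschitzOn O (chartRep p fun q => imPart (Z i q)) := fun i =>
    ⟨((hZ i).1.1.1 p).mono fun y hy => ⟨(hOO₀ hy).1, mem_univ _⟩,
      ((hZ i).1.1.2 p).mono fun y hy => ⟨(hOO₀ hy).1, mem_univ _⟩⟩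
  have hA : LocallyLipschitzOn O A := by
    refine LocallyLipschitzOn.frameCLM ℂ fun i => ?_
    exact LocallyLipschitzOn.toC_add_I_smul (hΛ.clm_apply (hZl i).1) (hΛ.clm_apply (hZl i).2)
  have hAapp : ∀ y v, A y v = ∑ i, v i • (toC (Λ y (chartDeriv p (e.symm y)
      (rePart (Z i (e.symm y))))) + Complex.I • toC (Λ y (chartDeriv p (e.symm y)
      (imPart (Z i (e.symm y)))))) := fun y v => by
    rw [frameCLM_apply]
    rfl
  have hmem : ∀ y ∈ O, ∀ w : CTangent n (e.symm y), w ∈ S (e.symm y) ↔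
      ∃ v, cplx (X y).toLinearMap (A y v) = (chartDeriv p (e.symm y)).baseChange ℂ w :=
    fun y hy w => mem_iff_baseChange_mem (chartDeriv_injective p (hsrc y (hOO₀ hy)))
      (hxf _ (hOO₀ hy).2.1).2.1 (hXapp y) (Λ := (Λ y).toLinearMap) (hΛX y hy)
      (hZf _ (hOO₀ hy).2.2).2 (A := (A y).toLinearMap) (hAapp y)
  have hXd : ∀ᵐ y : Euc n, y ∈ O₀ → DifferentiableAt ℝ X y :=
    hX.ae_differentiableAt (μ := volume) hO₀
  have hcomm : ∀ᵐ y : Euc n, y ∈ O →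
      ∀ c c', fderiv ℝ X y (X y c) c' = fderiv ℝ X y (X y c') c := by
    have h1 : ∀ᵐ y : Euc n, ∀ i j, y ∈ e.target → e.symm y ∈ O₁ →
        VectorField.mlieBracket (𝓡 n) (x i) (x j) (e.symm y) = 0 :=
      ae_all_iff.2 fun i => ae_all_iff.2 fun j => hxc i j p
    filter_upwards [h1, hXd] with y h1 h2 hy
    have hy₀ := hOO₀ hy
    refine fderiv_frame_symm_of_lieBracket_eq_zero (h2 hy₀) fun i j => ?_
    have h3 : ∀ i, (fun z => X z (Pi.single i 1)) = chartRep p (x i) := fun i => by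
      ext1 z
      simp [X, frameCLM_apply, Pi.single_apply]
    have h4 : ∀ i, DifferentiableAt ℝ (chartRep p (x i)) y := fun i => by
      rw [← h3]
      exact (h2 hy₀).clm_apply (differentiableAt_const _)
    rw [h3, h3, lieBracket_chartRep hy₀.1 (h4 i) (h4 j), h1 i j hy₀.1 hy₀.2.1]
    exact map_zero _
  refine ⟨l, k, r, O, X, A, hlk, ?_, ?_, hO, hx₀', fun y hy => (hOO₀ hy).1, hX.mono hOO₀, hA,
    fun y hy => hXi y (hOO₀ hy), fun y hy => ?_, hcomm, ?_, fun y hy c => ?_, fun y hy c => ?_,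
    hmem⟩
  · simpa using LinearMap.finrank_le_finrank_of_injective (f := (X (e p)).toLinearMap)
      (hXi _ hx₀)
  · rw [← (hxf p hpO₁).2.2]
    exact finrank_span_image_lt (hxf p hpO₁).1 hlk
  · exact coeff_injective (chartDeriv_injective p (hsrc y (hOO₀ hy)))
      (hxf _ (hOO₀ hy).2.1).2.1 (hXapp y) (Λ := (Λ y).toLinearMap) (hΛX y hy)
      (hZf _ (hOO₀ hy).2.2).2 (hZf _ (hOO₀ hy).2.2).1 (A := (A y).toLinearMap) (hAapp y)
  · have h1 : ∀ᵐ y : Euc n, ∀ i j, y ∈ e.target → e.symm y ∈ univ →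
        cBracket (Z i) (Z j) (e.symm y) ∈ S (e.symm y) :=
      ae_all_iff.2 fun i => ae_all_iff.2 fun j => (hinv (Z i) (Z j) (hZ i).1 (hZ j).1).1 p
    have h2 : ∀ᵐ y : Euc n, ∀ i, y ∈ O →
        DifferentiableAt ℝ (chartRep p fun q => rePart (Z i q)) y :=
      ae_all_iff.2 fun i => (hZl i).1.ae_differentiableAt (μ := volume) hO
    have h3 : ∀ᵐ y : Euc n, ∀ i, y ∈ O →
        DifferentiableAt ℝ (chartRep p fun q => imPart (Z i q)) y :=
      ae_all_iff.2 fun i => (hZl i).2.ae_differentiableAt (μ := volume) hO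
    filter_upwards [h1, h2, h3, hXd, hcomm, hA.ae_differentiableAt (μ := volume) hO]
      with y h1 h2 h3 h4 h5 h6 hy
    have hy₀ := hOO₀ hy
    have hcoeff : ∀ z ∈ O, ∀ i, (chartDeriv p (e.symm z)).baseChange ℂ (Z i (e.symm z))
        = cplx (X z).toLinearMap (A z (Pi.single i 1)) := fun z hz i => by
      have := baseChange_sum_eq_cplx (hxf _ (hOO₀ hz).2.1).2.1 (hXapp z)
        (Λ := (Λ z).toLinearMap) (hΛX z hz) (hZf _ (hOO₀ hz).2.2).2 (A := (A z).toLinearMap)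
        (hAapp z) (Pi.single i 1)
      simpa [Pi.single_apply] using this
    refine frameDeriv_sub_mem_range (h4 hy₀) (h6 hy) (hXi y hy₀) (h5 hy)
      (P := fun i => chartRep p fun q => rePart (Z i q))
      (Q := fun i => chartRep p fun q => imPart (Z i q)) (fun i => ?_) (fun i => ?_) fun i j => ?_
    · filter_upwards [hO.mem_nhds hy] with z hz
      have := congrArg rePart (hcoeff z hz i)
      rwa [rePart_baseChange, cplx_apply, rePart_cvec] at this
    · filter_upwards [hO.mem_nhds hy] with z hz
      have := congrArg imPart (hcoeff z hz i)
      rwa [imPart_baseChange, cplx_apply, imPart_cvec] at this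
    · rw [flatCBracket_chartRep hy₀.1 (h2 i hy) (h3 i hy) (h2 j hy) (h3 j hy)]
      exact (hmem y hy _).1 (h1 i j hy₀.1 (mem_univ _))
  · exact toC_mem_range_iff (chartDeriv_injective p (hsrc y (hOO₀ hy))) (hxf _ (hOO₀ hy).2.1).1
      (hxf _ (hOO₀ hy).2.1).2.1 (hxf _ (hOO₀ hy).2.1).2.2 (hXapp y) (Λ := (Λ y).toLinearMap)
      (hΛX y hy) (hZf _ (hOO₀ hy).2.2).2 (A := (A y).toLinearMap) (hAapp y)
  · exact exists_reC_eq (chartDeriv_injective p (hsrc y (hOO₀ hy)))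
      (hxf _ (hOO₀ hy).2.1).2.1 (hXapp y) (Λ := (Λ y).toLinearMap) (hΛX y hy)
      (hZf _ (hOO₀ hy).2.2).2 (A := (A y).toLinearMap) (hAapp y) c

end LocalCoordinates

/-! ### Change of charts for Lipschitz maps and directional derivatives -/

section Fibration

theorem LipschitzOnWith.comp_locallyLipschitzOn {α β γ : Type*} [PseudoEMetricSpace α]
    [PseudoEMetricSpace β] [PseudoEMetricSpace γ] {g : β → γ} {f : α → β} {C : NNReal} {t : Set β}
    {s : Set α} (hg : LipschitzOnWith C g t) (hf : LocallyLipschitzOn s f) (hst : MapsTo f s t) :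
    LocallyLipschitzOn s fun x => g (f x) := fun x hx => by
  obtain ⟨K, u, hu, h⟩ := hf hx
  exact ⟨C * K, u ∩ s, Filter.inter_mem hu self_mem_nhdsWithin,
    hg.comp (h.mono inter_subset_left) fun y hy => hst hy.2⟩

variable {n : ℕ} {M : Type*} [TopologicalSpace M] [ChartedSpace (Euc n) M]
  [IsManifold (𝓡 n) ∞ M]

theorem contDiffAt_chart_transition (c c' : M) {y : Euc n} (hy : y ∈ (chartAt (Euc n) c).target)
    (hy' : (chartAt (Euc n) c).symm y ∈ (chartAt (Euc n) c').source) :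
    ContDiffAt ℝ 1 (fun y => chartAt (Euc n) c' ((chartAt (Euc n) c).symm y)) y := by
  have h : ContMDiffAt (𝓡 n) (𝓡 n) ∞
      (fun y => chartAt (Euc n) c' ((chartAt (Euc n) c).symm y)) y :=
    ((contMDiffOn_chart (I := 𝓡 n) (x := c')).contMDiffAt
      ((chartAt (Euc n) c').open_source.mem_nhds hy')).comp y
      ((contMDiffOn_chart_symm (I := 𝓡 n) (x := c)).contMDiffAt
        ((chartAt (Euc n) c).open_target.mem_nhds hy))
  exact h.contDiffAt.of_le (by simp)

theorem fderiv_chart_transition_apply (c c' : M) {x : M}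
    (hx : x ∈ (chartAt (Euc n) c).source) (hx' : x ∈ (chartAt (Euc n) c').source)
    (u : TangentSpace (𝓡 n) x) :
    fderiv ℝ (fun y => chartAt (Euc n) c' ((chartAt (Euc n) c).symm y)) (chartAt (Euc n) c x)
      (chartDeriv c x u) = chartDeriv c' x u := by
  have : IsManifold (𝓡 n) 1 M := IsManifold.of_le (n := ∞) (by simp)
  have hc := mdifferentiable_chart (I := 𝓡 n) c
  have hxt := (chartAt (Euc n) c).map_source hx
  have h1 : MDifferentiableAt (𝓡 n) (𝓡 n) (chartAt (Euc n) c')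
      ((chartAt (Euc n) c).symm (chartAt (Euc n) c x)) := by
    rw [(chartAt (Euc n) c).left_inv hx]
    exact (mdifferentiable_chart (I := 𝓡 n) c').mdifferentiableAt hx'
  have h2 := mfderiv_comp (chartAt (Euc n) c x) h1 (hc.mdifferentiableAt_symm hxt)
  rw [mfderiv_eq_fderiv] at h2
  have h3 := congrArg (fun L : Euc n →L[ℝ] Euc n => L (chartDeriv c x u)) h2
  refine h3.trans ?_
  have h4 := congrArg (fun L : TangentSpace (𝓡 n) x →L[ℝ] TangentSpace (𝓡 n) x => L u)
    (hc.symm_comp_deriv hx)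
  have h5 : mfderiv (𝓡 n) (𝓡 n) (chartAt (Euc n) c).symm (chartAt (Euc n) c x)
      (chartDeriv c x u) = u := h4
  change mfderiv (𝓡 n) (𝓡 n) (chartAt (Euc n) c')
    ((chartAt (Euc n) c).symm (chartAt (Euc n) c x)) (mfderiv (𝓡 n) (𝓡 n) (chartAt (Euc n) c).symm
      (chartAt (Euc n) c x) (chartDeriv c x u)) = _
  rw [h5, (chartAt (Euc n) c).left_inv hx]
  rfl

/-- Directional derivatives of a map that is Lipschitz in one chart can be computed in that
chart. -/
theorem hasDirDeriv_iff_hasLineDerivAt {d : ℕ} {p x : M} {f : Euc n → Euc d} {C : NNReal}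
    {s : Set (Euc n)} (hf : LipschitzOnWith C f s) (hs : s ∈ 𝓝 (chartAt (Euc n) p x))
    (hx : x ∈ (chartAt (Euc n) p).source) {u : TangentSpace (𝓡 n) x} {a : Euc d} :
    HasDirDeriv (fun q => f (chartAt (Euc n) p q)) x u a ↔
      HasLineDerivAt ℝ f a (chartAt (Euc n) p x) (chartDeriv p x u) := by
  have hxx := mem_chart_source (Euc n) x
  set τ : Euc n → Euc n := fun y => chartAt (Euc n) p ((chartAt (Euc n) x).symm y) with hτ
  have hτd : DifferentiableAt ℝ τ (chartAt (Euc n) x x) :=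
    (contDiffAt_chart_transition x p ((chartAt (Euc n) x).map_source hxx)
      (by rwa [(chartAt (Euc n) x).left_inv hxx])).differentiableAt (by simp)
  have hline : HasDerivAt (fun t : ℝ => chartAt (Euc n) x x + t • chartDeriv x x u)
      (chartDeriv x x u) 0 := by
    simpa using ((hasDerivAt_id (0 : ℝ)).smul_const (chartDeriv x x u)).const_add
      (chartAt (Euc n) x x)
  have h0 : chartAt (Euc n) x x + (0 : ℝ) • chartDeriv x x u = chartAt (Euc n) x x := by
    rw [zero_smul, add_zero]
  -- `HasDirDeriv` uses a straight line in the chart at `x`. In the chart at `p` it is a curve with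
  -- velocity `chartDeriv p x u`, and for Lipschitz `f` only the velocity matters.
  have hp : HasDerivAt (fun t : ℝ => τ (chartAt (Euc n) x x + t • chartDeriv x x u))
      (chartDeriv p x u) 0 := by
    have h1 : HasFDerivAt τ (fderiv ℝ τ (chartAt (Euc n) x x))
        (chartAt (Euc n) x x + (0 : ℝ) • chartDeriv x x u) := by
      rw [h0]
      exact hτd.hasFDerivAt
    have := h1.comp_hasDerivAt (0 : ℝ) hline
    rwa [hτ, fderiv_chart_transition_apply x p hxx hx] at this
  exact hf.hasDerivAt_comp_iff_hasLineDerivAt hs hp (by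
    simp only [h0, hτ, (chartAt (Euc n) x).left_inv hxx])

theorem isLipMapOn_chart_comp {Y : Type*} [PseudoEMetricSpace Y] {p : M} {f : Euc n → Y}
    {C : NNReal} {s : Set (Euc n)} (hf : LipschitzOnWith C f s) :
    IsLipMapOn n (fun q => f (chartAt (Euc n) p q))
      ((chartAt (Euc n) p).source ∩ chartAt (Euc n) p ⁻¹' s) := by
  intro c
  refine hf.comp_locallyLipschitzOn
    (f := fun y => chartAt (Euc n) p ((chartAt (Euc n) c).symm y)) ?_ fun y hy => hy.2.2
  exact ContDiffAt.comp_locallyLipschitzOn (f := id)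
    (g := fun y => chartAt (Euc n) p ((chartAt (Euc n) c).symm y))
    (fun y hy => contDiffAt_chart_transition c p hy.1 hy.2.1)
    (LocallyLipschitz.id.locallyLipschitzOn)

theorem isLipIntoOn_chart_symm_comp {Y : Type*} [PseudoEMetricSpace Y] {p : M} {f : Y → Euc n}
    {C : NNReal} {s : Set Y} (hf : LipschitzOnWith C f s)
    (hs : MapsTo f s (chartAt (Euc n) p).target) :
    IsLipIntoOn n (fun y => (chartAt (Euc n) p).symm (f y)) s := by
  refine ⟨(chartAt (Euc n) p).continuousOn_symm.comp hf.continuousOn hs, fun c => ?_⟩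
  exact ContDiffAt.comp_locallyLipschitzOn (f := f)
    (g := fun y => chartAt (Euc n) c ((chartAt (Euc n) p).symm y))
    (fun y hy => contDiffAt_chart_transition p c (hs hy.1) hy.2)
    (hf.locallyLipschitzOn.mono inter_subset_left)

end Fibration

/-! ### Lifting directions from the quotient -/

section Pullback

variable {k r d : ℕ} {T E : Type*} [AddCommGroup T] [Module ℝ T] [AddCommGroup E] [Module ℝ E]

/-- The coefficients of `u` and `v` differ from the real and imaginary parts of `c` by vectors in
the kernel of `D`. That kernel lies in `R`, so the corrected complex coefficient vector is still in
`R`. -/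
theorem exists_cplx_eq_of_directional {R : Submodule ℂ (Fin k → ℂ)} {X : (Fin k → ℝ) →ₗ[ℝ] E}
    {D : (Fin k → ℝ) →ₗ[ℝ] T} (hD : ∀ c, D c = 0 → toC c ∈ R) {u v : E} {c : Fin k → ℂ}
    (hc : c ∈ R) (hu : ∃ c', D c' = D (reC c) ∧ X c' = u) (hv : ∃ c', D c' = D (imC c) ∧ X c' = v) :
    ∃ c' ∈ R, cplx X c' = cvec u v := by
  obtain ⟨a, ha, rfl⟩ := hu
  obtain ⟨b, hb, rfl⟩ := hv
  refine ⟨toC a + Complex.I • toC b, ?_, ?_⟩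
  · have h1 := hD (a - reC c) (by rw [map_sub, ha, sub_self])
    have h2 := hD (b - imC c) (by rw [map_sub, hb, sub_self])
    have h3 : toC a + Complex.I • toC b
        = c + (toC (a - reC c) + Complex.I • toC (b - imC c)) := by
      conv_rhs => rw [← toC_reC_add c]
      simp only [map_sub, map_add, reC_smul, imC_smul, reC_toC, imC_toC, Complex.I_re,
        Complex.I_im, zero_smul, one_smul, smul_zero, sub_zero, add_zero, zero_add]
      module
    rw [h3]
    exact R.add_mem hc (R.add_mem h1 (R.smul_mem _ h2))
  · rw [cplx_apply]
    simp only [map_add, reC_smul, imC_smul, reC_toC, imC_toC, Complex.I_re, Complex.I_im,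
      zero_smul, one_smul, smul_zero, sub_zero, add_zero, zero_add]

end Pullback

/-! ### The theorem on the manifold -/

theorem proposition6p1 {n : ℕ} {M : Type*} [TopologicalSpace M] [T2Space M]
    [ChartedSpace (Euc n) M] [IsManifold (𝓡 n) ∞ M]
    (S : ∀ q : M, Submodule ℂ (CTangent n q))
    (hS : IsLipSubbundleOn S univ)
    (hSS : IsLipSubbundleOn (fun q => S q ⊔ conjSub (S q)) univ)
    (hinv : IsInvolutiveOn S univ)
    (hV : HypothesisV S) (p : M) :
    ∃ (U : Set M) (d : ℕ) (W : Set (Euc d)) (π : M → Euc d)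
      (S' : ∀ y : Euc d, Submodule ℂ (CTangent d y)),
      IsOpen U ∧ p ∈ U ∧ IsOpen W ∧
      d + Module.finrank ℝ (realVecs (S p)) = n ∧
      IsLipFibration (n := n) (Module.finrank ℝ (realVecs (S p))) π U W ∧
      IsLeviFlatCROn S' W ∧
      ∀ x ∈ U, (S x : Set (CTangent n x)) = preimageFibre π S' x := by
  obtain ⟨l, k, r, O, X, A, hlk, hkn, hl, hO, hpO, hOt, hX, hA, hXi, hAi, hcomm, hbr, hker, hre,
    hmem⟩ := exists_flat_data hS hinv hV p
  obtain ⟨ρ, Φ, C, D, Q, hρ, hsrc, hpΦ, hΦO, hΦ, hΦs, hLF, hpt⟩ :=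
    exists_flat_fibration (d := n - l) hlk (by omega) (by omega) hO hpO hX hA (hXi _ hpO)
      (hAi _ hpO) hcomm hbr hker hre
  rw [hl]
  set e := chartAt (Euc n) p with he
  have hpe : p ∈ e.source := mem_chart_source _ p
  have hsrc' : Φ.source = Metric.ball (0 : Euc l) ρ ×ˢ Metric.ball (0 : Euc (n - l)) ρ := by
    rw [hsrc, ball_prod_same, Prod.mk_zero_zero]
  have hg : LipschitzOnWith C (fun y => (Φ.symm y).2) Φ.target := by
    have := LipschitzWith.prod_snd.comp_lipschitzOnWith hΦs
    rwa [one_mul] at this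
  have hmaps : ∀ x ∈ e.source ∩ e ⁻¹' Φ.target, (Φ.symm (e x)).2 ∈ Metric.ball (0 : Euc (n - l)) ρ :=
    fun x hx => (hsrc' ▸ Φ.map_target hx.2 : Φ.symm (e x) ∈ _ ×ˢ _).2
  refine ⟨e.source ∩ e ⁻¹' Φ.target, n - l, Metric.ball 0 ρ, fun q => (Φ.symm (e q)).2,
    projBundle D Q, e.isOpen_inter_preimage Φ.open_target, ⟨hpe, hpΦ⟩, Metric.isOpen_ball,
    by omega, ⟨isLipMapOn_chart_comp hg, ?_, fun y hy => ⟨Metric.ball 0 ρ, Metric.isOpen_ball, hy,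
      Subset.rfl, Metric.ball 0 ρ, e.trans Φ.symm, Metric.isOpen_ball, ?_, ?_, fun x _ => rfl,
      ?_, ?_⟩⟩, hLF, fun x hx => ?_⟩
  -- Surjectivity is witnessed on the transversal `{0} × ball`. The sup norm makes the box a product
  -- of balls, so one global trivialization serves every point of the base.
  · refine Subset.antisymm (image_subset_iff.2 hmaps) fun y hy => ?_
    have h0 : ((0 : Euc l), y) ∈ Φ.source := by
      rw [hsrc']
      exact ⟨Metric.mem_ball_self hρ, hy⟩
    have h1 := Φ.map_source h0
    have h2 := hOt (hΦO h1)
    refine ⟨e.symm (Φ (0, y)), ⟨e.map_target h2, ?_⟩, ?_⟩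
    · rwa [mem_preimage, e.right_inv h2]
    · simp only [e.right_inv h2, Φ.left_inv h0]
  · exact Subset.antisymm (fun x hx => ⟨hx, hmaps x hx⟩) inter_subset_left
  · rw [← hsrc']
    refine (OpenPartialHomeomorph.trans_target _ _).trans ?_
    exact inter_eq_left.2 fun v hv => hOt (hΦO (Φ.map_source hv))
  · exact isLipMapOn_chart_comp hΦs
  · have ht : (e.trans Φ.symm).target = Φ.source :=
      (OpenPartialHomeomorph.trans_target _ _).trans
        (inter_eq_left.2 fun v hv => hOt (hΦO (Φ.map_source hv)))
    rw [ht]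
    exact isLipIntoOn_chart_symm_comp hΦ fun v hv => hOt (hΦO (Φ.map_source hv))
  · have hSx : ∀ w : CTangent n x, w ∈ S x ↔
        ∃ v, cplx (X (e x)).toLinearMap (A (e x) v) = (chartDeriv p x).baseChange ℂ w := by
      have h := hmem (e x) (hΦO hx.2)
      rwa [e.left_inv hx.1] at h
    obtain ⟨hfwd, hbwd, hran, hDker⟩ := hpt (e x) hx.2
    have hdir : ∀ (u : TangentSpace (𝓡 n) x) (a : Euc (n - l)),
        HasDirDeriv (fun q => (Φ.symm (e q)).2) x u a ↔
          HasLineDerivAt ℝ (fun y => (Φ.symm y).2) a (e x) (chartDeriv p x u) := fun u a =>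
      hasDirDeriv_iff_hasLineDerivAt hg (Φ.open_target.mem_nhds hx.2) hx.1
    ext w
    constructor
    -- A vector of `S x` is a complex combination of the frame, and `π` has directional derivatives
    -- along frame combinations at every point, given by `D`.
    · intro hw
      obtain ⟨v, hv⟩ := (hSx w).1 hw
      have h1 := congrArg rePart hv
      have h2 := congrArg imPart hv
      rw [rePart_baseChange, cplx_apply, rePart_cvec] at h1
      rw [imPart_baseChange, cplx_apply, imPart_cvec] at h2
      refine ⟨D (reC (A (e x) v)), D (imC (A (e x) v)), (hdir _ _).2 ?_, (hdir _ _).2 ?_, ?_⟩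
      · rw [← h1]
        exact hfwd _
      · rw [← h2]
        exact hfwd _
      · have h3 : A (e x) v ∈ LinearMap.range (Q (Φ.symm (e x)).2).toLinearMap := by
          rw [hran]
          exact ⟨v, rfl⟩
        obtain ⟨v', hv'⟩ := h3
        have hv'' : Q (Φ.symm (e x)).2 v' = A (e x) v := hv'
        refine mem_projBundle.2 ⟨v', ?_⟩
        rw [hv'', cplx_apply]
        rfl
    -- Existence of the directional derivatives with values in the range of `D` forces both
    -- directions into the span of the frame. The remaining ambiguity lies in the kernel of `D`,
    -- hence in `S x`.
    · rintro ⟨a, b, ha, hb, hab⟩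
      obtain ⟨v, hv⟩ := mem_projBundle.1 hab
      have h3 : Q (Φ.symm (e x)).2 v ∈ LinearMap.range (A (e x)).toLinearMap := by
        rw [← hran]
        exact ⟨v, rfl⟩
      rw [cplx_apply] at hv
      have hre' : rePart (cvec a b) = a := rePart_cvec a b
      have him' : imPart (cvec a b) = b := imPart_cvec a b
      have h1 : D (reC (Q (Φ.symm (e x)).2 v)) = a := by
        have := congrArg (rePart (V := Euc (n - l))) hv
        rw [rePart_cvec] at this
        exact this.trans hre'
      have h2 : D (imC (Q (Φ.symm (e x)).2 v)) = b := by
        have := congrArg (imPart (V := Euc (n - l))) hv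
        rw [imPart_cvec] at this
        exact this.trans him'
      have ha' := hbwd (reC (Q (Φ.symm (e x)).2 v)) _ (by rw [h1]; exact (hdir _ _).1 ha)
      have hb' := hbwd (imC (Q (Φ.symm (e x)).2 v)) _ (by rw [h2]; exact (hdir _ _).1 hb)
      obtain ⟨c, ⟨v', hv'⟩, hc⟩ := exists_cplx_eq_of_directional (X := (X (e x)).toLinearMap)
        (D := D.toLinearMap) hDker h3 ha' hb'
      refine (hSx w).2 ⟨v', ?_⟩
      rw [baseChange_eq_cvec, ← hc, ← hv']
      rfl
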